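/- **Proposition 3.1.** Let $a,b\ge 0$ be integers, $m=b-a-1$, $n=(a+2)(b+1)$, and let $$M=A_{m,n}=\begin{pmatrix}0&1&0\\0&0&1\\1&-m&-n\end{pmatrix}\in SL(3,\mathbb Z).$$ The characteristic polynomial of $M$ is irreducible over $\mathbb Q$ and has three distinct real roots. Consider the three planes in $\mathbb R^3$ spanned by pairs of linearly independent eigenvectors of $M$. The connected components of the complement of their union are called open orthants. The sail of an open orthant $O$ is the boundary of the convex hull of all nonzero integer points in the closure of $O$; its vertices, edges and triangles are the proper faces of this convex hull of dimension $0$, $1$, $2$. There is exactly one open orthant $O$ for which this convex hull contains $(0,0,1)$. Let $S$ be its sail and let $\Xi$ be the group of all $g\in SL(3,\mathbb Z)$ with $gM=Mg$ and $g(S)=S$. Put $$A=(1,0,a+2),\quad B=(0,0,1),\quad C=(b-a-1,1,0),\quad D=((b+1)^2,b+1,1),$$ $$X=M^{-2},\qquad Y=M^{-1}\bigl(M^{-1}-(b+1)I\bigr).$$ Then the following holds. 1. (Torus triangulation.) Decompose the factor space $S/\Xi$ into the images of the faces of $S$. There is a homeomorphism of $S/\Xi$ onto the torus $\mathbb R^2/\mathbb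 Z^2$ that carries this decomposition, dimension by dimension, to the following one, obtained from a square $ABCD$ cut by the diagonal $BD$ by gluing its opposite sides by translations ($AB$ to $DC$ and $AD$ to $BC$): one vertex, three edges (the images of $AB$, $AD$, $BD$), and two triangles $ABD$ and $BCD$. 2. (Period group.) $X,Y\in SL(3,\mathbb Z)$, and $\Xi$ is the free abelian group of rank two with the generators $X$ and $Y$. Moreover $X(A)=D$, $X(B)=C$, $Y(A)=B$, $Y(D)=C$. 3. (Fundamental region.) $A,B,C,D$ are vertices of $S$. The vertex $B$, the edges $AB$, $AD$, $BD$ and the triangles $ABD$, $BCD$ are faces of $S$, and every face of $S$ is equivalent under $\Xi$ to exactly one of these six faces. Hence the union of these six faces, taken relatively open, is a fundamental region of $S$; its closure is the union of the closed triangles $ABD$ and $BCD$. 4. (Integer invariants.) The integer points strictly inside the segment $BD$ are exactly $((b+1)i,\,i,\,1)$, $1\le i\le b$. The integer lengths of $AB$, $BC$, $CD$, $DA$, $BD$ are $1,1,1,1,b+1$. The integer areas of the triangles $ABD$ and $BCD$ both equal $b+1$. The integer distances from the origin to the planes $ABD$ and $BCD$ equal $1$ and $a+2$ respectively. Here the integer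 length (area) of an integer segment (triangle) is the ratio of its Euclidean length (area) to the minimal Euclidean length (area) of a nondegenerate segment (triangle) with integer vertices in the same line (plane). The integer distance from an integer plane to an integer point is the ratio of the Euclidean distance between them to the minimal Euclidean distance from the plane to an integer point outside it. -/

import Mathlib

open MeasureTheory
open scoped MatrixGroups

noncomputable section

namespace KleinPolyhedron

/-- Three-dimensional Euclidean space. -/
abbrev Space : Type := EuclideanSpace ℝ (Fin 3)

/-- Integer points: all the coordinates are integers. -/
def IsIntegerPoint (x : Space) : Prop := ∀ i, ∃ k : ℤ, x i = k

/-- The operator of `SL(3, ℤ)` acting on space by its matrix (on column vectors). -/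
def toOperator (g : SL(3, ℤ)) : Space →ₗ[ℝ] Space :=
  Matrix.toEuclideanLin ((g : Matrix (Fin 3) (Fin 3) ℤ).map (Int.cast : ℤ → ℝ))

/-- The Frobenius operator with parameters `m`, `n`. -/
def frobeniusOperator (m n : ℤ) : SL(3, ℤ) :=
  ⟨!![0, 1, 0; 0, 0, 1; 1, -m, -n], by simp [Matrix.det_fin_three]⟩

/-! ### Orthants and sails -/

/-- A vector that is an eigenvector of the operator `M`, for some real eigenvalue. -/
def IsEigenvector (M : SL(3, ℤ)) (v : Space) : Prop :=
  ∃ μ : ℝ, Module.End.HasEigenvector (toOperator M) μ v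

/-- The planes spanned by pairs of linearly independent eigenvectors of `M`. -/
def eigenplanes (M : SL(3, ℤ)) : Set (Submodule ℝ Space) :=
  {H | ∃ u v : Space, IsEigenvector M u ∧ IsEigenvector M v ∧
    LinearIndependent ℝ ![u, v] ∧ H = Submodule.span ℝ {u, v}}

/-- The complement to the union of these planes. -/
def planesComplement (M : SL(3, ℤ)) : Set Space :=
  {x | ∀ H ∈ eigenplanes M, x ∉ H}

/-- The open orthants of `M`: the connected components of the complement to the planes. -/
def IsOrthant (M : SL(3, ℤ)) (O : Set Space) : Prop :=
  ∃ x ∈ planesComplement M, O = connectedComponentIn (planesComplement M) x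

/-- The convex hull of all the nonzero integer points in the closure of the orthant `O`. -/
def integerHull (O : Set Space) : Set Space :=
  convexHull ℝ {x | x ∈ closure O ∧ IsIntegerPoint x ∧ x ≠ 0}

/-- The sail of the orthant `O`: the boundary of this convex hull. -/
def sail (O : Set Space) : Set Space := frontier (integerHull O)

/-- `F` is a (closed) `k`-dimensional face of the sail of `O`: a nonempty proper face of the
convex hull, that is, its set of contact with a supporting plane, of dimension `k`. -/
def IsFace (O : Set Space) (k : ℕ) (F : Set Space) : Prop :=
  F.Nonempty ∧ F ≠ integerHull O ∧ IsExposed ℝ (integerHull O) F ∧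
    Module.finrank ℝ (vectorSpan ℝ F) = k

/-! ### The period group, the torus and its triangulation -/

/-- The group of the integer operators of determinant one that commute with `M` and map the
sail of `O` to itself. -/
def periodGroup (M : SL(3, ℤ)) (O : Set Space) : Subgroup SL(3, ℤ) where
  carrier := {g | g * M = M * g ∧ toOperator g '' sail O = sail O}
  one_mem' := by
    refine ⟨by simp, ?_⟩
    have h : toOperator 1 = LinearMap.id := by
      ext x i
      simp [toOperator]
    simp [h]
  mul_mem' := by
    rintro g h ⟨hg, hg'⟩ ⟨hh, hh'⟩
    refine ⟨by rw [mul_assoc, hh, ← mul_assoc, hg, mul_assoc], ?_⟩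
    have e : toOperator (g * h) = toOperator g ∘ₗ toOperator h := by
      ext x i
      simp [toOperator, Matrix.toLpLin_apply, Matrix.map_mul_intCast]
    rw [e, LinearMap.coe_comp, Set.image_comp, hh', hg']
  inv_mem' := by
    rintro g ⟨hg, hg'⟩
    refine ⟨by rw [inv_mul_eq_iff_eq_mul, ← mul_assoc, hg, mul_assoc, mul_inv_cancel, mul_one], ?_⟩
    have e : ∀ x, toOperator g⁻¹ (toOperator g x) = x := by
      intro x
      have e1 : toOperator (g⁻¹ * g) = toOperator g⁻¹ ∘ₗ toOperator g := by
        ext x i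
        simp only [toOperator, Matrix.SpecialLinearGroup.coe_mul, Matrix.map_mul_intCast,
          Matrix.toLpLin_apply, LinearMap.comp_apply, Matrix.mulVec_mulVec]
      have e2 : toOperator (g⁻¹ * g) = LinearMap.id := by
        ext x i
        simp [toOperator]
      rw [← LinearMap.comp_apply, ← e1, e2, LinearMap.id_apply]
    conv_lhs => rw [← hg']
    rw [← Set.image_comp]
    convert Set.image_id _
    exact funext e

/-- Two points of the sail are equivalent if an element of the period group maps one to the
other. -/
def periodSetoid (M : SL(3, ℤ)) (O : Set Space) : Setoid (sail O) where
  r x y := ∃ g ∈ periodGroup M O, toOperator g x = y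
  iseqv := by
    have one : ∀ x, toOperator 1 x = x := fun x => by
      have : toOperator 1 = LinearMap.id := by
        ext x i
        simp [toOperator]
      rw [this, LinearMap.id_apply]
    have mul : ∀ g h x, toOperator (g * h) x = toOperator g (toOperator h x) := fun g h x => by
      simp only [toOperator, Matrix.SpecialLinearGroup.coe_mul, Matrix.map_mul_intCast,
          Matrix.toLpLin_apply, Matrix.mulVec_mulVec]
    refine ⟨fun x => ⟨1, one_mem _, one _⟩, ?_, ?_⟩
    · rintro x y ⟨g, hg, h⟩
      exact ⟨g⁻¹, inv_mem hg, by rw [← h, ← mul, inv_mul_cancel, one]⟩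
    · rintro x y z ⟨g, hg, h⟩ ⟨g', hg', h'⟩
      exact ⟨g' * g, mul_mem hg' hg, by rw [mul, h, h']⟩

/-- The factor of the sail under the action of the period group, with the quotient topology. -/
abbrev SailFactor (M : SL(3, ℤ)) (O : Set Space) : Type := Quotient (periodSetoid M O)

/-- The torus triangulation: the decomposition of the factor into the images of the faces of the
sail; `torusTriangulation M O k` is the family of the (closed) `k`-dimensional cells. -/
def torusTriangulation (M : SL(3, ℤ)) (O : Set Space) (k : ℕ) : Set (Set (SailFactor M O)) :=
  {c | ∃ F, IsFace O k F ∧ c = Quotient.mk (periodSetoid M O) '' (Subtype.val ⁻¹' F)}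

/-- Two decompositions of topological spaces into cells are homeomorphic: some homeomorphism of
the spaces carries the `k`-dimensional cells of the one to those of the other, for all `k`. -/
def HomeomorphicDecompositions {S T : Type} [TopologicalSpace S] [TopologicalSpace T]
    (c : ℕ → Set (Set S)) (d : ℕ → Set (Set T)) : Prop :=
  ∃ φ : S ≃ₜ T, ∀ k, (fun s => φ '' s) '' c k = d k

/-- The projection of the plane to the torus `(ℝ/ℤ)²`. -/
def toTorus (p : ℝ × ℝ) : UnitAddCircle × UnitAddCircle := (p.1, p.2)

/-- The model: the square with vertices `B = (0, 0)`, `C = (1, 0)`, `D = (1, 1)`, `A = (0, 1)`,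
cut by its diagonal `BD` into the triangles `ABD` and `BCD`, its opposite sides being glued by
translations. It has one vertex, three edges and two triangles. -/
def squareTriangulation : ℕ → Set (Set (UnitAddCircle × UnitAddCircle))
  | 0 => {toTorus '' {(0, 0)}}
  | 1 => {toTorus '' segment ℝ (0, 0) (1, 0), toTorus '' segment ℝ (0, 0) (0, 1),
      toTorus '' segment ℝ (0, 0) (1, 1)}
  | 2 => {toTorus '' convexHull ℝ {(0, 1), (0, 0), (1, 1)},
      toTorus '' convexHull ℝ {(0, 0), (1, 0), (1, 1)}}
  | _ => ∅

/-- A family of faces of the sail that contains exactly one face from each equivalence class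
under the period group. -/
def IsFundamentalFamily (M : SL(3, ℤ)) (O : Set Space) (𝓕 : Set (Set Space)) : Prop :=
  (∀ F ∈ 𝓕, ∃ k, IsFace O k F) ∧
    ∀ k F, IsFace O k F → ∃! F', F' ∈ 𝓕 ∧ ∃ g ∈ periodGroup M O, toOperator g '' F = F'

/-- The union of the faces of the family. The faces are taken relatively open here, so that
different faces are disjoint. -/
def openFaceUnion (𝓕 : Set (Set Space)) : Set Space :=
  ⋃ F ∈ 𝓕, intrinsicInterior ℝ F

/-- A fundamental region of the sail: a union of faces that contains exactly one face from each
equivalence class. -/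
def IsFundamentalRegion (M : SL(3, ℤ)) (O : Set Space) (R : Set Space) : Prop :=
  ∃ 𝓕, IsFundamentalFamily M O 𝓕 ∧ R = openFaceUnion 𝓕

/-! ### Integer lengths, areas and distances -/

/-- The Euclidean `k`-dimensional volume. -/
def euclideanVolume (k : ℕ) (P : Set Space) : ℝ := (μHE[k] P).toReal

/-- The integer `k`-dimensional volume of the `k`-dimensional integer polyhedron `P`: the ratio
of its Euclidean volume to the minimal Euclidean volume of a `k`-dimensional simplex with integer
vertices in the same `k`-dimensional affine subspace. -/
def integerVolume (k : ℕ) (P : Set Space) : ℝ :=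
  euclideanVolume k P /
    sInf {V | ∃ w : Fin (k + 1) → Space, AffineIndependent ℝ w ∧
      (∀ i, IsIntegerPoint (w i) ∧ w i ∈ affineSpan ℝ P) ∧
      V = euclideanVolume k (convexHull ℝ (Set.range w))}

/-- The integer length of the segment `PQ`. -/
def integerLength (P Q : Space) : ℝ := integerVolume 1 (segment ℝ P Q)

/-- The integer area of the triangle `PQR`. -/
def integerArea (P Q R : Space) : ℝ := integerVolume 2 (convexHull ℝ {P, Q, R})

/-- The integer distance from the integer plane `H` to the integer point `p`: the ratio of the
Euclidean distance to the minimal Euclidean distance from `H` to an integer point outside `H`. -/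
def integerDistance (H : AffineSubspace ℝ Space) (p : Space) : ℝ :=
  Metric.infDist p (H : Set Space) /
    sInf {d | ∃ q, IsIntegerPoint q ∧ q ∉ H ∧ d = Metric.infDist q (H : Set Space)}

end KleinPolyhedron

end

open KleinPolyhedron

open MeasureTheory
open scoped MatrixGroups

noncomputable section

namespace KleinPolyhedron

/-! ### The action of integer matrices -/

/-! The characteristic equation of M⁻¹ is t (t + a + 2) (t - (b + 1)) = 1, so t, t + a + 2 and t -
(b + 1) are units of the cubic order ℤ[t]. The eigencoordinates `Roots.coord`, normalized to be 1 at
B, identify ℤ³ with ℤ[t] and B with the number 1. The orthant of B becomes the set `Roots.orth` of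
totally positive points. X multiplies by t², Y⁻¹ multiplies by t + a + 2, and both are totally
positive. The points A, B, C, D are t + a + 2, 1, t², t² (t + a + 2): the corners of a unit square
in the exponents κ of `unit`.

Let `triFun` be the linear forms equal to 1 on ABD and on BCD. Both are positive on the orthant.
Form ABD is integral, hence at least 1 at totally positive integer points. Form BCD has denominator
a + 2, and excluding its values below 1 is the arithmetic core, `Roots.one_le_funBCD`. So all
integer points of the orthant lie in the polyhedron `Roots.hull`, cut out by the orbits of the two
forms under the units.

Conversely, at a given point of the orthant the values of the forms of the orbit have a minimum,
since their coefficients are integers over a common denominator and they are positive on the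
orthant. The difference between the form of a neighbouring triangle and that of a given one is a
positive multiple of the barycentric coordinate opposite to their common edge. Minimality thus says
that the point lies, after a unit, in the cone over ABD or BCD. Hence the hull of the integer points
is this polyhedron (`Roots.integerHull_eq`), and the translates of the two triangles cover its
boundary (`Roots.sail_eq`, `Roots.exists_mem_tri`).

Each face is the contact set of a form that is at least 1 on the polyhedron. If it contains a point
that is not a vertex, its form is 1 on some edge of a triangle, hence is a convex combination of the
forms of the two triangles at that edge (`face_of_edge`). This leaves the six faces up to units. An
element of the period group is diagonal in the eigencoordinates and sends B to a vertex, that is, to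
the image of B under some unit; as B is a cyclic vector, the element is that unit
(`Roots.mem_periodGroup_iff`). No unit theorem is needed; the independence of X and Y comes from a
nonzero regulator.

For the torus, the piecewise linear map `param` of the square onto the two triangles has, after
passing to the factor, the same fibres as the projection of the square to ℝ²/ℤ². Both are continuous
surjections from a compact space, so a homeomorphism follows once the factor is Hausdorff, which
logarithmic coordinates show. The integer invariants are determinants in explicit lattice bases, and
distances are values of primitive integer forms. -/

lemma toOperator_apply (g : SL(3, ℤ)) (v : Space) (i : Fin 3) :
    toOperator g v i = g i 0 * v 0 + g i 1 * v 1 + g i 2 * v 2 := by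
  simp [toOperator, Matrix.toLpLin_apply, Matrix.mulVec, dotProduct, Fin.sum_univ_three]

lemma toOperator_one (v : Space) : toOperator 1 v = v := by
  ext i
  fin_cases i <;> simp [toOperator_apply]

lemma toOperator_mul (g h : SL(3, ℤ)) (v : Space) :
    toOperator (g * h) v = toOperator g (toOperator h v) := by
  simp only [toOperator, Matrix.SpecialLinearGroup.coe_mul, Matrix.map_mul_intCast,
    Matrix.toLpLin_apply, Matrix.mulVec_mulVec]

lemma toOperator_inv_cancel (g : SL(3, ℤ)) (v : Space) :
    toOperator g⁻¹ (toOperator g v) = v := by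
  rw [← toOperator_mul, inv_mul_cancel, toOperator_one]

lemma toOperator_cancel_inv (g : SL(3, ℤ)) (v : Space) :
    toOperator g (toOperator g⁻¹ v) = v := by
  rw [← toOperator_mul, mul_inv_cancel, toOperator_one]

lemma toOperator_inv_eq {g : SL(3, ℤ)} {v w : Space} (h : toOperator g w = v) :
    toOperator g⁻¹ v = w := by
  rw [← h, toOperator_inv_cancel]

lemma IsIntegerPoint.map {v : Space} (hv : IsIntegerPoint v) (g : SL(3, ℤ)) :
    IsIntegerPoint (toOperator g v) := by
  intro i
  obtain ⟨x, hx⟩ := hv 0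
  obtain ⟨y, hy⟩ := hv 1
  obtain ⟨z, hz⟩ := hv 2
  exact ⟨g i 0 * x + g i 1 * y + g i 2 * z, by rw [toOperator_apply, hx, hy, hz]; push_cast; rfl⟩

lemma space_ext {v w : Space} (h0 : v 0 = w 0) (h1 : v 1 = w 1) (h2 : v 2 = w 2) : v = w := by
  ext i
  fin_cases i <;> assumption

/-! ### The operator and its units -/

/-- The operator of the family with the parameters `a`, `b`. -/
def frob (a b : ℕ) : SL(3, ℤ) := frobeniusOperator (b - a - 1) ((a + 2) * (b + 1))

/-- The generator `M⁻²` of the period group, written out. -/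
def unitX (a b : ℕ) : SL(3, ℤ) :=
  ⟨!![((b : ℤ) - a - 1) ^ 2 + (a + 2) * (b + 1), ((b : ℤ) - a - 1) * ((a + 2) * (b + 1)) + 1,
      (b : ℤ) - a - 1;
    (b : ℤ) - a - 1, ((a : ℤ) + 2) * (b + 1), 1; 1, 0, 0], by
    simp [Matrix.det_fin_three]⟩

/-- The generator `M⁻¹ (M⁻¹ - (b + 1))` of the period group, written out. -/
def unitY (a b : ℕ) : SL(3, ℤ) :=
  ⟨!![((a : ℤ) + 2) ^ 2, 1 - ((a : ℤ) + 2) ^ 2 * (b + 1), -((a : ℤ) + 2);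
    -((a : ℤ) + 2), ((a : ℤ) + 2) * (b + 1), 1; 1, -((b : ℤ) + 1), 0], by
    simp [Matrix.det_fin_three]; ring⟩

variable {a b : ℕ}

lemma frob_coe : (frob a b : Matrix (Fin 3) (Fin 3) ℤ) =
    !![0, 1, 0; 0, 0, 1; 1, -((b : ℤ) - a - 1), -(((a : ℤ) + 2) * (b + 1))] := rfl

lemma unitX_coe : (unitX a b : Matrix (Fin 3) (Fin 3) ℤ) =
    !![((b : ℤ) - a - 1) ^ 2 + (a + 2) * (b + 1), ((b : ℤ) - a - 1) * ((a + 2) * (b + 1)) + 1,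
      (b : ℤ) - a - 1;
    (b : ℤ) - a - 1, ((a : ℤ) + 2) * (b + 1), 1; 1, 0, 0] := rfl

lemma unitY_coe : (unitY a b : Matrix (Fin 3) (Fin 3) ℤ) =
    !![((a : ℤ) + 2) ^ 2, 1 - ((a : ℤ) + 2) ^ 2 * (b + 1), -((a : ℤ) + 2);
    -((a : ℤ) + 2), ((a : ℤ) + 2) * (b + 1), 1; 1, -((b : ℤ) + 1), 0] := rfl

/-- The inverse of the operator, written out. -/
def frobInv (a b : ℕ) : SL(3, ℤ) :=
  ⟨!![(b : ℤ) - a - 1, (a + 2) * (b + 1), 1; 1, 0, 0; 0, 1, 0], by simp [Matrix.det_fin_three]⟩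

lemma frobInv_coe : (frobInv a b : Matrix (Fin 3) (Fin 3) ℤ) =
    !![(b : ℤ) - a - 1, (a + 2) * (b + 1), 1; 1, 0, 0; 0, 1, 0] := rfl

lemma frob_inv : (((frob a b)⁻¹ : SL(3, ℤ)) : Matrix (Fin 3) (Fin 3) ℤ) =
    !![(b : ℤ) - a - 1, (a + 2) * (b + 1), 1; 1, 0, 0; 0, 1, 0] := by
  have h : frob a b * frobInv a b = 1 := by
    ext i j
    rw [Matrix.SpecialLinearGroup.coe_mul, frob_coe, frobInv_coe]
    fin_cases i <;> fin_cases j <;> simp [Matrix.mul_apply, Fin.sum_univ_three]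
  rw [inv_eq_of_mul_eq_one_right h, frobInv_coe]

lemma unitX_eq : unitX a b = (frob a b)⁻¹ ^ 2 := by
  ext i j
  rw [pow_two, Matrix.SpecialLinearGroup.coe_mul, frob_inv, unitX_coe]
  fin_cases i <;> fin_cases j <;>
    simp [Matrix.mul_apply, Fin.sum_univ_three, pow_two]

lemma unitY_eq : (unitY a b : Matrix (Fin 3) (Fin 3) ℤ) =
    ((frob a b)⁻¹ : SL(3, ℤ)) *
      ((((frob a b)⁻¹ : SL(3, ℤ)) : Matrix (Fin 3) (Fin 3) ℤ) - ((b : ℤ) + 1) • 1) := by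
  rw [frob_inv, unitY_coe]
  ext i j
  rw [Matrix.mul_apply, Fin.sum_univ_three]
  simp only [Matrix.sub_apply, Matrix.smul_apply]
  fin_cases i <;> fin_cases j <;> simp [Matrix.one_apply] <;> ring

lemma unitX_comm : unitX a b * frob a b = frob a b * unitX a b := by
  rw [unitX_eq]
  exact ((Commute.refl (frob a b)).inv_left.pow_left 2).eq

lemma unitY_comm : unitY a b * frob a b = frob a b * unitY a b := by
  ext i j
  rw [Matrix.SpecialLinearGroup.coe_mul, Matrix.SpecialLinearGroup.coe_mul, unitY_coe, frob_coe]
  fin_cases i <;> fin_cases j <;> simp [Matrix.mul_apply, Fin.sum_univ_three] <;> ring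

lemma unitX_unitY_comm : unitX a b * unitY a b = unitY a b * unitX a b := by
  have h : Commute (unitY a b) (frob a b) := unitY_comm
  rw [unitX_eq]
  exact (h.inv_right.pow_right 2).eq.symm

lemma frob_apply (v : Space) : toOperator (frob a b) v =
    !₂[v 1, v 2, v 0 - ((b : ℝ) - a - 1) * v 1 - (a + 2) * (b + 1) * v 2] := by
  apply space_ext <;> rw [toOperator_apply, frob_coe] <;> simp
  ring

lemma unitX_apply (v : Space) : toOperator (unitX a b) v =
    !₂[(((b : ℝ) - a - 1) ^ 2 + (a + 2) * (b + 1)) * v 0 +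
        (((b : ℝ) - a - 1) * ((a + 2) * (b + 1)) + 1) * v 1 + ((b : ℝ) - a - 1) * v 2,
      ((b : ℝ) - a - 1) * v 0 + (a + 2) * (b + 1) * v 1 + v 2, v 0] := by
  apply space_ext <;> rw [toOperator_apply, unitX_coe] <;> simp

lemma unitY_apply (v : Space) : toOperator (unitY a b) v =
    !₂[((a : ℝ) + 2) ^ 2 * v 0 + (1 - ((a : ℝ) + 2) ^ 2 * (b + 1)) * v 1 - ((a : ℝ) + 2) * v 2,
      -((a : ℝ) + 2) * v 0 + (a + 2) * (b + 1) * v 1 + v 2, v 0 - ((b : ℝ) + 1) * v 1] := by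
  apply space_ext <;> rw [toOperator_apply, unitY_coe] <;> simp <;> ring

lemma unitX_inv_apply (v : Space) : toOperator (unitX a b)⁻¹ v =
    !₂[v 2, v 0 - ((b : ℝ) - a - 1) * v 1 - (a + 2) * (b + 1) * v 2,
      v 1 - ((b : ℝ) - a - 1) * v 2 - (a + 2) * (b + 1) *
        (v 0 - ((b : ℝ) - a - 1) * v 1 - (a + 2) * (b + 1) * v 2)] := by
  apply toOperator_inv_eq
  rw [unitX_apply]
  apply space_ext <;> simp <;> ring

lemma unitY_inv_apply (v : Space) : toOperator (unitY a b)⁻¹ v =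
    !₂[((b : ℝ) + 1) * v 0 + (a + 2) * (b + 1) * v 1 + v 2, v 0 + ((a : ℝ) + 2) * v 1,
      v 1 + ((a : ℝ) + 2) * v 2] := by
  apply toOperator_inv_eq
  rw [unitY_apply]
  apply space_ext <;> simp <;> ring

/-! ### The corners of the fundamental region -/

/-- The vertex `A`. -/
def ptA (a : ℕ) : Space := !₂[1, 0, (a : ℝ) + 2]

/-- The vertex `B`. -/
def ptB : Space := !₂[0, 0, 1]

/-- The vertex `C`. -/
def ptC (a b : ℕ) : Space := !₂[(b : ℝ) - a - 1, 1, 0]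

/-- The vertex `D`. -/
def ptD (b : ℕ) : Space := !₂[((b : ℝ) + 1) ^ 2, (b : ℝ) + 1, 1]

lemma unitX_ptA : toOperator (unitX a b) (ptA a) = ptD b := by
  rw [unitX_apply]
  apply space_ext <;> simp [ptA, ptD] <;> ring

lemma unitX_ptB : toOperator (unitX a b) ptB = ptC a b := by
  rw [unitX_apply]
  apply space_ext <;> simp [ptB, ptC]

lemma unitY_ptA : toOperator (unitY a b) (ptA a) = ptB := by
  rw [unitY_apply]
  apply space_ext <;> simp [ptA, ptB]
  ring

lemma unitY_ptD : toOperator (unitY a b) (ptD b) = ptC a b := by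
  rw [unitY_apply]
  apply space_ext <;> simp [ptD, ptC] <;> ring

lemma isIntegerPoint_ptB : IsIntegerPoint ptB := by
  intro i
  fin_cases i
  · exact ⟨0, by simp [ptB]⟩
  · exact ⟨0, by simp [ptB]⟩
  · exact ⟨1, by simp [ptB]⟩

/-! ### The functionals of the two triangles -/

/-- The functional that equals `1` on `A`, `B`, `D`. -/
def funABD (a b : ℕ) : Space →ₗ[ℝ] ℝ where
  toFun v := -((a : ℝ) + 1) * v 0 + ((a : ℝ) + 1) * (b + 1) * v 1 + v 2
  map_add' v w := by simp; ring
  map_smul' c v := by simp; ring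

/-- The functional that equals `1` on `B`, `C`, `D`. -/
def funBCD (a b : ℕ) : Space →ₗ[ℝ] ℝ where
  toFun v := (-v 0 + ((b : ℝ) + 1) * v 1 + (a + 2) * v 2) / (a + 2)
  map_add' v w := by simp; ring
  map_smul' c v := by simp; ring

lemma funABD_apply (v : Space) :
    funABD a b v = -((a : ℝ) + 1) * v 0 + ((a : ℝ) + 1) * (b + 1) * v 1 + v 2 := rfl

lemma funBCD_apply (v : Space) :
    funBCD a b v = (-v 0 + ((b : ℝ) + 1) * v 1 + (a + 2) * v 2) / (a + 2) := rfl

lemma funABD_ptA : funABD a b (ptA a) = 1 := by simp [funABD_apply, ptA]; ring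
lemma funABD_ptB : funABD a b ptB = 1 := by simp [funABD_apply, ptB]
lemma funABD_ptD : funABD a b (ptD b) = 1 := by simp [funABD_apply, ptD]; ring

lemma funBCD_ptB : funBCD a b ptB = 1 := by
  have : (a : ℝ) + 2 ≠ 0 := by positivity
  simp [funBCD_apply, ptB, this]

lemma funBCD_ptC : funBCD a b (ptC a b) = 1 := by
  have : (a : ℝ) + 2 ≠ 0 := by positivity
  simp [funBCD_apply, ptC]; field_simp; ring

lemma funBCD_ptD : funBCD a b (ptD b) = 1 := by
  have : (a : ℝ) + 2 ≠ 0 := by positivity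
  simp [funBCD_apply, ptD]; field_simp; ring

/-! #### Barycentric coordinates -/

/-- The coordinate at `A` with respect to the basis `A`, `B`, `D`. -/
def barA (b : ℕ) (v : Space) : ℝ := v 0 - ((b : ℝ) + 1) * v 1

/-- The coordinate at `D` with respect to the basis `A`, `B`, `D`. -/
def barD (b : ℕ) (v : Space) : ℝ := v 1 / ((b : ℝ) + 1)

/-- The coordinate at `B` with respect to the basis `A`, `B`, `D`. -/
def barB (a b : ℕ) (v : Space) : ℝ := v 2 - (a + 2) * barA b v - barD b v

lemma eq_barycentric_ABD (v : Space) :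
    v = barA b v • ptA a + barB a b v • ptB + barD b v • ptD b := by
  have : (b : ℝ) + 1 ≠ 0 := by positivity
  apply space_ext <;> simp [barA, barB, barD, ptA, ptB, ptD] <;> field_simp <;> ring

lemma funABD_eq_sum (v : Space) : funABD a b v = barA b v + barB a b v + barD b v := by
  conv_lhs => rw [eq_barycentric_ABD (a := a) (b := b) v]
  simp [funABD_ptA, funABD_ptB, funABD_ptD]

/-- The coordinate at `C` with respect to the basis `B`, `C`, `D`. -/
def barC' (a b : ℕ) (v : Space) : ℝ := (((b : ℝ) + 1) * v 1 - v 0) / (a + 2)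

/-- The coordinate at `D` with respect to the basis `B`, `C`, `D`. -/
def barD' (a b : ℕ) (v : Space) : ℝ := (v 1 - barC' a b v) / (b + 1)

/-- The coordinate at `B` with respect to the basis `B`, `C`, `D`. -/
def barB' (a b : ℕ) (v : Space) : ℝ := v 2 - barD' a b v

lemma eq_barycentric_BCD (v : Space) :
    v = barB' a b v • ptB + barC' a b v • ptC a b + barD' a b v • ptD b := by
  have : (b : ℝ) + 1 ≠ 0 := by positivity
  have : (a : ℝ) + 2 ≠ 0 := by positivity
  apply space_ext <;> simp [barB', barC', barD', ptC, ptB, ptD] <;> field_simp <;> ring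

lemma funBCD_eq_sum (v : Space) : funBCD a b v = barB' a b v + barC' a b v + barD' a b v := by
  conv_lhs => rw [eq_barycentric_BCD (a := a) (b := b) v]
  simp [funBCD_ptC, funBCD_ptB, funBCD_ptD]

/-! #### The cones over the triangles are cut out by the neighbouring triangles -/

/-- Both forms are 1 at B and D, so their difference is a multiple of the coordinate at A. The other
five identities arise the same way from the neighbours across the remaining edges: X⁻¹(BCD) contains
AB, Y⁻¹(BCD) contains AD, X(ABD) contains CD and Y(ABD) contains BC. -/
lemma funBCD_sub_funABD (v : Space) : funBCD a b v - funABD a b v =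
    (((a : ℝ) + 1) * (a + 2) - 1) / (a + 2) * barA b v := by
  have : (a : ℝ) + 2 ≠ 0 := by positivity
  simp only [funBCD_apply, funABD_apply, barA]; field_simp; ring

lemma funBCD_unitX_sub (v : Space) : funBCD a b (toOperator (unitX a b) v) - funABD a b v =
    ((b : ℝ) + 1) * ((a + 2) * (b + 1) - 1) / (a + 2) * barD b v := by
  have : (a : ℝ) + 2 ≠ 0 := by positivity
  have : (b : ℝ) + 1 ≠ 0 := by positivity
  simp [unitX_apply, funBCD_apply, funABD_apply, barD]; field_simp; ring

lemma funBCD_unitY_sub (v : Space) : funBCD a b (toOperator (unitY a b) v) - funABD a b v =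
    ((b : ℝ) + 1) / (a + 2) * barB a b v := by
  have : (a : ℝ) + 2 ≠ 0 := by positivity
  have : (b : ℝ) + 1 ≠ 0 := by positivity
  simp [unitY_apply, funBCD_apply, funABD_apply, barB, barA, barD]; field_simp; ring

lemma funABD_sub_funBCD (v : Space) : funABD a b v - funBCD a b v =
    (((a : ℝ) + 1) * (a + 2) - 1) * barC' a b v := by
  have : (a : ℝ) + 2 ≠ 0 := by positivity
  simp only [funBCD_apply, funABD_apply, barC']; field_simp; ring

lemma funABD_unitX_inv_sub (v : Space) :
    funABD a b (toOperator (unitX a b)⁻¹ v) - funBCD a b v =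
    ((b : ℝ) + 1) * ((a + 2) * (b + 1) - 1) * barB' a b v := by
  have : (a : ℝ) + 2 ≠ 0 := by positivity
  have : (b : ℝ) + 1 ≠ 0 := by positivity
  simp [unitX_inv_apply, funBCD_apply, funABD_apply, barB', barC', barD']; field_simp; ring

lemma funABD_unitY_inv_sub (v : Space) :
    funABD a b (toOperator (unitY a b)⁻¹ v) - funBCD a b v = ((b : ℝ) + 1) * barD' a b v := by
  have : (a : ℝ) + 2 ≠ 0 := by positivity
  have : (b : ℝ) + 1 ≠ 0 := by positivity
  simp [unitY_inv_apply, funBCD_apply, funABD_apply, barC', barD']; field_simp; ring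

/-- The three factors in the differences of the forms are positive: the sail is convex across each
edge. This makes the local comparison with three neighbours sufficient for membership in the cone.
-/
lemma bar_nonneg_ABD {v : Space} (h₁ : funABD a b v ≤ funBCD a b v)
    (h₂ : funABD a b v ≤ funBCD a b (toOperator (unitX a b) v))
    (h₃ : funABD a b v ≤ funBCD a b (toOperator (unitY a b) v)) :
    0 ≤ barA b v ∧ 0 ≤ barB a b v ∧ 0 ≤ barD b v := by
  have ha : (0 : ℝ) ≤ a := a.cast_nonneg
  have hb : (0 : ℝ) ≤ b := b.cast_nonneg
  have c₁ : 0 < (((a : ℝ) + 1) * (a + 2) - 1) / (a + 2) := div_pos (by nlinarith) (by linarith)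
  have c₂ : 0 < ((b : ℝ) + 1) * ((a + 2) * (b + 1) - 1) / (a + 2) :=
    div_pos (mul_pos (by linarith) (by nlinarith)) (by linarith)
  have c₃ : 0 < ((b : ℝ) + 1) / (a + 2) := by positivity
  rw [← sub_nonneg, funBCD_sub_funABD] at h₁
  rw [← sub_nonneg, funBCD_unitX_sub] at h₂
  rw [← sub_nonneg, funBCD_unitY_sub] at h₃
  exact ⟨nonneg_of_mul_nonneg_right h₁ c₁, nonneg_of_mul_nonneg_right h₃ c₃,
    nonneg_of_mul_nonneg_right h₂ c₂⟩

lemma bar_nonneg_BCD {v : Space} (h₁ : funBCD a b v ≤ funABD a b v)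
    (h₂ : funBCD a b v ≤ funABD a b (toOperator (unitX a b)⁻¹ v))
    (h₃ : funBCD a b v ≤ funABD a b (toOperator (unitY a b)⁻¹ v)) :
    0 ≤ barB' a b v ∧ 0 ≤ barC' a b v ∧ 0 ≤ barD' a b v := by
  have ha : (0 : ℝ) ≤ a := a.cast_nonneg
  have hb : (0 : ℝ) ≤ b := b.cast_nonneg
  have c₁ : 0 < ((a : ℝ) + 1) * (a + 2) - 1 := by nlinarith
  have c₂ : 0 < ((b : ℝ) + 1) * ((a + 2) * (b + 1) - 1) := mul_pos (by linarith) (by nlinarith)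
  have c₃ : 0 < (b : ℝ) + 1 := by positivity
  rw [← sub_nonneg, funABD_sub_funBCD] at h₁
  rw [← sub_nonneg, funABD_unitX_inv_sub] at h₂
  rw [← sub_nonneg, funABD_unitY_inv_sub] at h₃
  exact ⟨nonneg_of_mul_nonneg_right h₂ c₂, nonneg_of_mul_nonneg_right h₁ c₁,
    nonneg_of_mul_nonneg_right h₃ c₃⟩

/-! ### The roots and the eigencoordinates -/

/-- The three roots of `t (t + a + 2) (t - (b + 1)) = 1`, the eigenvalues of the inverse operator,
with their localization. -/
structure Roots (a b : ℕ) where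
  /-- the roots -/
  t : Fin 3 → ℝ
  eq : ∀ i, t i * (t i + (a + 2)) * (t i - (b + 1)) = 1
  lt₀ : (b : ℝ) + 1 < t 0
  lt₁ : -1 < t 1 * (a + 2)
  neg₁ : t 1 < 0
  add_pos₂ : 0 < t 2 + (a + 2)
  lt₂ : (t 2 + (a + 2)) * (a + 2) < 1

lemma Roots.exists (a b : ℕ) : Nonempty (Roots a b) := by
  have ha : (0 : ℝ) ≤ a := a.cast_nonneg
  have hb : (0 : ℝ) ≤ b := b.cast_nonneg
  set f : ℝ → ℝ := fun t => t * (t + (a + 2)) * (t - (b + 1)) with hf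
  have hc : Continuous f := by fun_prop
  -- The cubic vanishes at b + 1, 0 and -(a + 2), and exceeds 1 at b + 2, -u and -(a + 2) + u. The
  -- width u = 1 / (a + 2) gives exactly the localization used for the sign of the form of BCD.
  obtain ⟨u, hu⟩ : ∃ u : ℝ, u * (a + 2) = 1 := ⟨1 / (a + 2), by field_simp⟩
  have hu0 : 0 < u := by
    by_contra h
    nlinarith
  have hu2 : u ≤ 1 / 2 := by nlinarith
  obtain ⟨t₀, ⟨h₀, -⟩, e₀⟩ := intermediate_value_Ioo (by linarith : (b : ℝ) + 1 ≤ b + 2)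
    hc.continuousOn (show (1 : ℝ) ∈ Set.Ioo (f (b + 1)) (f (b + 2)) by
      constructor <;> simp only [hf]
      · simp
      · nlinarith [mul_nonneg ha hb])
  obtain ⟨t₁, ⟨h₁, h₁'⟩, e₁⟩ := intermediate_value_Ioo' (by linarith : -u ≤ 0)
    hc.continuousOn (show (1 : ℝ) ∈ Set.Ioo (f 0) (f (-u)) by
      constructor <;> simp only [hf]
      · simp
      · have : -u * (-u + (a + 2)) * (-u - (b + 1)) = (u * (a + 2) - u ^ 2) * (u + 1 + b) := by
          ring
        rw [this, hu]
        nlinarith [mul_nonneg hb (by nlinarith : 0 ≤ 1 - u ^ 2), mul_pos hu0 hu0])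
  obtain ⟨t₂, ⟨h₂, h₂'⟩, e₂⟩ := intermediate_value_Ioo (by linarith : -((a : ℝ) + 2) ≤ -(a + 2) + u)
    hc.continuousOn (show (1 : ℝ) ∈ Set.Ioo (f (-(a + 2))) (f (-(a + 2) + u)) by
      constructor <;> simp only [hf]
      · simp
      · have : (-((a : ℝ) + 2) + u) * (-((a : ℝ) + 2) + u + (a + 2)) *
            (-((a : ℝ) + 2) + u - (b + 1)) = (u * (a + 2) - u ^ 2) * (a + 3 + b - u) := by
          ring
        rw [this, hu]
        have h : (3 / 4 : ℝ) ≤ 1 - u ^ 2 := by nlinarith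
        nlinarith [mul_nonneg (by linarith : 0 ≤ 1 - u ^ 2 - 3 / 4)
          (by linarith : 0 ≤ a + 3 + b - u)])
  refine ⟨⟨![t₀, t₁, t₂], ?_, h₀, ?_, h₁', ?_, ?_⟩⟩
  · intro i
    fin_cases i
    exacts [e₀, e₁, e₂]
  · change -1 < t₁ * (a + 2)
    nlinarith
  · change 0 < t₂ + (a + 2)
    linarith
  · change (t₂ + (a + 2)) * (a + 2) < 1
    nlinarith

namespace Roots

variable {a b : ℕ} (r : Roots a b)

lemma t₀_pos : 0 < r.t 0 := by
  have hb : (0 : ℝ) ≤ b := b.cast_nonneg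
  linarith [r.lt₀]

lemma neg_one_lt₁ : -1 < r.t 1 := by
  have ha : (0 : ℝ) ≤ a := a.cast_nonneg
  nlinarith [r.lt₁, r.neg₁]

lemma lt_neg_one₂ : r.t 2 < -1 := by
  have ha : (0 : ℝ) ≤ a := a.cast_nonneg
  nlinarith [r.lt₂, r.add_pos₂]

lemma t_ne_zero (i : Fin 3) : r.t i ≠ 0 := by
  intro h
  have := r.eq i
  simp [h] at this

lemma add_pos (i : Fin 3) : 0 < r.t i + (a + 2) := by
  have ha : (0 : ℝ) ≤ a := a.cast_nonneg
  fin_cases i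
  · have := r.t₀_pos
    change 0 < r.t 0 + (a + 2)
    linarith
  · have := r.neg_one_lt₁
    change 0 < r.t 1 + (a + 2)
    linarith
  · exact r.add_pos₂

lemma lt_of_lt : r.t 2 < r.t 1 ∧ r.t 1 < r.t 0 :=
  ⟨r.lt_neg_one₂.trans r.neg_one_lt₁, r.neg₁.trans r.t₀_pos⟩

lemma injective : Function.Injective r.t := by
  obtain ⟨h, h'⟩ := r.lt_of_lt
  intro i j hij
  fin_cases i <;> fin_cases j <;> simp at hij ⊢ <;> linarith

/-- Divided difference of the cubic at two distinct roots. A further difference gives the sum of the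
roots, and from these comes the factorization of the cubic. -/
lemma pair_eq {i j : Fin 3} (hij : i ≠ j) : r.t i ^ 2 + r.t i * r.t j + r.t j ^ 2 -
    (b - a - 1) * (r.t i + r.t j) - (a + 2) * (b + 1) = 0 := by
  have h : r.t i - r.t j ≠ 0 := sub_ne_zero.2 (r.injective.ne hij)
  apply mul_left_cancel₀ h
  linear_combination r.eq i - r.eq j

lemma sum_eq : r.t 0 + r.t 1 + r.t 2 = b - a - 1 := by
  have h : r.t 1 - r.t 2 ≠ 0 := sub_ne_zero.2 (r.injective.ne (by decide))
  apply mul_left_cancel₀ h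
  linear_combination r.pair_eq (i := 0) (j := 1) (by decide) -
    r.pair_eq (i := 0) (j := 2) (by decide)

lemma eq_prod (x : ℝ) : x * (x + (a + 2)) * (x - (b + 1)) - 1 =
    (x - r.t 0) * (x - r.t 1) * (x - r.t 2) := by
  linear_combination r.eq 0 + (x - r.t 0) * r.pair_eq (i := 0) (j := 1) (by decide) +
    (x - r.t 0) * (x - r.t 1) * r.sum_eq

lemma prod_t : r.t 0 * r.t 1 * r.t 2 = 1 := by
  linear_combination r.eq_prod 0

lemma prod_add : (r.t 0 + (a + 2)) * (r.t 1 + (a + 2)) * (r.t 2 + (a + 2)) = 1 := by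
  linear_combination r.eq_prod (-(a + 2))

/-- The eigencoordinates. -/
def coord (i : Fin 3) : Space →ₗ[ℝ] ℝ where
  toFun v := r.t i * v 0 + (r.t i ^ 2 - (b - a - 1) * r.t i) * v 1 + v 2
  map_add' v w := by simp; ring
  map_smul' c v := by simp; ring

lemma coord_apply (i : Fin 3) (v : Space) : r.coord i v =
    r.t i * v 0 + (r.t i ^ 2 - (b - a - 1) * r.t i) * v 1 + v 2 := rfl

@[simp] lemma coord_ptB (i : Fin 3) : r.coord i ptB = 1 := by
  simp [coord_apply, ptB]

lemma coord_frob (i : Fin 3) (v : Space) :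
    r.coord i (toOperator (frob a b) v) = (r.t i)⁻¹ * r.coord i v := by
  rw [eq_inv_mul_iff_mul_eq₀ (r.t_ne_zero i)]
  simp [frob_apply, coord_apply]
  linear_combination v 2 * r.eq i

lemma coord_unitX (i : Fin 3) (v : Space) :
    r.coord i (toOperator (unitX a b) v) = r.t i ^ 2 * r.coord i v := by
  simp [unitX_apply, coord_apply]
  linear_combination -(v 0 + r.t i * v 1) * r.eq i

lemma coord_unitY (i : Fin 3) (v : Space) : r.coord i (toOperator (unitY a b) v) =
    (r.t i + (a + 2))⁻¹ * r.coord i v := by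
  have := (r.add_pos i).ne'
  rw [eq_inv_mul_iff_mul_eq₀ this]
  simp [unitY_apply, coord_apply]
  linear_combination (-(a + 2) * v 0 + (a + 2) * (b + 1) * v 1 + v 2) * r.eq i

/-- A Vandermonde argument by successive divided differences, since the three roots are distinct. -/
lemma coord_ext {v w : Space} (h : ∀ i, r.coord i v = r.coord i w) : v = w := by
  have key : ∀ x y z : ℝ, (∀ i, r.t i * x + (r.t i ^ 2 - (b - a - 1) * r.t i) * y + z = 0) →
      x = 0 ∧ y = 0 ∧ z = 0 := by
    intro x y z h
    have h01 : r.t 0 - r.t 1 ≠ 0 := sub_ne_zero.2 (r.injective.ne (by decide))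
    have h02 : r.t 0 - r.t 2 ≠ 0 := sub_ne_zero.2 (r.injective.ne (by decide))
    have h12 : r.t 1 - r.t 2 ≠ 0 := sub_ne_zero.2 (r.injective.ne (by decide))
    have e1 : x + (r.t 0 + r.t 1 - (b - a - 1)) * y = 0 := by
      apply mul_left_cancel₀ h01
      linear_combination h 0 - h 1
    have e2 : x + (r.t 0 + r.t 2 - (b - a - 1)) * y = 0 := by
      apply mul_left_cancel₀ h02
      linear_combination h 0 - h 2
    have hy : y = 0 := by
      apply mul_left_cancel₀ h12
      linear_combination e1 - e2
    have hx : x = 0 := by simpa [hy] using e1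
    have := h 0
    simp only [hx, hy] at this
    exact ⟨hx, hy, by simpa using this⟩
  obtain ⟨h0, h1, h2⟩ := key (v 0 - w 0) (v 1 - w 1) (v 2 - w 2) fun i => by
    have := h i
    simp only [coord_apply] at this
    linear_combination this
  exact space_ext (sub_eq_zero.1 h0) (sub_eq_zero.1 h1) (sub_eq_zero.1 h2)

/-- An unnormalized eigenvector. -/
def eigen (i : Fin 3) : Space :=
  !₂[r.t i, 1, r.t i ^ 2 - (b - a - 1) * r.t i - (a + 2) * (b + 1)]

lemma coord_eigen_ne {i j : Fin 3} (hij : j ≠ i) : r.coord j (r.eigen i) = 0 := by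
  simp only [coord_apply, eigen]
  simp
  linear_combination r.pair_eq hij

/-- The derivative of the polynomial at the root. -/
def der (i : Fin 3) : ℝ := r.coord i (r.eigen i)

lemma der_eq (i : Fin 3) : r.der i =
    3 * r.t i ^ 2 - 2 * (b - a - 1) * r.t i - (a + 2) * (b + 1) := by
  simp only [der, coord_apply, eigen]
  simp
  ring

lemma der₀_pos : 0 < r.der 0 := by
  have h : r.der 0 = (r.t 0 - r.t 1) * (r.t 0 - r.t 2) := by
    rw [der_eq]
    linear_combination 2 * r.t 0 * r.sum_eq + (r.pair_eq (i := 1) (j := 2) (by decide)) -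
      (r.t 1 + r.t 2) * r.sum_eq
  rw [h]
  obtain ⟨h, h'⟩ := r.lt_of_lt
  exact mul_pos (by linarith) (by linarith)

lemma der₁_neg : r.der 1 < 0 := by
  have h : r.der 1 = (r.t 1 - r.t 0) * (r.t 1 - r.t 2) := by
    rw [der_eq]
    linear_combination 2 * r.t 1 * r.sum_eq + (r.pair_eq (i := 0) (j := 2) (by decide)) -
      (r.t 0 + r.t 2) * r.sum_eq
  rw [h]
  obtain ⟨h, h'⟩ := r.lt_of_lt
  exact mul_neg_of_neg_of_pos (by linarith) (by linarith)

lemma der₂_pos : 0 < r.der 2 := by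
  have h : r.der 2 = (r.t 2 - r.t 0) * (r.t 2 - r.t 1) := by
    rw [der_eq]
    linear_combination 2 * r.t 2 * r.sum_eq + (r.pair_eq (i := 0) (j := 1) (by decide)) -
      (r.t 0 + r.t 1) * r.sum_eq
  rw [h]
  obtain ⟨h, h'⟩ := r.lt_of_lt
  exact mul_pos_of_neg_of_neg (by linarith) (by linarith)

lemma der_ne_zero (i : Fin 3) : r.der i ≠ 0 := by
  fin_cases i
  exacts [r.der₀_pos.ne', r.der₁_neg.ne, r.der₂_pos.ne']

/-- The basis of eigenvectors dual to the eigencoordinates. -/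
def dual (i : Fin 3) : Space := (r.der i)⁻¹ • r.eigen i

lemma coord_dual_ne {i j : Fin 3} (hij : j ≠ i) : r.coord j (r.dual i) = 0 := by
  simp [dual, r.coord_eigen_ne hij]

@[simp] lemma coord_dual_self (i : Fin 3) : r.coord i (r.dual i) = 1 := by
  rw [dual, map_smul, ← der, smul_eq_mul, inv_mul_cancel₀ (r.der_ne_zero i)]

lemma sum_dual (v : Space) : v = ∑ i, r.coord i v • r.dual i := by
  apply r.coord_ext
  intro j
  rw [map_sum, Finset.sum_eq_single j]
  · simp
  · intro i _ hi
    simp [r.coord_dual_ne hi.symm]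
  · simp

lemma map_eq_sum (l : Space →ₗ[ℝ] ℝ) (v : Space) : l v = ∑ i, r.coord i v * l (r.dual i) := by
  conv_lhs => rw [r.sum_dual v]
  simp

/-! ### Positivity of the functionals -/

/-- On the dual eigenvector the form is (t + 1)(t - (b + 1)) divided by the derivative of the cubic.
The derivative is negative exactly at the middle root, and so is the numerator, because t₂ < -1 < t₁
< 0 and t₀ > b + 1. -/
lemma funABD_dual_pos (i : Fin 3) : 0 < funABD a b (r.dual i) := by
  have h : funABD a b (r.dual i) = (r.t i + 1) * (r.t i - (b + 1)) / r.der i := by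
    simp only [dual, map_smul, funABD_apply, eigen]
    simp
    field_simp
    ring
  have hb : (0 : ℝ) ≤ b := b.cast_nonneg
  rw [h]
  match i with
  | 0 => exact div_pos (mul_pos (by linarith [r.t₀_pos]) (by linarith [r.lt₀])) r.der₀_pos
  | 1 => exact div_pos_of_neg_of_neg (mul_neg_of_pos_of_neg (by linarith [r.neg_one_lt₁])
      (by linarith [r.neg₁])) r.der₁_neg
  | 2 => exact div_pos (mul_pos_of_neg_of_neg (by linarith [r.lt_neg_one₂])
      (by linarith [r.lt_neg_one₂])) r.der₂_pos

/-- The same comparison of signs. Here the factor (t + a + 2)(a + 2) - 1 must be negative at t₂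
only, and `lt₂` is exactly this. -/
lemma funBCD_dual_pos (i : Fin 3) : 0 < funBCD a b (r.dual i) := by
  have ha : (0 : ℝ) ≤ a := a.cast_nonneg
  have hb : (0 : ℝ) ≤ b := b.cast_nonneg
  have h : funBCD a b (r.dual i) = ((r.t i + (a + 2)) * (a + 2) - 1) * (r.t i - (b + 1)) /
      r.der i / (a + 2) := by
    simp only [dual, map_smul, funBCD_apply, eigen]
    simp
    field_simp
    ring
  rw [h]
  refine div_pos ?_ (by linarith)
  match i with
  | 0 => exact div_pos (mul_pos (by change 0 < (r.t 0 + (a + 2)) * (a + 2) - 1; nlinarith [r.t₀_pos])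
      (by linarith [r.lt₀])) r.der₀_pos
  | 1 => exact div_pos_of_neg_of_neg (mul_neg_of_pos_of_neg (by
      change 0 < (r.t 1 + (a + 2)) * (a + 2) - 1; nlinarith [r.neg_one_lt₁])
      (by linarith [r.neg₁])) r.der₁_neg
  | 2 => exact div_pos (mul_pos_of_neg_of_neg (by linarith [r.lt₂])
      (by linarith [r.lt_neg_one₂])) r.der₂_pos

lemma pos_of_dual_pos {l : Space →ₗ[ℝ] ℝ} (hl : ∀ i, 0 < l (r.dual i)) {v : Space}
    (hv : ∀ i, 0 < r.coord i v) : 0 < l v := by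
  rw [r.map_eq_sum]
  exact Finset.sum_pos (fun i _ => mul_pos (hv i) (hl i)) Finset.univ_nonempty

lemma one_le_funABD {v : Space} (hv : IsIntegerPoint v) (hp : ∀ i, 0 < r.coord i v) :
    1 ≤ funABD a b v := by
  have h := r.pos_of_dual_pos r.funABD_dual_pos hp
  obtain ⟨x, hx⟩ := hv 0
  obtain ⟨y, hy⟩ := hv 1
  obtain ⟨z, hz⟩ := hv 2
  have e : funABD a b v = ((-((a : ℤ) + 1) * x + ((a : ℤ) + 1) * (b + 1) * y + z : ℤ) : ℝ) := by
    rw [funABD_apply, hx, hy, hz]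
    push_cast
    ring
  rw [e] at h ⊢
  exact_mod_cast h

/-- Positivity and integrality leave the numerators k = 1, …, a + 1 of the form to exclude. These
would be integer points strictly between the origin and the plane BCD, and the positivity of
suitable eigencoordinates rules them out according to the signs of y and z. -/
lemma one_le_funBCD {v : Space} (hv : IsIntegerPoint v) (hp : ∀ i, 0 < r.coord i v) :
    1 ≤ funBCD a b v := by
  have ha : (0 : ℝ) ≤ a := a.cast_nonneg
  have hb : (0 : ℝ) ≤ b := b.cast_nonneg
  have h := r.pos_of_dual_pos r.funBCD_dual_pos hp
  obtain ⟨x, hx⟩ := hv 0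
  obtain ⟨y, hy⟩ := hv 1
  obtain ⟨z, hz⟩ := hv 2
  obtain ⟨k, hk⟩ : ∃ k : ℤ, k = -x + (b + 1) * y + (a + 2) * z := ⟨_, rfl⟩
  have hkr : (k : ℝ) = -x + (b + 1) * y + (a + 2) * z := by
    rw [hk]
    push_cast
    ring
  rw [funBCD_apply, hx, hy, hz, ← hkr] at h ⊢
  have hk0 : (0 : ℝ) < k := by
    by_contra hneg
    exact absurd h (not_lt.2 (div_nonpos_of_nonpos_of_nonneg (not_lt.1 hneg) (by linarith)))
  rw [one_le_div (by linarith)]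
  by_contra! hlt
  have hk1 : (k : ℝ) ≤ a + 1 := by
    have : k < (a : ℤ) + 2 := by exact_mod_cast hlt
    have : k ≤ (a : ℤ) + 1 := by omega
    exact_mod_cast this
  -- Eliminating x in favour of k leaves a combination of y, z and k whose coefficients have known
  -- signs at each root.
  have hc : ∀ i, 0 < y * (r.t i * (r.t i + (a + 2))) + z * (1 + r.t i * (a + 2)) - k * r.t i := by
    intro i
    have h := hp i
    rw [coord_apply, hx, hy, hz] at h
    linear_combination h + r.t i * hkr
  have h0 := hc 0
  have h1 := hc 1
  have h2 := hc 2
  have t0 := r.t₀_pos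
  rcases le_or_gt z 0 with hz0 | hz0
  · have hz0' : (z : ℝ) ≤ 0 := by exact_mod_cast hz0
    rcases le_or_gt y 0 with hy0 | hy0
    · have hy0' : (y : ℝ) ≤ 0 := by exact_mod_cast hy0
      have : (y : ℝ) * (r.t 0 * (r.t 0 + (a + 2))) ≤ 0 :=
        mul_nonpos_of_nonpos_of_nonneg hy0' (by positivity)
      have : (z : ℝ) * (1 + r.t 0 * (a + 2)) ≤ 0 :=
        mul_nonpos_of_nonpos_of_nonneg hz0' (by positivity)
      have : 0 < k * r.t 0 := mul_pos hk0 t0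
      linarith
    · have hy1 : (1 : ℝ) ≤ y := by exact_mod_cast hy0
      have : (z : ℝ) * (1 + r.t 1 * (a + 2)) ≤ 0 :=
        mul_nonpos_of_nonpos_of_nonneg hz0' (by linarith [r.lt₁])
      have h3 : 0 < (y * (r.t 1 + (a + 2)) - k) * r.t 1 := by linarith
      have h4 : y * (r.t 1 + (a + 2)) - k < 0 := neg_of_mul_pos_left h3 r.neg₁.le
      nlinarith [r.neg_one_lt₁]
  · have hz1 : (1 : ℝ) ≤ z := by exact_mod_cast hz0
    obtain ⟨u, hu⟩ : ∃ u, u = - r.t 2 := ⟨_, rfl⟩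
    obtain ⟨Y, hY⟩ : ∃ Y : ℝ, Y = - y := ⟨_, rfl⟩
    have ht2 : r.t 2 = -u := by linarith
    have hy' : (y : ℝ) = -Y := by linarith
    have l2 := r.lt₂
    have p2 := r.add_pos₂
    have e2 := r.eq 2
    have e0 := r.eq 0
    rw [ht2] at h2 l2 p2 e2
    rw [hy'] at h2 h0
    have hu1 : (3 : ℝ) / 2 < u := by nlinarith
    -- For z ≥ 1 the coordinate at t₂ bounds z above by a multiple of Y = -y, since k ≤ (a + 1) z.
    -- The coordinate at t₀ bounds Y by a multiple of z. Multiplying the two eliminates both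
    -- unknowns.
    have h5 : z * (u - 1) < Y * (u * ((a + 2) - u)) := by
      have : k * u ≤ (a + 1) * u * z := by
        have : k * u ≤ (a + 1) * u := mul_le_mul_of_nonneg_right hk1 (by linarith)
        nlinarith [mul_nonneg (by linarith : (0 : ℝ) ≤ (a + 1)) (by linarith : 0 ≤ u)]
      nlinarith
    have hY0 : 0 < Y := by
      have h6 : 0 < Y * (u * ((a + 2) - u)) :=
        lt_trans (mul_pos (by linarith) (by linarith)) h5
      exact pos_of_mul_pos_left h6 (mul_pos (by linarith) (by linarith)).le
    have h7 : Y * (r.t 0 * (r.t 0 + (a + 2))) < z * (1 + r.t 0 * (a + 2)) := by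
      have : 0 < k * r.t 0 := mul_pos hk0 t0
      linarith
    have p : 0 < r.t 0 * (r.t 0 + (a + 2)) := by positivity
    have h8 : (u - 1) * (r.t 0 * (r.t 0 + (a + 2))) <
        (u * ((a + 2) - u)) * (1 + r.t 0 * (a + 2)) := by
      have q : 0 < 1 + r.t 0 * (a + 2) := by positivity
      have h9 : Y * ((u - 1) * (r.t 0 * (r.t 0 + (a + 2)))) <
          Y * ((u * ((a + 2) - u)) * (1 + r.t 0 * (a + 2))) := by
        calc _ = (u - 1) * (Y * (r.t 0 * (r.t 0 + (a + 2)))) := by ring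
          _ ≤ (u - 1) * (z * (1 + r.t 0 * (a + 2))) :=
              mul_le_mul_of_nonneg_left h7.le (by linarith)
          _ = z * (u - 1) * (1 + r.t 0 * (a + 2)) := by ring
          _ < Y * (u * ((a + 2) - u)) * (1 + r.t 0 * (a + 2)) := mul_lt_mul_of_pos_right h5 q
          _ = _ := by ring
      exact lt_of_mul_lt_mul_left h9 hY0.le
    -- This is the cubic equation at t₂ = -u. It turns the eliminated inequality into t₀ (t₀ + a +
    -- 2) < 1 + t₀ (a + 2), because (u - 1)(u + b + 1) > 1; this contradicts t₀ > 1.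
    have h10 : u * ((a + 2) - u) * (u + (b + 1)) = 1 := by linarith
    have h11 : (u - 1) * (u + (b + 1)) * (r.t 0 * (r.t 0 + (a + 2))) < 1 + r.t 0 * (a + 2) := by
      have := mul_lt_mul_of_pos_right h8 (by linarith : 0 < u + (b + 1))
      calc _ = (u - 1) * (r.t 0 * (r.t 0 + (a + 2))) * (u + (b + 1)) := by ring
        _ < _ := this
        _ = (u * ((a + 2) - u) * (u + (b + 1))) * (1 + r.t 0 * (a + 2)) := by ring
        _ = _ := by rw [h10, one_mul]
    have h12 : 1 < (u - 1) * (u + (b + 1)) := by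
      calc (1 : ℝ) < (1 / 2) * (5 / 2) := by norm_num
        _ ≤ (u - 1) * (u + (b + 1)) :=
          mul_le_mul (by linarith) (by linarith) (by norm_num) (by linarith)
    have h13 : 1 < r.t 0 := by linarith [r.lt₀]
    have h14 := mul_lt_mul_of_pos_right h12 p
    have h15 : 1 < r.t 0 * r.t 0 := one_lt_mul_of_lt_of_le h13 h13.le
    linarith

end Roots

/-! ### Irreducibility -/

open Polynomial in
lemma charpoly_frob : ((frob a b : Matrix (Fin 3) (Fin 3) ℤ).map (Int.cast : ℤ → ℚ)).charpoly =
    X ^ 3 + C (((a : ℚ) + 2) * (b + 1)) * X ^ 2 + C ((b : ℚ) - a - 1) * X - 1 := by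
  rw [Matrix.charpoly, Matrix.det_fin_three, frob_coe]
  simp
  ring

open Polynomial in
lemma natDegree_frob : (X ^ 3 + C (((a : ℚ) + 2) * (b + 1)) * X ^ 2 + C ((b : ℚ) - a - 1) * X - 1 :
    ℚ[X]).natDegree = 3 := by
  compute_degree!

open Polynomial in
lemma monic_frob : (X ^ 3 + C (((a : ℚ) + 2) * (b + 1)) * X ^ 2 + C ((b : ℚ) - a - 1) * X - 1 :
    ℚ[X]).Monic := by
  monicity!

open Polynomial in
lemma irreducible_frob : Irreducible
    (X ^ 3 + C (((a : ℚ) + 2) * (b + 1)) * X ^ 2 + C ((b : ℚ) - a - 1) * X - 1 : ℚ[X]) := by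
  rw [monic_frob.irreducible_iff_roots_eq_zero_of_degree_le_three (by rw [natDegree_frob]; norm_num)
    (by rw [natDegree_frob]), Multiset.eq_zero_iff_forall_notMem]
  intro x hx
  rw [mem_roots monic_frob.ne_zero, IsRoot] at hx
  simp at hx
  have hint : IsIntegral ℤ x := by
    refine ⟨X ^ 3 + C (((a : ℤ) + 2) * (b + 1)) * X ^ 2 + C ((b : ℤ) - a - 1) * X - 1,
      by monicity!, ?_⟩
    simpa using hx
  obtain ⟨k, rfl⟩ := IsIntegrallyClosed.isIntegral_iff.1 hint
  have h : k * (k ^ 2 + (a + 2) * (b + 1) * k + (b - a - 1)) = 1 := by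
    have : ((k * (k ^ 2 + (a + 2) * (b + 1) * k + (b - a - 1)) : ℤ) : ℚ) = (1 : ℤ) := by
      push_cast
      simp at hx
      linear_combination hx
    exact_mod_cast this
  -- A rational root is an integer dividing 1. The root 1 would force ab + 3b + 1 = 0, and the root
  -- -1 would force ab + 2a + b + 1 = 0.
  have hab : 0 ≤ (a : ℤ) * b := by positivity
  rcases Int.eq_one_or_neg_one_of_mul_eq_one h with rfl | rfl
  · nlinarith
  · nlinarith

/-! ### Integer points on the walls of the orthants -/

open Polynomial in
-- Divided by t, an eigencoordinate of an integer point is a polynomial of degree at most 2 in t⁻¹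
-- with rational coefficients, while t⁻¹ has degree 3 over ℚ.
lemma Roots.coord_ne_zero (r : Roots a b) {v : Space} (hv : IsIntegerPoint v) (h0 : v ≠ 0)
    (i : Fin 3) : r.coord i v ≠ 0 := by
  intro h
  obtain ⟨x, hx⟩ := hv 0
  obtain ⟨y, hy⟩ := hv 1
  obtain ⟨z, hz⟩ := hv 2
  have ht := r.t_ne_zero i
  set P : ℚ[X] := X ^ 3 + C (((a : ℚ) + 2) * (b + 1)) * X ^ 2 + C ((b : ℚ) - a - 1) * X - 1 with hP
  have hmin : minpoly ℚ (r.t i)⁻¹ = P := by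
    refine (minpoly.eq_of_irreducible_of_monic irreducible_frob ?_ monic_frob).symm
    simp
    field_simp
    linear_combination - r.eq i
  set Q : ℚ[X] := C (y : ℚ) * X ^ 2 + C (z + (a + 2) * (b + 1) * y : ℚ) * X + C (x : ℚ) with hQ
  have hQ0 : Q = 0 := by
    by_contra hne
    have hroot : aeval (r.t i)⁻¹ Q = 0 := by
      rw [r.coord_apply, hx, hy, hz] at h
      simp [hQ]
      field_simp
      apply mul_left_cancel₀ ht
      linear_combination r.t i * r.t i * h - r.t i * y * r.eq i
    have hle := minpoly.degree_le_of_ne_zero ℚ (r.t i)⁻¹ hne hroot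
    have h3 : P.degree = 3 := by
      rw [degree_eq_natDegree monic_frob.ne_zero, natDegree_frob]
      rfl
    rw [hmin, h3] at hle
    have h2 : Q.degree ≤ 2 := by
      rw [hQ]
      compute_degree
    exact absurd (hle.trans h2) (by decide)
  have hcoeff : ∀ p q s : ℚ, C p * X ^ 2 + C q * X + C s = (0 : ℚ[X]) → p = 0 ∧ q = 0 ∧ s = 0 := by
    intro p q s h
    refine ⟨?_, ?_, ?_⟩
    · simpa [coeff_X, coeff_C] using congrArg (fun p => p.coeff 2) h
    · simpa [coeff_X, coeff_C] using congrArg (fun p => p.coeff 1) h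
    · simpa [coeff_X, coeff_C] using congrArg (fun p => p.coeff 0) h
  obtain ⟨hy0, hz0, hx0⟩ := hcoeff _ _ _ hQ0
  rw [hy0, mul_zero, add_zero] at hz0
  apply h0
  apply space_ext
  · rw [hx, Int.cast_eq_zero.1 hx0]; simp
  · rw [hy, Int.cast_eq_zero.1 hy0]; simp
  · rw [hz, Int.cast_eq_zero.1 hz0]; simp

/-! ### The group generated by the units -/

/-- The operator `X ^ i * Y ^ (-j)`. -/
def unit (a b : ℕ) (κ : ℤ × ℤ) : SL(3, ℤ) := unitX a b ^ κ.1 * unitY a b ^ (-κ.2)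

@[simp] lemma unit_zero : unit a b 0 = 1 := by simp [unit]

lemma unit_add (κ μ : ℤ × ℤ) : unit a b (κ + μ) = unit a b κ * unit a b μ := by
  have h : Commute (unitX a b) (unitY a b) := unitX_unitY_comm
  simp only [unit, Prod.fst_add, Prod.snd_add, neg_add, zpow_add]
  have := (h.zpow_zpow μ.1 (-κ.2)).eq
  simp only [mul_assoc]
  rw [← mul_assoc (unitX a b ^ μ.1), this]
  simp only [mul_assoc]

lemma unit_neg (κ : ℤ × ℤ) : unit a b (-κ) = (unit a b κ)⁻¹ := by
  rw [eq_inv_iff_mul_eq_one, ← unit_add, neg_add_cancel, unit_zero]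

lemma unit_comm (κ : ℤ × ℤ) : unit a b κ * frob a b = frob a b * unit a b κ :=
  ((show Commute (unitX a b) (frob a b) from unitX_comm).zpow_left _).mul_left
    ((show Commute (unitY a b) (frob a b) from unitY_comm).zpow_left _)

lemma mem_closure_iff {g : SL(3, ℤ)} :
    g ∈ Subgroup.closure {unitX a b, unitY a b} ↔ ∃ κ, g = unit a b κ := by
  constructor
  · intro h
    induction h using Subgroup.closure_induction with
    | mem x hx =>
      rcases hx with rfl | rfl
      · exact ⟨(1, 0), by simp [unit]⟩
      · exact ⟨(0, -1), by simp [unit]⟩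
    | one => exact ⟨0, by simp⟩
    | mul x y _ _ hx hy =>
      obtain ⟨κ, rfl⟩ := hx
      obtain ⟨μ, rfl⟩ := hy
      exact ⟨κ + μ, (unit_add _ _).symm⟩
    | inv x _ hx =>
      obtain ⟨κ, rfl⟩ := hx
      exact ⟨-κ, (unit_neg _).symm⟩
  · rintro ⟨κ, rfl⟩
    exact mul_mem (zpow_mem (Subgroup.subset_closure (by simp)) _)
      (zpow_mem (Subgroup.subset_closure (by simp)) _)

lemma unit_one_zero : unit a b (1, 0) = unitX a b := by simp [unit]
lemma unit_zero_one : unit a b (0, 1) = (unitY a b)⁻¹ := by simp [unit]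

lemma toOperator_unit_add (κ μ : ℤ × ℤ) (v : Space) : toOperator (unit a b (κ + μ)) v =
    toOperator (unit a b κ) (toOperator (unit a b μ) v) := by
  rw [unit_add, toOperator_mul]

lemma toOperator_unit_neg_cancel (κ : ℤ × ℤ) (v : Space) :
    toOperator (unit a b (-κ)) (toOperator (unit a b κ) v) = v := by
  rw [unit_neg, toOperator_inv_cancel]

lemma toOperator_unit_cancel_neg (κ : ℤ × ℤ) (v : Space) :
    toOperator (unit a b κ) (toOperator (unit a b (-κ)) v) = v := by
  rw [unit_neg, toOperator_cancel_inv]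

/-- An operator in the commutant of the Frobenius operator that fixes `B` is trivial. -/
lemma eq_one_of_comm {g : SL(3, ℤ)} (hg : g * frob a b = frob a b * g)
    (hB : toOperator g ptB = ptB) : g = 1 := by
  -- B, MB and M²B form a basis; their coordinates are triangular enough to read off the columns of
  -- g from last to first.
  have hg' : ∀ n : ℕ, toOperator g (toOperator (frob a b ^ n) ptB) =
      toOperator (frob a b ^ n) ptB := by
    intro n
    have hc : Commute g (frob a b) := hg
    rw [← toOperator_mul, (hc.pow_right n).eq, toOperator_mul, hB]
  have h1 := hg' 1
  have h2 := hg' 2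
  rw [pow_one] at h1
  rw [pow_two, toOperator_mul] at h2
  have e1 : toOperator (frob a b) ptB = !₂[0, 1, -((a : ℝ) + 2) * (b + 1)] := by
    rw [frob_apply]
    apply space_ext <;> simp [ptB]
    ring
  have e2 : toOperator (frob a b) (toOperator (frob a b) ptB) =
      !₂[1, -((a : ℝ) + 2) * (b + 1),
        -((b : ℝ) - a - 1) + (((a : ℝ) + 2) * (b + 1)) ^ 2] := by
    rw [e1, frob_apply]
    apply space_ext <;> simp
    ring
  rw [e1] at h1
  rw [e2] at h2
  ext i j
  have k0 := congrArg (fun v : Space => v i) hB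
  have k1 := congrArg (fun v : Space => v i) h1
  have k2 := congrArg (fun v : Space => v i) h2
  simp only [toOperator_apply] at k0 k1 k2
  have c2 : (g i 2 : ℝ) = (1 : Matrix (Fin 3) (Fin 3) ℝ) i 2 := by
    simp [ptB] at k0
    rw [k0]
    fin_cases i <;> simp [Matrix.one_apply]
  have c1 : (g i 1 : ℝ) = (1 : Matrix (Fin 3) (Fin 3) ℝ) i 1 := by
    simp at k1
    rw [c2] at k1
    fin_cases i <;> simp [Matrix.one_apply] at k1 ⊢ <;> linarith
  have c0 : (g i 0 : ℝ) = (1 : Matrix (Fin 3) (Fin 3) ℝ) i 0 := by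
    simp at k2
    rw [c2, c1] at k2
    fin_cases i <;> simp [Matrix.one_apply] at k2 ⊢ <;> linarith
  have hcast : ∀ i j, ((1 : Matrix (Fin 3) (Fin 3) ℝ) i j) =
      (((1 : Matrix (Fin 3) (Fin 3) ℤ) i j : ℤ) : ℝ) := by
    intro i j
    rw [Matrix.one_apply, Matrix.one_apply]
    split_ifs <;> simp
  rw [hcast] at c0 c1 c2
  rw [Matrix.SpecialLinearGroup.coe_one]
  match j with
  | 0 => exact_mod_cast c0
  | 1 => exact_mod_cast c1
  | 2 => exact_mod_cast c2

namespace Roots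

variable (r : Roots a b)

/-- The eigenvalues of the operators `X ^ i * Y ^ (-j)`. -/
def eps (i : Fin 3) (κ : ℤ × ℤ) : ℝ := (r.t i ^ 2) ^ κ.1 * (r.t i + (a + 2)) ^ κ.2

lemma eps_pos (i : Fin 3) (κ : ℤ × ℤ) : 0 < r.eps i κ :=
  mul_pos (zpow_pos (pow_two_pos_of_ne_zero (r.t_ne_zero i)) _) (zpow_pos (r.add_pos i) _)

lemma coord_zpow {i : Fin 3} {g : SL(3, ℤ)} {c : ℝ} (hc : c ≠ 0)
    (h : ∀ v, r.coord i (toOperator g v) = c * r.coord i v) (n : ℤ) (v : Space) :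
    r.coord i (toOperator (g ^ n) v) = c ^ n * r.coord i v := by
  have hinv : ∀ v, r.coord i (toOperator g⁻¹ v) = c⁻¹ * r.coord i v := by
    intro v
    rw [eq_inv_mul_iff_mul_eq₀ hc, ← h, toOperator_cancel_inv]
  induction n generalizing v with
  | zero => simp [toOperator_one]
  | succ n ih => rw [zpow_add_one, toOperator_mul, ih, h, zpow_add_one₀ hc, mul_assoc]
  | pred n ih => rw [zpow_sub_one, toOperator_mul, ih, hinv, zpow_sub_one₀ hc, mul_assoc]

lemma coord_unit (i : Fin 3) (κ : ℤ × ℤ) (v : Space) :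
    r.coord i (toOperator (unit a b κ) v) = r.eps i κ * r.coord i v := by
  rw [unit, toOperator_mul, r.coord_zpow (pow_ne_zero 2 (r.t_ne_zero i)) (r.coord_unitX i),
    r.coord_zpow (inv_ne_zero (r.add_pos i).ne') (r.coord_unitY i), eps, inv_zpow, zpow_neg,
    inv_inv, mul_assoc]

lemma eps_add (i : Fin 3) (κ μ : ℤ × ℤ) : r.eps i (κ + μ) = r.eps i κ * r.eps i μ := by
  simp only [eps, Prod.fst_add, Prod.snd_add, zpow_add₀ (pow_ne_zero 2 (r.t_ne_zero i)),
    zpow_add₀ (r.add_pos i).ne']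
  ring

lemma eps_nsmul (i : Fin 3) (κ : ℤ × ℤ) (n : ℕ) : r.eps i (n • κ) = r.eps i κ ^ n := by
  induction n with
  | zero => simp [eps]
  | succ n ih => rw [succ_nsmul, eps_add, ih, pow_succ]

lemma one_lt_sq₀ : 1 < r.t 0 ^ 2 := by
  have hb : (0 : ℝ) ≤ b := b.cast_nonneg
  nlinarith [r.lt₀]

lemma sq₁_lt_one : r.t 1 ^ 2 < 1 := by nlinarith [r.neg_one_lt₁, r.neg₁]

lemma one_lt_sq₂ : 1 < r.t 2 ^ 2 := by nlinarith [r.lt_neg_one₂]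

lemma one_lt_add₀ : 1 < r.t 0 + (a + 2) := by
  have ha : (0 : ℝ) ≤ a := a.cast_nonneg
  linarith [r.t₀_pos]

lemma one_lt_add₁ : 1 < r.t 1 + (a + 2) := by
  have ha : (0 : ℝ) ≤ a := a.cast_nonneg
  linarith [r.neg_one_lt₁]

/-- By the cubic equation, t² (t + a + 2) = t / (t - (b + 1)), and for negative t the denominator is
the larger in absolute value. -/
lemma eps_lt_one_of_neg {i : Fin 3} (hi : r.t i < 0) : r.eps i (1, 1) < 1 := by
  have hb : (0 : ℝ) ≤ b := b.cast_nonneg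
  have h := r.eq i
  have : r.eps i (1, 1) = r.t i / (r.t i - (b + 1)) := by
    rw [eq_div_iff (by linarith)]
    simp [eps]
    linear_combination r.t i * h
  rw [this, div_lt_one_of_neg (by linarith)]
  linarith

/-- For each coordinate some unit contracts the two other coordinates. -/
lemma exists_eps_lt_one (i : Fin 3) : ∃ κ, ∀ j ≠ i, r.eps j κ < 1 := by
  match i with
  | 0 =>
    refine ⟨(1, 1), fun j hj => ?_⟩
    match j with
    | 0 => exact absurd rfl hj
    | 1 => exact r.eps_lt_one_of_neg r.neg₁
    | 2 => exact r.eps_lt_one_of_neg (by linarith [r.lt_neg_one₂])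
  | 1 =>
    refine ⟨(-1, 0), fun j hj => ?_⟩
    match j with
    | 0 => simpa [eps] using inv_lt_one_of_one_lt₀ r.one_lt_sq₀
    | 1 => exact absurd rfl hj
    | 2 => simpa [eps] using inv_lt_one_of_one_lt₀ r.one_lt_sq₂
  | 2 =>
    refine ⟨(0, -1), fun j hj => ?_⟩
    match j with
    | 0 => simpa [eps] using inv_lt_one_of_one_lt₀ r.one_lt_add₀
    | 1 => simpa [eps] using inv_lt_one_of_one_lt₀ r.one_lt_add₁
    | 2 => exact absurd rfl hj

/-- The determinant of the logarithmic lattice of the units is positive. -/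
lemma regulator_pos : 0 < Real.log (r.t 0 ^ 2) * Real.log (r.t 1 + (a + 2)) -
    Real.log (r.t 1 ^ 2) * Real.log (r.t 0 + (a + 2)) := by
  have h1 := Real.log_pos r.one_lt_sq₀
  have h2 := Real.log_pos r.one_lt_add₁
  have h3 := Real.log_pos r.one_lt_add₀
  have h4 := Real.log_neg (pow_two_pos_of_ne_zero (r.t_ne_zero 1)) r.sq₁_lt_one
  have := mul_pos h1 h2
  have := mul_neg_of_neg_of_pos h4 h3
  linarith

lemma log_eps (i : Fin 3) (κ : ℤ × ℤ) : Real.log (r.eps i κ) =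
    κ.1 * Real.log (r.t i ^ 2) + κ.2 * Real.log (r.t i + (a + 2)) := by
  rw [eps, Real.log_mul (zpow_pos (pow_two_pos_of_ne_zero (r.t_ne_zero i)) _).ne'
    (zpow_pos (r.add_pos i) _).ne', Real.log_zpow, Real.log_zpow]

lemma eq_zero_of_eps {κ : ℤ × ℤ} (h : ∀ i, r.eps i κ = 1) : κ = 0 := by
  have h0 := r.log_eps 0 κ
  have h1 := r.log_eps 1 κ
  rw [h, Real.log_one] at h0 h1
  have hr := r.regulator_pos.ne'
  have k1 : (κ.1 : ℝ) = 0 := by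
    apply mul_left_cancel₀ hr
    linear_combination - Real.log (r.t 1 + (a + 2)) * h0 + Real.log (r.t 0 + (a + 2)) * h1
  have k2 : (κ.2 : ℝ) = 0 := by
    apply mul_left_cancel₀ hr
    linear_combination Real.log (r.t 1 ^ 2) * h0 - Real.log (r.t 0 ^ 2) * h1
  ext
  · exact_mod_cast k1
  · exact_mod_cast k2

lemma eq_zero_of_unit (r : Roots a b) {κ : ℤ × ℤ} (h : toOperator (unit a b κ) ptB = ptB) : κ = 0 :=
  r.eq_zero_of_eps fun i => by simpa [h] using (r.coord_unit i κ ptB).symm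

end Roots

/-! ### Triangles as convex hulls -/

lemma mem_convexHull_triple {E : Type*} [AddCommGroup E] [Module ℝ E] {P Q R x : E} :
    x ∈ convexHull ℝ {P, Q, R} ↔
      ∃ p q s : ℝ, 0 ≤ p ∧ 0 ≤ q ∧ 0 ≤ s ∧ p + q + s = 1 ∧ x = p • P + q • Q + s • R := by
  constructor
  · intro hx
    rw [convexHull_insert (by simp), convexHull_pair, mem_convexJoin] at hx
    obtain ⟨P', rfl, y, ⟨c, d, hc, hd, hcd, rfl⟩, e, f, he, hf, hef, rfl⟩ := hx
    refine ⟨e, f * c, f * d, he, mul_nonneg hf hc, mul_nonneg hf hd, ?_, ?_⟩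
    · rw [add_assoc, ← mul_add, hcd, mul_one, hef]
    · rw [smul_add, smul_smul, smul_smul, add_assoc]
  · rintro ⟨p, q, s, hp, hq, hs, h, rfl⟩
    have := (convex_convexHull ℝ {P, Q, R}).sum_mem (t := Finset.univ) (w := ![p, q, s])
      (z := ![P, Q, R]) (by intro i _; fin_cases i <;> simpa) (by simpa [Fin.sum_univ_three])
      (by intro i _; apply subset_convexHull; fin_cases i <;> simp)
    simpa [Fin.sum_univ_three] using this

/-- The two triangles of the fundamental region. -/
def tri (a b : ℕ) : Bool → Set Space
  | true => convexHull ℝ {ptA a, ptB, ptD b}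
  | false => convexHull ℝ {ptB, ptC a b, ptD b}

/-- The functionals of the two triangles. -/
def triFun (a b : ℕ) : Bool → Space →ₗ[ℝ] ℝ
  | true => funABD a b
  | false => funBCD a b

lemma triFun_of_mem {s : Bool} {v : Space} (hv : v ∈ tri a b s) : triFun a b s v = 1 := by
  cases s <;> obtain ⟨p, q, u, -, -, -, h, rfl⟩ := mem_convexHull_triple.1 hv
  · simpa [triFun, funBCD_ptB, funBCD_ptC, funBCD_ptD] using h
  · simpa [triFun, funABD_ptB, funABD_ptA, funABD_ptD] using h

/-- The cone over a triangle is cut out by the inequalities for the neighbouring triangles. -/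
lemma mem_tri {s : Bool} {v : Space} (h1 : triFun a b s v = 1)
    (h : ∀ κ s', 1 ≤ triFun a b s' (toOperator (unit a b κ) v)) : v ∈ tri a b s := by
  have hX := unit_one_zero (a := a) (b := b)
  have hX' : unit a b (-1, 0) = (unitX a b)⁻¹ := by simp [unit]
  have hY : unit a b (0, -1) = unitY a b := by simp [unit]
  have hY' := unit_zero_one (a := a) (b := b)
  cases s
  · obtain ⟨hB, hC, hD⟩ := bar_nonneg_BCD (v := v) (a := a) (b := b)
      (by simpa [toOperator_one, triFun] using h1.le.trans (h 0 true))
      (by simpa [hX', triFun] using h1.le.trans (h (-1, 0) true))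
      (by simpa [hY', triFun] using h1.le.trans (h (0, 1) true))
    exact mem_convexHull_triple.2 ⟨_, _, _, hB, hC, hD, by rw [← funBCD_eq_sum]; exact h1,
      eq_barycentric_BCD v⟩
  · obtain ⟨hB, hC, hD⟩ := bar_nonneg_ABD (v := v) (a := a) (b := b)
      (by simpa [toOperator_one, triFun] using h1.le.trans (h 0 false))
      (by simpa [hX, triFun] using h1.le.trans (h (1, 0) false))
      (by simpa [hY, triFun] using h1.le.trans (h (0, -1) false))
    exact mem_convexHull_triple.2 ⟨_, _, _, hB, hC, hD, by rw [← funABD_eq_sum]; exact h1,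
      eq_barycentric_ABD v⟩

/-- The values of the functionals in the orbit of the functionals of the triangles are integer
combinations of the coordinates, up to a common denominator. -/
lemma exists_int_triFun (g : SL(3, ℤ)) (s : Bool) : ∃ p q u : ℤ, ∀ v : Space,
    triFun a b s (toOperator g v) = (p * v 0 + q * v 1 + u * v 2) / (a + 2) := by
  have : (a : ℝ) + 2 ≠ 0 := by positivity
  have key : ∃ p q u : ℤ, ∀ v : Space,
      triFun a b s v = (p * v 0 + q * v 1 + u * v 2) / (a + 2) := by
    cases s
    · refine ⟨-1, b + 1, a + 2, fun v => ?_⟩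
      simp [triFun, funBCD_apply]
    · refine ⟨-(a + 1) * (a + 2), (a + 1) * (b + 1) * (a + 2), a + 2, fun v => ?_⟩
      simp only [triFun, funABD_apply]
      push_cast
      field_simp
  obtain ⟨p, q, u, h⟩ := key
  refine ⟨p * g 0 0 + q * g 1 0 + u * g 2 0, p * g 0 1 + q * g 1 1 + u * g 2 1,
    p * g 0 2 + q * g 1 2 + u * g 2 2, fun v => ?_⟩
  rw [h]
  simp only [toOperator_apply]
  push_cast
  ring

/-! ### The totally positive orthant and the orbit of the two forms on it. -/

namespace Roots

variable (r : Roots a b)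

/-- The open orthant of the totally positive points. -/
def orth : Set Space := {v | ∀ i, 0 < r.coord i v}

lemma continuous_coord (i : Fin 3) : Continuous (r.coord i) :=
  (r.coord i).continuous_of_finiteDimensional

lemma isOpen_orth : IsOpen r.orth := by
  simp only [orth, Set.ofPred_forall]
  exact isOpen_iInter_of_finite fun i => isOpen_lt continuous_const (r.continuous_coord i)

lemma convex_orth : Convex ℝ r.orth := by
  intro v hv w hw c d hc hd hcd i
  rw [map_add, map_smul, map_smul, smul_eq_mul, smul_eq_mul]
  rcases hc.eq_or_lt with rfl | hc
  · rw [zero_add] at hcd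
    simpa [hcd] using hw i
  · exact add_pos_of_pos_of_nonneg (mul_pos hc (hv i)) (mul_nonneg hd (hw i).le)

lemma add_mem_orth {v w : Space} (hv : v ∈ r.orth) (hw : w ∈ r.orth) : v + w ∈ r.orth :=
  fun i => by rw [map_add]; exact _root_.add_pos (hv i) (hw i)

lemma smul_mem_orth {v : Space} (hv : v ∈ r.orth) {c : ℝ} (hc : 0 < c) : c • v ∈ r.orth :=
  fun i => by rw [map_smul]; exact mul_pos hc (hv i)

lemma ptB_mem_orth : ptB ∈ r.orth := fun i => by simp

lemma nonneg_of_mem_closure {v : Space} (hv : v ∈ closure r.orth) (i : Fin 3) :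
    0 ≤ r.coord i v :=
  closure_minimal (fun w (hw : w ∈ r.orth) => (hw i).le)
    (isClosed_le continuous_const (r.continuous_coord i)) hv

lemma unit_mem_orth {v : Space} (κ : ℤ × ℤ) (hv : v ∈ r.orth) :
    toOperator (unit a b κ) v ∈ r.orth :=
  fun i => by rw [r.coord_unit]; exact mul_pos (r.eps_pos i κ) (hv i)

lemma triFun_dual_pos (s : Bool) (i : Fin 3) : 0 < triFun a b s (r.dual i) := by
  cases s
  · exact r.funBCD_dual_pos i
  · exact r.funABD_dual_pos i

lemma triFun_pos {v : Space} (hv : v ∈ r.orth) (s : Bool) : 0 < triFun a b s v :=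
  r.pos_of_dual_pos (r.triFun_dual_pos s) hv

lemma one_le_triFun {v : Space} (hv : v ∈ r.orth) (hi : IsIntegerPoint v) (s : Bool) :
    1 ≤ triFun a b s v := by
  cases s
  · exact r.one_le_funBCD hi hv
  · exact r.one_le_funABD hi hv

lemma unit_dual (κ : ℤ × ℤ) (i : Fin 3) :
    toOperator (unit a b κ) (r.dual i) = r.eps i κ • r.dual i := by
  apply r.coord_ext
  intro j
  rw [r.coord_unit, map_smul, smul_eq_mul]
  rcases eq_or_ne j i with rfl | h
  · rfl
  · simp [r.coord_dual_ne h]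

lemma orbitFun_dual_pos (κ : ℤ × ℤ) (s : Bool) (i : Fin 3) :
    0 < triFun a b s (toOperator (unit a b κ) (r.dual i)) := by
  rw [r.unit_dual, map_smul]
  exact mul_pos (r.eps_pos i κ) (r.triFun_dual_pos s i)

/-- The forms of the orbit are positive on the dual eigenvectors, so a bound at v bounds each of
those values and hence the form at every fixed vector. Applied to the standard basis, this bounds
the coefficients, which are integers over a + 2; finitely many remain. -/
lemma finite_orbitFun_le {v : Space} (hv : v ∈ r.orth) (c : ℝ) :
    {x | (∃ κ s, x = triFun a b s (toOperator (unit a b κ) v)) ∧ x ≤ c}.Finite := by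
  have bound : ∀ e : Space, ∃ N : ℤ, ∀ κ s, triFun a b s (toOperator (unit a b κ) v) ≤ c →
      |(a + 2) * triFun a b s (toOperator (unit a b κ) e)| ≤ N := by
    intro e
    obtain ⟨N, hN⟩ := exists_int_gt ((a + 2) * ∑ i, |r.coord i e| * (c / r.coord i v))
    refine ⟨N, fun κ s h => le_trans ?_ hN.le⟩
    have ha : (0 : ℝ) ≤ a + 2 := by positivity
    rw [abs_mul, abs_of_nonneg ha]
    refine mul_le_mul_of_nonneg_left ?_ ha
    have hsum := r.map_eq_sum (triFun a b s ∘ₗ toOperator (unit a b κ))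
    rw [← LinearMap.comp_apply, hsum e]
    refine (Finset.abs_sum_le_sum_abs _ _).trans (Finset.sum_le_sum fun i _ => ?_)
    rw [abs_mul]
    refine mul_le_mul_of_nonneg_left ?_ (abs_nonneg _)
    have hp := r.orbitFun_dual_pos κ s
    rw [LinearMap.comp_apply, abs_of_pos (hp i), le_div_iff₀ (hv i), mul_comm]
    refine le_trans ?_ h
    rw [← LinearMap.comp_apply, ← LinearMap.comp_apply, hsum v]
    exact Finset.single_le_sum (f := fun j => r.coord j v *
      (triFun a b s ∘ₗ toOperator (unit a b κ)) (r.dual j))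
      (fun j _ => mul_nonneg (hv j).le (hp j).le) (Finset.mem_univ i)
  obtain ⟨N0, h0⟩ := bound !₂[1, 0, 0]
  obtain ⟨N1, h1⟩ := bound !₂[0, 1, 0]
  obtain ⟨N2, h2⟩ := bound !₂[0, 0, 1]
  have hα : (a : ℝ) + 2 ≠ 0 := by positivity
  refine ((((Set.finite_Icc (-N0) N0).prod (Set.finite_Icc (-N1) N1)).prod
    (Set.finite_Icc (-N2) N2)).image
      fun k : (ℤ × ℤ) × ℤ => (k.1.1 * v 0 + k.1.2 * v 1 + k.2 * v 2) / (a + 2)).subset ?_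
  rintro x ⟨⟨κ, s, rfl⟩, hx⟩
  obtain ⟨p, q, u, h⟩ := exists_int_triFun (a := a) (b := b) (unit a b κ) s
  refine ⟨((p, q), u), ?_, (h v).symm⟩
  have k0 := h0 κ s hx
  have k1 := h1 κ s hx
  have k2 := h2 κ s hx
  rw [h, mul_div_cancel₀ _ hα] at k0 k1 k2
  simp at k0 k1 k2
  simp only [Set.mem_prod, Set.mem_Icc, ← abs_le]
  exact ⟨⟨by exact_mod_cast k0, by exact_mod_cast k1⟩, by exact_mod_cast k2⟩

lemma exists_min {v : Space} (hv : v ∈ r.orth) : ∃ κ s, ∀ κ' s',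
    triFun a b s (toOperator (unit a b κ) v) ≤ triFun a b s' (toOperator (unit a b κ') v) := by
  set c := triFun a b true (toOperator (unit a b 0) v) with hc
  obtain ⟨x, ⟨⟨κ, s, rfl⟩, hx⟩, hmin⟩ := Set.exists_min_image _ id (r.finite_orbitFun_le hv c)
    ⟨c, ⟨0, true, rfl⟩, le_rfl⟩
  refine ⟨κ, s, fun κ' s' => ?_⟩
  rcases le_or_gt (triFun a b s' (toOperator (unit a b κ') v)) c with h | h
  · exact hmin _ ⟨⟨κ', s', rfl⟩, h⟩
  · exact hx.trans h.le

/-! ### The convex hull of the integer points -/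

/-- The polyhedron cut out by the orbits of the functionals of the two triangles. -/
def hull : Set Space :=
  {v | v ∈ r.orth ∧ ∀ κ s, 1 ≤ triFun a b s (toOperator (unit a b κ) v)}

/-- Every point of the orthant is proportional to a point of a triangle. -/
lemma exists_eq_smul_tri {v : Space} (hv : v ∈ r.orth) : ∃ κ s, ∃ p ∈ tri a b s, ∃ c : ℝ, 0 < c ∧
    toOperator (unit a b κ) v = c • p ∧ c = triFun a b s (toOperator (unit a b κ) v) := by
  obtain ⟨κ, s, h⟩ := r.exists_min hv
  have hpos := r.triFun_pos (r.unit_mem_orth κ hv) s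
  -- The form with the smallest value at v is scaled to the value 1. All the others are then at
  -- least 1 and `mem_tri` applies.
  refine ⟨κ, s, (triFun a b s (toOperator (unit a b κ) v))⁻¹ • toOperator (unit a b κ) v,
    mem_tri ?_ ?_, _, hpos, ?_, rfl⟩
  · rw [map_smul, smul_eq_mul, inv_mul_cancel₀ hpos.ne']
  · intro κ' s'
    rw [map_smul, map_smul, smul_eq_mul, ← div_eq_inv_mul, one_le_div hpos, ← toOperator_unit_add]
    exact h _ _
  · rw [smul_smul, mul_inv_cancel₀ hpos.ne', one_smul]

lemma unit_mem_hull {v : Space} (κ : ℤ × ℤ) (hv : v ∈ r.hull) :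
    toOperator (unit a b κ) v ∈ r.hull :=
  ⟨r.unit_mem_orth κ hv.1, fun κ' s => by rw [← toOperator_unit_add]; exact hv.2 _ _⟩

lemma convex_hull : Convex ℝ r.hull := by
  intro v hv w hw c d hc hd hcd
  refine ⟨r.convex_orth hv.1 hw.1 hc hd hcd, fun κ s => ?_⟩
  rw [map_add, map_add, map_smul, map_smul, map_smul, map_smul, smul_eq_mul, smul_eq_mul]
  nlinarith [hv.2 κ s, hw.2 κ s]

lemma integer_mem_hull {v : Space} (hv : v ∈ r.orth) (hi : IsIntegerPoint v) : v ∈ r.hull :=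
  ⟨hv, fun κ s => r.one_le_triFun (r.unit_mem_orth κ hv) (hi.map _) s⟩

/-- The walls of the orthant contain no nonzero integer point, so passing to the closure adds only
the origin to the integer points. -/
lemma integer_set_eq : {x | x ∈ closure r.orth ∧ IsIntegerPoint x ∧ x ≠ 0} =
    {x | x ∈ r.orth ∧ IsIntegerPoint x} := by
  ext x
  constructor
  · rintro ⟨h, hi, h0⟩
    exact ⟨fun i => lt_of_le_of_ne (r.nonneg_of_mem_closure h i) (r.coord_ne_zero hi h0 i).symm, hi⟩
  · rintro ⟨h, hi⟩
    refine ⟨subset_closure h, hi, ?_⟩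
    rintro rfl
    simpa using h 0

lemma ptB_mem_hull : ptB ∈ r.hull := r.integer_mem_hull r.ptB_mem_orth isIntegerPoint_ptB

lemma ptC_eq : ptC a b = toOperator (unit a b (1, 0)) ptB := by
  rw [unit_one_zero, unitX_ptB]

lemma ptA_eq : ptA a = toOperator (unit a b (0, 1)) ptB := by
  rw [unit_zero_one, toOperator_inv_eq unitY_ptA]

lemma ptD_eq : ptD b = toOperator (unit a b (1, 1)) ptB := by
  rw [← unitX_ptA (a := a), ptA_eq (b := b), ← unit_one_zero, ← toOperator_unit_add]
  rfl

lemma unit_integer_mem (κ : ℤ × ℤ) : toOperator (unit a b κ) ptB ∈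
    {x | x ∈ r.orth ∧ IsIntegerPoint x} :=
  ⟨r.unit_mem_orth κ r.ptB_mem_orth, isIntegerPoint_ptB.map _⟩

lemma tri_subset (s : Bool) : tri a b s ⊆ convexHull ℝ {x | x ∈ r.orth ∧ IsIntegerPoint x} := by
  have hB : ptB ∈ {x | x ∈ r.orth ∧ IsIntegerPoint x} := ⟨r.ptB_mem_orth, isIntegerPoint_ptB⟩
  have hA := r.unit_integer_mem (0, 1)
  have hC := r.unit_integer_mem (1, 0)
  have hD := r.unit_integer_mem (1, 1)
  rw [← ptA_eq] at hA
  rw [← ptC_eq] at hC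
  rw [← ptD_eq] at hD
  cases s <;> apply convexHull_mono <;> rintro x (rfl | rfl | rfl) <;> assumption

lemma image_integer_set (κ : ℤ × ℤ) :
    toOperator (unit a b κ) '' {x | x ∈ r.orth ∧ IsIntegerPoint x} =
      {x | x ∈ r.orth ∧ IsIntegerPoint x} := by
  ext x
  constructor
  · rintro ⟨y, ⟨hy, hi⟩, rfl⟩
    exact ⟨r.unit_mem_orth κ hy, hi.map _⟩
  · rintro ⟨hx, hi⟩
    exact ⟨toOperator (unit a b (-κ)) x, ⟨r.unit_mem_orth _ hx, hi.map _⟩,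
      toOperator_unit_cancel_neg κ x⟩

/-- For an integer point x and an integer N > c, the point c x lies between the integer points x and
N x. The general case follows by convexity. -/
lemma smul_mem_integerHull {v : Space}
    (hv : v ∈ convexHull ℝ {x | x ∈ r.orth ∧ IsIntegerPoint x}) {c : ℝ} (hc : 1 ≤ c) :
    c • v ∈ convexHull ℝ {x | x ∈ r.orth ∧ IsIntegerPoint x} := by
  suffices h : convexHull ℝ {x | x ∈ r.orth ∧ IsIntegerPoint x} ⊆
      (fun v => c • v) ⁻¹' convexHull ℝ {x | x ∈ r.orth ∧ IsIntegerPoint x} from h hv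
  refine convexHull_min ?_ ((convex_convexHull ℝ _).is_linear_preimage
    (IsLinearMap.isLinearMap_smul c))
  rintro x ⟨hx, hi⟩
  obtain ⟨N, hN⟩ := exists_nat_gt c
  have hN1 : 0 < (N : ℝ) - 1 := by linarith
  have hxN : (N : ℝ) • x ∈ {x | x ∈ r.orth ∧ IsIntegerPoint x} := by
    refine ⟨r.smul_mem_orth hx (by linarith), fun i => ?_⟩
    obtain ⟨k, hk⟩ := hi i
    exact ⟨N * k, by simp [hk]⟩
  have hseg : c • x ∈ segment ℝ x ((N : ℝ) • x) := by
    refine ⟨(N - c) / (N - 1), (c - 1) / (N - 1), div_nonneg (by linarith) hN1.le,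
      div_nonneg (by linarith) hN1.le, ?_, ?_⟩
    · field_simp
      ring
    · rw [smul_smul, ← add_smul]
      congr 1
      field_simp
      ring
  have hx' : x ∈ {x | x ∈ r.orth ∧ IsIntegerPoint x} := ⟨hx, hi⟩
  exact (convex_convexHull ℝ _).segment_subset (subset_convexHull ℝ _ hx')
    (subset_convexHull ℝ _ hxN) hseg

/-- The nontrivial inclusion: after a unit, a point of the polyhedron is c p with p in a triangle
spanned by integer points, and c ≥ 1 since c is the value of one of the defining forms. -/
lemma integerHull_eq : integerHull r.orth = r.hull := by
  rw [integerHull, integer_set_eq]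
  apply Set.Subset.antisymm
  · exact convexHull_min (fun x hx => r.integer_mem_hull hx.1 hx.2) r.convex_hull
  · intro v hv
    obtain ⟨κ, s, p, hp, c, hc, h, hc'⟩ := r.exists_eq_smul_tri hv.1
    have hc1 : 1 ≤ c := by rw [hc']; exact hv.2 κ s
    have hu := r.smul_mem_integerHull (r.tri_subset s hp) hc1
    rw [← h] at hu
    rw [← toOperator_unit_neg_cancel κ v, ← r.image_integer_set (-κ),
      ← LinearMap.image_convexHull]
    exact ⟨_, hu, rfl⟩

lemma tri_subset_hull (s : Bool) : tri a b s ⊆ r.hull := by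
  rw [← integerHull_eq, integerHull, integer_set_eq]
  exact r.tri_subset s

lemma tri_eq (s : Bool) : tri a b s = {v ∈ r.hull | triFun a b s v = 1} := by
  ext v
  exact ⟨fun h => ⟨r.tri_subset_hull s h, triFun_of_mem h⟩, fun h => mem_tri h.2 h.1.2⟩

/-! ### The sail -/

lemma add_mem_hull {v w : Space} (hv : v ∈ r.hull) (hw : w ∈ r.orth) : v + w ∈ r.hull := by
  refine ⟨r.add_mem_orth hv.1 hw, fun κ s => ?_⟩
  rw [map_add, map_add]
  have := hv.2 κ s
  have := r.triFun_pos (r.unit_mem_orth κ hw) s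
  linarith

/-- The translate v + orthant is open, lies in the polyhedron and contains every multiple c v with c
> 1. -/
lemma smul_mem_interior {v : Space} (hv : v ∈ r.hull) {c : ℝ} (hc : 1 < c) :
    c • v ∈ interior r.hull := by
  rw [mem_interior]
  refine ⟨(fun w => w - v) ⁻¹' r.orth, fun w hw => ?_, r.isOpen_orth.preimage (by fun_prop), ?_⟩
  · have := r.add_mem_hull hv hw
    rwa [add_sub_cancel] at this
  · have : c • v - v = (c - 1) • v := by rw [sub_smul, one_smul]
    rw [Set.mem_preimage, this]
    exact r.smul_mem_orth hv.1 (by linarith)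

open Filter Topology in
-- The form inequalities pass to the limit; only the open condition on the orthant is in doubt. At a
-- limit point with i-th coordinate 0, the powers of a unit contracting the two other coordinates
-- would drive a form to 0, against the bound 1.
lemma isClosed_hull : IsClosed r.hull := by
  rw [← closure_subset_iff_isClosed]
  intro x hx
  have hnn : ∀ i, 0 ≤ r.coord i x := r.nonneg_of_mem_closure (closure_mono (fun v hv => hv.1) hx)
  have hge : ∀ κ s, 1 ≤ triFun a b s (toOperator (unit a b κ) x) := by
    intro κ s
    have hcont : Continuous (triFun a b s ∘ₗ toOperator (unit a b κ)) :=
      LinearMap.continuous_of_finiteDimensional _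
    exact closure_minimal (fun v hv => hv.2 κ s) (isClosed_le continuous_const hcont) hx
  refine ⟨fun i => (hnn i).lt_of_ne fun h0 => ?_, hge⟩
  obtain ⟨κ, hκ⟩ := r.exists_eps_lt_one i
  have hlim : Tendsto (fun n : ℕ => triFun a b true (toOperator (unit a b (n • κ)) x)) atTop
      (𝓝 0) := by
    have hexp : ∀ n : ℕ, triFun a b true (toOperator (unit a b (n • κ)) x) =
        ∑ j, r.eps j κ ^ n * (r.coord j x * triFun a b true (r.dual j)) := by
      intro n
      rw [r.map_eq_sum]
      refine Finset.sum_congr rfl fun j _ => ?_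
      rw [r.coord_unit, r.eps_nsmul, mul_assoc]
    simp only [hexp]
    rw [← Finset.sum_const_zero (s := (Finset.univ : Finset (Fin 3)))]
    refine tendsto_finsetSum _ fun j _ => ?_
    rcases eq_or_ne j i with rfl | hj
    · simp [← h0]
    · simpa using (tendsto_pow_atTop_nhds_zero_of_lt_one (r.eps_pos j κ).le (hκ j hj)).mul_const
        (r.coord j x * triFun a b true (r.dual j))
  exact absurd (ge_of_tendsto' hlim fun n => hge _ _) (by norm_num)

/-- Where the smallest form of the orbit exceeds 1, the point is a proper multiple of a point of the
polyhedron, hence interior. Where some form equals 1, shrinking the point slightly leaves the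
polyhedron. -/
lemma sail_eq : sail r.orth =
    {v ∈ r.hull | ∃ κ s, triFun a b s (toOperator (unit a b κ) v) = 1} := by
  rw [sail, integerHull_eq, frontier, r.isClosed_hull.closure_eq]
  ext v
  refine and_congr_right fun hv => ?_
  constructor
  · intro hni
    obtain ⟨κ, s, p, hp, c, hc, h, hc'⟩ := r.exists_eq_smul_tri hv.1
    refine ⟨κ, s, ?_⟩
    have hc1 : 1 ≤ c := by rw [hc']; exact hv.2 κ s
    rcases hc1.eq_or_lt with h1 | h1
    · rw [← hc', ← h1]
    · refine absurd ?_ hni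
      have := r.smul_mem_interior (r.unit_mem_hull (-κ) (r.tri_subset_hull s hp)) h1
      rwa [← map_smul, ← h, toOperator_unit_neg_cancel] at this
  · rintro ⟨κ, s, h⟩ hint
    have hc : Continuous fun c : ℝ => c • v := by fun_prop
    have hnhds : (fun c : ℝ => c • v) ⁻¹' interior r.hull ∈ nhds (1 : ℝ) :=
      (isOpen_interior.preimage hc).mem_nhds (by simpa using hint)
    obtain ⟨ε, hε, hball⟩ := Metric.mem_nhds_iff.1 hnhds
    have hmem := interior_subset (hball (show 1 - ε / 2 ∈ Metric.ball (1 : ℝ) ε by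
      rw [Metric.mem_ball, Real.dist_eq]
      rw [show 1 - ε / 2 - 1 = -(ε / 2) by ring, abs_neg, abs_of_pos (by linarith)]
      linarith))
    have := hmem.2 κ s
    rw [map_smul, map_smul, h, smul_eq_mul] at this
    linarith

lemma tri_subset_sail (s : Bool) : tri a b s ⊆ sail r.orth := by
  rw [r.sail_eq, r.tri_eq]
  rintro v ⟨hv, h⟩
  exact ⟨hv, 0, s, by simpa [toOperator_one] using h⟩

lemma sail_subset_hull : sail r.orth ⊆ r.hull := by
  rw [r.sail_eq]
  exact fun v hv => hv.1

/-- The orbits of the triangles cover the sail. -/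
lemma exists_mem_tri {v : Space} (hv : v ∈ sail r.orth) :
    ∃ κ s, toOperator (unit a b κ) v ∈ tri a b s := by
  rw [r.sail_eq] at hv
  obtain ⟨hv, κ, s, h⟩ := hv
  exact ⟨κ, s, by rw [r.tri_eq]; exact ⟨r.unit_mem_hull κ hv, h⟩⟩

lemma unit_mem_sail {v : Space} (κ : ℤ × ℤ) (hv : v ∈ sail r.orth) :
    toOperator (unit a b κ) v ∈ sail r.orth := by
  rw [r.sail_eq] at hv ⊢
  obtain ⟨hv, μ, s, h⟩ := hv
  refine ⟨r.unit_mem_hull κ hv, μ - κ, s, ?_⟩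
  rw [← toOperator_unit_add, sub_add_cancel, h]

end Roots

/-! ### Linear independence of the corners -/

lemma linearIndep_ABD {p q s : ℝ} (h : p • ptA a + q • ptB + s • ptD b = 0) :
    p = 0 ∧ q = 0 ∧ s = 0 := by
  have hb : (b : ℝ) + 1 ≠ 0 := by positivity
  have h0 := congrArg (fun v : Space => v 0) h
  have h1 := congrArg (fun v : Space => v 1) h
  have h2 := congrArg (fun v : Space => v 2) h
  simp [ptA, ptB, ptD] at h0 h1 h2
  have hs : s = 0 := h1.resolve_right hb
  subst hs
  simp at h0 h2
  subst h0
  simp at h2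
  exact ⟨rfl, h2, rfl⟩

lemma linearIndep_BCD {p q s : ℝ} (h : p • ptB + q • ptC a b + s • ptD b = 0) :
    p = 0 ∧ q = 0 ∧ s = 0 := by
  have ha : (a : ℝ) + 2 ≠ 0 := by positivity
  have hb : (b : ℝ) + 1 ≠ 0 := by positivity
  have h0 := congrArg (fun v : Space => v 0) h
  have h1 := congrArg (fun v : Space => v 1) h
  have h2 := congrArg (fun v : Space => v 2) h
  simp [ptC, ptB, ptD] at h0 h1 h2
  have hq : q = 0 := by
    apply mul_left_cancel₀ ha
    linear_combination (b + 1) * h1 - h0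
  subst hq
  simp at h1
  have hs : s = 0 := h1.resolve_right hb
  subst hs
  simp at h2
  exact ⟨h2, rfl, rfl⟩

lemma affineIndependent_triple {P Q R : Space}
    (h : ∀ p q s : ℝ, p • P + q • Q + s • R = 0 → p = 0 ∧ q = 0 ∧ s = 0) :
    AffineIndependent ℝ ![P, Q, R] := by
  rw [affineIndependent_iff_of_fintype]
  intro w hw h0 i
  rw [Finset.weightedVSub_eq_linear_combination _ hw] at h0
  simp [Fin.sum_univ_three] at h0
  obtain ⟨e0, e1, e2⟩ := h _ _ _ h0
  fin_cases i <;> assumption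

lemma finrank_vectorSpan_triple {P Q R : Space}
    (h : ∀ p q s : ℝ, p • P + q • Q + s • R = 0 → p = 0 ∧ q = 0 ∧ s = 0) :
    Module.finrank ℝ (vectorSpan ℝ (convexHull ℝ {P, Q, R})) = 2 := by
  have h2 := (affineIndependent_triple h).finrank_vectorSpan (n := 2) (by simp)
  rw [← direction_affineSpan, affineSpan_convexHull, direction_affineSpan, ← h2]
  have hr : Set.range ![P, Q, R] = {P, Q, R} := by
    simp [Set.insert_comm]
    ext x
    simp only [Set.mem_insert_iff, Set.mem_singleton_iff]
    tauto
  rw [hr]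

lemma finrank_vectorSpan_segment {P Q : Space} (h : P ≠ Q) :
    Module.finrank ℝ (vectorSpan ℝ (segment ℝ P Q)) = 1 := by
  rw [← convexHull_pair, ← direction_affineSpan, affineSpan_convexHull, direction_affineSpan,
    vectorSpan_pair]
  exact finrank_span_singleton (by simpa [sub_eq_zero] using h)

/-! ### Faces -/

/-- A set of contact of a polyhedron with a plane that separates it from the origin, the plane
being normalized. -/
def IsContact (K F : Set Space) : Prop :=
  F.Nonempty ∧ ∃ l : Space →ₗ[ℝ] ℝ, (∀ v ∈ K, 1 ≤ l v) ∧ F = {v ∈ K | l v = 1}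

namespace Roots

variable (r : Roots a b)

lemma smul_mem_hull {v : Space} (hv : v ∈ r.hull) {c : ℝ} (hc : 1 ≤ c) : c • v ∈ r.hull := by
  rcases hc.eq_or_lt with rfl | hc
  · simpa
  · exact interior_subset (r.smul_mem_interior hv hc)

/-- The polyhedron is stable under doubling, so the maximum of the exposing functional is at most 0.
If it were 0, the functional would be nonpositive near the interior point 2x, where it vanishes,
hence identically zero, and F would be everything. So the maximum is negative and division by it
normalizes the functional. -/
lemma isContact_of_exposed {F : Set Space} (h1 : F.Nonempty) (h2 : F ≠ r.hull)
    (h3 : IsExposed ℝ r.hull F) : IsContact r.hull F := by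
  refine ⟨h1, ?_⟩
  obtain ⟨l, rfl⟩ := h3 h1
  obtain ⟨x, hx, hmax⟩ := h1
  have hle : l x ≤ 0 := by
    have := hmax _ (r.smul_mem_hull hx one_le_two)
    rw [map_smul, smul_eq_mul] at this
    linarith
  have hlt : l x < 0 := by
    refine hle.lt_of_ne fun h0 => h2 ?_
    have hint := r.smul_mem_interior hx one_lt_two
    have hzero : ∀ v, l v ≤ 0 := by
      intro v
      have hc : Continuous fun c : ℝ => (2 : ℝ) • x + c • v := by fun_prop
      have hnhds : (fun c : ℝ => (2 : ℝ) • x + c • v) ⁻¹' interior r.hull ∈ nhds (0 : ℝ) :=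
        (isOpen_interior.preimage hc).mem_nhds (by simpa using hint)
      obtain ⟨ε, hε, hball⟩ := Metric.mem_nhds_iff.1 hnhds
      have hmem := interior_subset (hball (show ε / 2 ∈ Metric.ball (0 : ℝ) ε by
        rw [Metric.mem_ball, Real.dist_eq, sub_zero, abs_of_pos (by linarith)]
        linarith))
      have := hmax _ hmem
      rw [map_add, map_smul, map_smul, h0, smul_zero, zero_add, smul_eq_mul] at this
      nlinarith
    have hzero' : ∀ v, l v = 0 := fun v =>
      le_antisymm (hzero v) (by have := hzero (-v); rw [map_neg] at this; linarith)
    ext v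
    simp [hzero']
  refine ⟨(l x)⁻¹ • l.toLinearMap, fun v hv => ?_, ?_⟩
  · have := hmax v hv
    simp only [LinearMap.smul_apply, ContinuousLinearMap.coe_coe, smul_eq_mul]
    rw [← div_eq_inv_mul, one_le_div_of_neg hlt]
    exact this
  · ext v
    refine and_congr_right fun hv => ?_
    simp only [LinearMap.smul_apply, ContinuousLinearMap.coe_coe, smul_eq_mul]
    rw [inv_mul_eq_one₀ hlt.ne]
    exact ⟨fun h => le_antisymm (h x hx) (hmax v hv), fun h y hy => h ▸ hmax y hy⟩

lemma exposed_of_isContact {F : Set Space} (h : IsContact r.hull F) :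
    F ≠ r.hull ∧ IsExposed ℝ r.hull F := by
  obtain ⟨⟨x, hx⟩, l, hl, rfl⟩ := h
  constructor
  · intro heq
    have h2 := r.smul_mem_hull hx.1 one_le_two
    rw [← heq] at h2
    have := h2.2
    rw [map_smul, hx.2] at this
    norm_num at this
  · intro _
    refine ⟨-l.toContinuousLinearMap, ?_⟩
    ext v
    simp only [Set.mem_ofPred, _root_.neg_apply, LinearMap.coe_toContinuousLinearMap',
      neg_le_neg_iff]
    refine and_congr_right fun hv => ⟨fun h y hy => h ▸ hl y hy, fun h => ?_⟩
    exact le_antisymm (hx.2 ▸ h x hx.1) (hl v hv)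

lemma isFace_iff {F : Set Space} {k : ℕ} : IsFace r.orth k F ↔
    IsContact r.hull F ∧ Module.finrank ℝ (vectorSpan ℝ F) = k := by
  rw [IsFace, integerHull_eq]
  constructor
  · rintro ⟨h1, h2, h3, h4⟩
    exact ⟨r.isContact_of_exposed h1 h2 h3, h4⟩
  · rintro ⟨h, h4⟩
    exact ⟨h.1, (r.exposed_of_isContact h).1, (r.exposed_of_isContact h).2, h4⟩

lemma isContact_image {F : Set Space} (h : IsContact r.hull F) (κ : ℤ × ℤ) :
    IsContact r.hull (toOperator (unit a b κ) '' F) := by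
  obtain ⟨h1, l, hl, rfl⟩ := h
  refine ⟨h1.image _, l ∘ₗ toOperator (unit a b (-κ)), fun v hv => hl _ (r.unit_mem_hull _ hv), ?_⟩
  ext v
  constructor
  · rintro ⟨w, ⟨hw, hw'⟩, rfl⟩
    exact ⟨r.unit_mem_hull _ hw, by rwa [LinearMap.comp_apply, toOperator_unit_neg_cancel]⟩
  · rintro ⟨hv, h⟩
    exact ⟨_, ⟨r.unit_mem_hull (-κ) hv, h⟩, toOperator_unit_cancel_neg _ _⟩

/-- A point of contact is c p with p in the polyhedron and c ≥ 1; the contact form is at least 1 at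
p, so c = 1. -/
lemma contact_subset_sail {F : Set Space} (h : IsContact r.hull F) : F ⊆ sail r.orth := by
  obtain ⟨-, l, hl, rfl⟩ := h
  rintro v ⟨hv, hlv⟩
  obtain ⟨κ, s, p, hp, c, hc, h, hc'⟩ := r.exists_eq_smul_tri hv.1
  have hc1 : 1 ≤ c := by rw [hc']; exact hv.2 κ s
  have hv' : v = c • toOperator (unit a b (-κ)) p := by
    rw [← map_smul, ← h, toOperator_unit_neg_cancel]
  have hlp := hl _ (r.unit_mem_hull (-κ) (r.tri_subset_hull s hp))
  have hc2 : c = 1 := by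
    rw [hv', map_smul, smul_eq_mul] at hlv
    nlinarith
  rw [r.sail_eq]
  exact ⟨hv, κ, s, by rw [← hc', hc2]⟩

/-! #### The standard faces -/

lemma isContact_tri (s : Bool) : IsContact r.hull (tri a b s) := by
  refine ⟨?_, triFun a b s, fun v hv => ?_, r.tri_eq s⟩
  · cases s <;> exact ⟨ptB, subset_convexHull _ _ (by simp)⟩
  · simpa [toOperator_one] using hv.2 0 s

/-- The functional of the triangle adjacent to `ABD` along an edge. -/
lemma contact_inter {l₁ l₂ : Space →ₗ[ℝ] ℝ} {K : Set Space} (h₁ : ∀ v ∈ K, 1 ≤ l₁ v)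
    (h₂ : ∀ v ∈ K, 1 ≤ l₂ v) (hne : {v ∈ K | l₁ v = 1 ∧ l₂ v = 1}.Nonempty) :
    IsContact K {v ∈ K | l₁ v = 1 ∧ l₂ v = 1} := by
  refine ⟨hne, (1 / 2 : ℝ) • (l₁ + l₂), fun v hv => ?_, ?_⟩
  · have := h₁ v hv
    have := h₂ v hv
    simp only [LinearMap.smul_apply, LinearMap.add_apply, smul_eq_mul]
    linarith
  · ext v
    refine and_congr_right fun hv => ?_
    have := h₁ v hv
    have := h₂ v hv
    simp only [LinearMap.smul_apply, LinearMap.add_apply, smul_eq_mul]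
    constructor
    · rintro ⟨h, h'⟩
      rw [h, h']
      norm_num
    · intro h
      constructor <;> linarith

/-- The functional of the neighbour of `ABD` that is the image of `BCD`. -/
def nbrFun (a b : ℕ) (κ : ℤ × ℤ) : Space →ₗ[ℝ] ℝ := funBCD a b ∘ₗ toOperator (unit a b κ)

lemma one_le_nbrFun {v : Space} (hv : v ∈ r.hull) (κ : ℤ × ℤ) : 1 ≤ nbrFun a b κ v :=
  hv.2 κ false

lemma one_le_funABD' {v : Space} (hv : v ∈ r.hull) : 1 ≤ funABD a b v := by
  simpa [toOperator_one, triFun] using hv.2 0 true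

lemma nbrFun_zero (v : Space) : nbrFun a b 0 v = funBCD a b v := by
  simp [nbrFun, toOperator_one]

lemma nbrFun_X (v : Space) : nbrFun a b (1, 0) v = funBCD a b (toOperator (unitX a b) v) := by
  rw [nbrFun, LinearMap.comp_apply, unit_one_zero]

lemma nbrFun_Y (v : Space) : nbrFun a b (0, -1) v = funBCD a b (toOperator (unitY a b) v) := by
  simp [nbrFun, unit]

lemma mem_triABD {v : Space} : v ∈ r.hull ∧ funABD a b v = 1 ↔
    ∃ p q s : ℝ, 0 ≤ p ∧ 0 ≤ q ∧ 0 ≤ s ∧ p + q + s = 1 ∧ v = p • ptA a + q • ptB + s • ptD b := by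
  rw [← mem_convexHull_triple]
  exact (Set.ext_iff.1 (r.tri_eq true) v).symm

lemma bar_combo (p q s : ℝ) : barA b (p • ptA a + q • ptB + s • ptD b) = p ∧
    barB a b (p • ptA a + q • ptB + s • ptD b) = q ∧
    barD b (p • ptA a + q • ptB + s • ptD b) = s := by
  have : (b : ℝ) + 1 ≠ 0 := by positivity
  refine ⟨?_, ?_, ?_⟩ <;> simp [barA, barB, barD, ptA, ptB, ptD] <;> field_simp <;> ring

/-- On the plane ABD the form of the neighbour X⁻¹(BCD) is 1 plus a positive multiple of the
coordinate at D, so it equals 1 exactly where that coordinate vanishes. The edges AD and BD are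
handled alike with their own neighbours. -/
lemma edge_AB_eq : {v ∈ r.hull | funABD a b v = 1 ∧ nbrFun a b (1, 0) v = 1} =
    segment ℝ (ptA a) ptB := by
  have ha : (0 : ℝ) ≤ a := a.cast_nonneg
  have hb : (0 : ℝ) ≤ b := b.cast_nonneg
  have hc : ((b : ℝ) + 1) * ((a + 2) * (b + 1) - 1) / (a + 2) ≠ 0 :=
    (div_pos (mul_pos (by linarith) (by nlinarith)) (by linarith)).ne'
  ext v
  rw [Set.mem_ofPred, ← and_assoc, r.mem_triABD, nbrFun_X]
  constructor
  · rintro ⟨⟨p, q, s, hp, hq, hs, h, rfl⟩, h2⟩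
    have e := funBCD_unitX_sub (a := a) (b := b) (p • ptA a + q • ptB + s • ptD b)
    rw [h2, (bar_combo p q s).2.2] at e
    simp only [map_add, map_smul, funABD_ptA, funABD_ptB, funABD_ptD, smul_eq_mul, mul_one, h,
      sub_self] at e
    obtain rfl : s = 0 := (mul_eq_zero.1 e.symm).resolve_left hc
    exact ⟨p, q, hp, hq, by linarith, by simp⟩
  · rintro ⟨p, q, hp, hq, h, rfl⟩
    refine ⟨⟨p, q, 0, hp, hq, le_rfl, by simpa using h, by simp⟩, ?_⟩
    have e := funBCD_unitX_sub (a := a) (b := b) (p • ptA a + q • ptB + (0 : ℝ) • ptD b)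
    rw [(bar_combo p q 0).2.2] at e
    simp [funABD_ptA, funABD_ptB, h] at e
    simp
    linarith

lemma edge_AD_eq : {v ∈ r.hull | funABD a b v = 1 ∧ nbrFun a b (0, -1) v = 1} =
    segment ℝ (ptA a) (ptD b) := by
  have ha : (0 : ℝ) ≤ a := a.cast_nonneg
  have hb : (0 : ℝ) ≤ b := b.cast_nonneg
  have hc : ((b : ℝ) + 1) / (a + 2) ≠ 0 := by positivity
  ext v
  rw [Set.mem_ofPred, ← and_assoc, r.mem_triABD, nbrFun_Y]
  constructor
  · rintro ⟨⟨p, q, s, hp, hq, hs, h, rfl⟩, h2⟩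
    have e := funBCD_unitY_sub (a := a) (b := b) (p • ptA a + q • ptB + s • ptD b)
    rw [h2, (bar_combo p q s).2.1] at e
    simp only [map_add, map_smul, funABD_ptA, funABD_ptB, funABD_ptD, smul_eq_mul, mul_one, h,
      sub_self] at e
    obtain rfl : q = 0 := (mul_eq_zero.1 e.symm).resolve_left hc
    exact ⟨p, s, hp, hs, by linarith, by simp⟩
  · rintro ⟨p, s, hp, hs, h, rfl⟩
    refine ⟨⟨p, 0, s, hp, le_rfl, hs, by simpa using h, by simp⟩, ?_⟩
    have e := funBCD_unitY_sub (a := a) (b := b) (p • ptA a + (0 : ℝ) • ptB + s • ptD b)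
    rw [(bar_combo p 0 s).2.1] at e
    simp [funABD_ptA, funABD_ptD, h] at e
    simp
    linarith

lemma edge_BD_eq : {v ∈ r.hull | funABD a b v = 1 ∧ nbrFun a b 0 v = 1} =
    segment ℝ ptB (ptD b) := by
  have ha : (0 : ℝ) ≤ a := a.cast_nonneg
  have hb : (0 : ℝ) ≤ b := b.cast_nonneg
  have hc : (((a : ℝ) + 1) * (a + 2) - 1) / (a + 2) ≠ 0 :=
    (div_pos (by nlinarith) (by linarith)).ne'
  ext v
  rw [Set.mem_ofPred, ← and_assoc, r.mem_triABD, nbrFun_zero]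
  constructor
  · rintro ⟨⟨p, q, s, hp, hq, hs, h, rfl⟩, h2⟩
    have e := funBCD_sub_funABD (a := a) (b := b) (p • ptA a + q • ptB + s • ptD b)
    rw [h2, (bar_combo p q s).1] at e
    simp only [map_add, map_smul, funABD_ptA, funABD_ptB, funABD_ptD, smul_eq_mul, mul_one, h,
      sub_self] at e
    obtain rfl : p = 0 := (mul_eq_zero.1 e.symm).resolve_left hc
    exact ⟨q, s, hq, hs, by linarith, by simp⟩
  · rintro ⟨q, s, hq, hs, h, rfl⟩
    refine ⟨⟨0, q, s, le_rfl, hq, hs, by simpa using h, by simp⟩, ?_⟩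
    have e := funBCD_sub_funABD (a := a) (b := b) ((0 : ℝ) • ptA a + q • ptB + s • ptD b)
    rw [(bar_combo 0 q s).1] at e
    simp [funABD_ptB, funABD_ptD, h] at e
    simp
    linarith

lemma isContact_AB : IsContact r.hull (segment ℝ (ptA a) ptB) := by
  rw [← edge_AB_eq]
  refine contact_inter (fun v => r.one_le_funABD') (fun v hv => r.one_le_nbrFun hv _) ?_
  rw [edge_AB_eq]
  exact ⟨_, left_mem_segment ℝ _ _⟩

lemma isContact_AD : IsContact r.hull (segment ℝ (ptA a) (ptD b)) := by
  rw [← edge_AD_eq]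
  refine contact_inter (fun v => r.one_le_funABD') (fun v hv => r.one_le_nbrFun hv _) ?_
  rw [edge_AD_eq]
  exact ⟨_, left_mem_segment ℝ _ _⟩

lemma isContact_BD : IsContact r.hull (segment ℝ ptB (ptD b)) := by
  rw [← edge_BD_eq]
  refine contact_inter (fun v => r.one_le_funABD') (fun v hv => r.one_le_nbrFun hv _) ?_
  rw [edge_BD_eq]
  exact ⟨_, left_mem_segment ℝ _ _⟩

lemma isContact_inter {F G : Set Space} (hF : IsContact r.hull F) (hG : IsContact r.hull G)
    (hne : (F ∩ G).Nonempty) : IsContact r.hull (F ∩ G) := by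
  obtain ⟨-, l, hl, rfl⟩ := hF
  obtain ⟨-, l', hl', rfl⟩ := hG
  have h : {v ∈ r.hull | l v = 1} ∩ {v ∈ r.hull | l' v = 1} =
      {v ∈ r.hull | l v = 1 ∧ l' v = 1} := by
    ext v
    exact ⟨fun h => ⟨h.1.1, h.1.2, h.2.2⟩, fun h => ⟨⟨h.1, h.2.1⟩, h.1, h.2.2⟩⟩
  rw [h] at hne ⊢
  exact contact_inter hl hl' hne

lemma isContact_B : IsContact r.hull {ptB} := by
  have h : segment ℝ (ptA a) ptB ∩ segment ℝ ptB (ptD b) = {ptB} := by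
    ext v
    constructor
    · rintro ⟨⟨p, q, hp, hq, h, rfl⟩, ⟨q', s, hq', hs, h', e⟩⟩
      have h0 : p • ptA a + (q - q') • ptB + (-s) • ptD b = 0 := by
        rw [← sub_eq_zero.2 e.symm]
        module
      obtain ⟨rfl, -, -⟩ := linearIndep_ABD h0
      obtain rfl : q = 1 := by linarith
      simp
    · rintro rfl
      exact ⟨right_mem_segment ℝ _ _, left_mem_segment ℝ _ _⟩
  rw [← h]
  refine r.isContact_inter r.isContact_AB r.isContact_BD ?_
  rw [h]
  exact Set.singleton_nonempty _

end Roots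

/-- A face through a common edge `PQ` of two faces is the edge or one of these faces. -/
lemma face_of_edge {K : Set Space} {l l₁ l₂ : Space →ₗ[ℝ] ℝ} {P Q R R' : Space}
    (span : ∀ v : Space, ∃ p q s : ℝ, v = p • P + q • Q + s • R)
    (hl : ∀ v ∈ K, 1 ≤ l v) (h₁ : ∀ v ∈ K, 1 ≤ l₁ v) (h₂ : ∀ v ∈ K, 1 ≤ l₂ v)
    (hP : l P = 1) (hQ : l Q = 1) (h₁P : l₁ P = 1) (h₁Q : l₁ Q = 1) (h₁R : l₁ R = 1)
    (h₂P : l₂ P = 1) (h₂Q : l₂ Q = 1) (h₂R' : l₂ R' = 1) (hR : R ∈ K) (hR' : R' ∈ K)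
    (h₂R : 1 < l₂ R) (h₁R' : 1 < l₁ R') :
    {v ∈ K | l v = 1} = {v ∈ K | l₁ v = 1 ∧ l₂ v = 1} ∨ {v ∈ K | l v = 1} = {v ∈ K | l₁ v = 1} ∨
      {v ∈ K | l v = 1} = {v ∈ K | l₂ v = 1} := by
  -- The forms l and (1 - c) l₁ + c l₂ already agree at P and Q; this c makes them agree at R as
  -- well, so they coincide.
  obtain ⟨c, hc⟩ : ∃ c : ℝ, c = (l R - 1) / (l₂ R - 1) := ⟨_, rfl⟩
  have hcR : l R = (1 - c) * 1 + c * l₂ R := by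
    have : l₂ R - 1 ≠ 0 := by linarith
    rw [hc]
    field_simp
    ring
  have heq : ∀ v, l v = (1 - c) * l₁ v + c * l₂ v := by
    intro v
    obtain ⟨p, q, s, rfl⟩ := span v
    simp only [map_add, map_smul, hP, hQ, h₁P, h₁Q, h₁R, h₂P, h₂Q, hcR, smul_eq_mul]
    ring
  -- The test points R and R', the vertices opposite to the edge in the two triangles, give 0 ≤ c
  -- and c ≤ 1 respectively. The end values 1 and 0 of 1 - c are the two triangles, the interior
  -- values the edge.
  have hc0 : 0 ≤ c := by
    rw [hc]
    exact div_nonneg (by linarith [hl R hR]) (by linarith)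
  have hc1 : c ≤ 1 := by
    have := hl R' hR'
    rw [heq, h₂R'] at this
    nlinarith
  rcases hc0.eq_or_lt with rfl | hc0
  · right; left
    ext v
    simp [heq]
  rcases hc1.eq_or_lt with rfl | hc1
  · right; right
    ext v
    simp [heq]
  left
  ext v
  refine and_congr_right fun hv => ?_
  rw [heq]
  have := h₁ v hv
  have := h₂ v hv
  constructor
  · intro h
    constructor <;> nlinarith
  · rintro ⟨h, h'⟩
    rw [h, h']
    ring

/-- The six faces of the fundamental region. -/
def stdFaces (a b : ℕ) : Set (Set Space) :=
  {{ptB}, segment ℝ (ptA a) ptB, segment ℝ (ptA a) (ptD b), segment ℝ ptB (ptD b),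
    convexHull ℝ {ptA a, ptB, ptD b}, convexHull ℝ {ptB, ptC a b, ptD b}}

/-- The vertices of the sail. -/
def vert (a b : ℕ) (κ : ℤ × ℤ) : Space := toOperator (unit a b κ) ptB

lemma vert_zero : vert a b 0 = ptB := by simp [vert, toOperator_one]

lemma unit_vert (κ μ : ℤ × ℤ) : toOperator (unit a b κ) (vert a b μ) = vert a b (κ + μ) := by
  rw [vert, vert, toOperator_unit_add]

/-! ### Classification of the faces up to units. -/

namespace Roots

variable (r : Roots a b)

lemma vert_injective (r : Roots a b) : Function.Injective (vert a b) := by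
  intro κ μ h
  have h' : toOperator (unit a b (-κ + μ)) ptB = ptB := by
    change vert a b (-κ + μ) = ptB
    rw [← unit_vert, ← h, unit_vert, neg_add_cancel, vert_zero]
  have := r.eq_zero_of_unit h'
  exact (neg_add_eq_zero.1 this)

lemma vert_mem_hull (κ : ℤ × ℤ) : vert a b κ ∈ r.hull := r.unit_mem_hull κ r.ptB_mem_hull

/-- The contact form has its minimum 1 at x, so both ends of a segment through x also have value 1
and hence equal x. -/
lemma contact_extreme {K : Set Space} {x : Space} (h : IsContact K {x}) :
    x ∈ K.extremePoints ℝ := by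
  obtain ⟨-, l, hl, hx⟩ := h
  have hxK : x ∈ K ∧ l x = 1 := by
    have : x ∈ ({x} : Set Space) := rfl
    rwa [hx] at this
  refine mem_extremePoints_iff_left.2 ⟨hxK.1, ?_⟩
  rintro y hy z hz ⟨c, d, hc, hd, hcd, rfl⟩
  have h1 := hxK.2
  rw [map_add, map_smul, map_smul, smul_eq_mul, smul_eq_mul] at h1
  have hy1 := hl y hy
  have hz1 := hl z hz
  have : l y = 1 := by nlinarith
  have hmem : y ∈ {v ∈ K | l v = 1} := ⟨hy, this⟩
  rw [← hx] at hmem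
  exact hmem

lemma isContact_vert (κ : ℤ × ℤ) : IsContact r.hull {vert a b κ} := by
  have := r.isContact_image r.isContact_B κ
  rwa [Set.image_singleton] at this

lemma vert_extreme (κ : ℤ × ℤ) : vert a b κ ∈ r.hull.extremePoints ℝ :=
  contact_extreme (r.isContact_vert κ)

/-- The translates of the standard faces. -/
def IsStd (a b : ℕ) (F : Set Space) : Prop :=
  ∃ κ, toOperator (unit a b κ) '' F ∈ stdFaces a b

lemma isStd_of_image {F : Set Space} (κ : ℤ × ℤ) (h : IsStd a b (toOperator (unit a b κ) '' F)) :
    IsStd a b F := by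
  obtain ⟨μ, h⟩ := h
  refine ⟨μ + κ, ?_⟩
  rw [Set.image_image] at h
  simpa only [toOperator_unit_add] using h

lemma isStd_of_mem {F : Set Space} (h : F ∈ stdFaces a b) : IsStd a b F :=
  ⟨0, by simpa [toOperator_one] using h⟩

lemma image_nbr (κ : ℤ × ℤ) :
    toOperator (unit a b κ) '' {v ∈ r.hull | nbrFun a b κ v = 1} = tri a b false := by
  rw [r.tri_eq]
  ext v
  constructor
  · rintro ⟨w, ⟨hw, h⟩, rfl⟩
    exact ⟨r.unit_mem_hull κ hw, h⟩
  · rintro ⟨hv, h⟩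
    refine ⟨toOperator (unit a b (-κ)) v, ⟨r.unit_mem_hull _ hv, ?_⟩,
      toOperator_unit_cancel_neg _ _⟩
    rw [nbrFun, LinearMap.comp_apply, toOperator_unit_cancel_neg]
    exact h

lemma isStd_nbr (κ : ℤ × ℤ) : IsStd a b {v ∈ r.hull | nbrFun a b κ v = 1} :=
  ⟨κ, by rw [r.image_nbr]; simp [stdFaces, tri]⟩

lemma isStd_ABD : IsStd a b {v ∈ r.hull | funABD a b v = 1} := by
  have := r.tri_eq true
  rw [triFun] at this
  rw [← this]
  exact isStd_of_mem (by simp [stdFaces, tri])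

lemma ptA_mem : ptA a ∈ r.hull := by rw [ptA_eq (b := b)]; exact r.vert_mem_hull _
lemma ptC_mem : ptC a b ∈ r.hull := by rw [ptC_eq]; exact r.vert_mem_hull _
lemma ptD_mem : ptD b ∈ r.hull := by rw [ptD_eq (a := a)]; exact r.vert_mem_hull _

lemma bar_ptA : barA b (ptA a) = 1 ∧ barB a b (ptA a) = 0 ∧ barD b (ptA a) = 0 := by
  simpa using bar_combo (a := a) (b := b) 1 0 0
lemma bar_ptB : barA b ptB = 0 ∧ barB a b ptB = 1 ∧ barD b ptB = 0 := by
  simpa using bar_combo (a := a) (b := b) 0 1 0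
lemma bar_ptD : barA b (ptD b) = 0 ∧ barB a b (ptD b) = 1 - 1 ∧ barD b (ptD b) = 1 := by
  simpa using bar_combo (a := a) (b := b) 0 0 1

lemma isStd_of_AB {l : Space →ₗ[ℝ] ℝ} (hl : ∀ v ∈ r.hull, 1 ≤ l v) (h1 : l (ptA a) = 1)
    (h2 : l ptB = 1) : IsStd a b {v ∈ r.hull | l v = 1} := by
  have ha : (0 : ℝ) ≤ a := a.cast_nonneg
  have hb : (0 : ℝ) ≤ b := b.cast_nonneg
  have e := fun v => funBCD_unitX_sub (a := a) (b := b) v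
  have hc : 0 < ((b : ℝ) + 1) * ((a + 2) * (b + 1) - 1) :=
    mul_pos (by linarith) (by nlinarith)
  -- The neighbour across AB is X⁻¹(BCD), with vertices X⁻¹B, B, A; hence R' = X⁻¹B.
  have h := face_of_edge (K := r.hull) (l := l) (l₁ := funABD a b) (l₂ := nbrFun a b (1, 0))
    (P := ptA a) (Q := ptB) (R := ptD b) (R' := vert a b (-1, 0))
    (fun v => ⟨_, _, _, eq_barycentric_ABD v⟩) hl (fun v => r.one_le_funABD')
    (fun v hv => r.one_le_nbrFun hv _) h1 h2 funABD_ptA funABD_ptB funABD_ptD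
    (by have := e (ptA a)
        rw [← nbrFun_X, bar_ptA.2.2, funABD_ptA] at this
        linarith)
    (by have := e ptB
        rw [← nbrFun_X, (bar_ptB (a := a)).2.2, funABD_ptB] at this
        linarith)
    (by rw [nbrFun, LinearMap.comp_apply, unit_vert]; exact funBCD_ptB (a := a) (b := b) ▸ by
          rw [show ((1, 0) + (-1, 0) : ℤ × ℤ) = 0 by rfl, vert_zero])
    r.ptD_mem (r.vert_mem_hull _)
    (by have := e (ptD b)
        rw [← nbrFun_X, (bar_ptD (a := a)).2.2, funABD_ptD] at this
        have : 0 < ((b : ℝ) + 1) * ((a + 2) * (b + 1) - 1) / (a + 2) := by positivity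
        linarith)
    (by have := funABD_unitX_inv_sub (a := a) (b := b) ptB
        have hv : vert a b (-1, 0) = toOperator (unitX a b)⁻¹ ptB := by simp [vert, unit]
        rw [← hv, funBCD_ptB] at this
        simp [barB', barD', barC', ptB] at this
        linarith)
  rcases h with h | h | h <;> rw [h]
  · rw [edge_AB_eq]
    exact isStd_of_mem (by simp [stdFaces])
  · exact r.isStd_ABD
  · exact r.isStd_nbr _

lemma isStd_of_AD {l : Space →ₗ[ℝ] ℝ} (hl : ∀ v ∈ r.hull, 1 ≤ l v) (h1 : l (ptA a) = 1)
    (h2 : l (ptD b) = 1) : IsStd a b {v ∈ r.hull | l v = 1} := by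
  have ha : (0 : ℝ) ≤ a := a.cast_nonneg
  have hb : (0 : ℝ) ≤ b := b.cast_nonneg
  have e := fun v => funBCD_unitY_sub (a := a) (b := b) v
  have hc : 0 < ((b : ℝ) + 1) / (a + 2) := by positivity
  -- The neighbour across AD is Y⁻¹(BCD), with vertices A, D, Y⁻¹D, and Y⁻¹D has exponents (1, 2).
  have hY : vert a b (1, 2) = toOperator (unitY a b)⁻¹ (ptD b) := by
    rw [ptD_eq (a := a), ← unit_zero_one, ← toOperator_unit_add]
    rfl
  have h := face_of_edge (K := r.hull) (l := l) (l₁ := funABD a b) (l₂ := nbrFun a b (0, -1))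
    (P := ptA a) (Q := ptD b) (R := ptB) (R' := vert a b (1, 2))
    (fun v => ⟨_, _, _, (eq_barycentric_ABD (a := a) (b := b) v).trans (add_right_comm _ _ _)⟩)
    hl (fun v => r.one_le_funABD')
    (fun v hv => r.one_le_nbrFun hv _) h1 h2 funABD_ptA funABD_ptD funABD_ptB
    (by have := e (ptA a)
        rw [← nbrFun_Y, bar_ptA.2.1, funABD_ptA] at this
        linarith)
    (by have := e (ptD b)
        rw [← nbrFun_Y, (bar_ptD (a := a)).2.1, funABD_ptD] at this
        linarith)
    (by rw [nbrFun_Y, hY, toOperator_cancel_inv, funBCD_ptD])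
    r.ptB_mem_hull (r.vert_mem_hull _)
    (by have := e ptB
        rw [← nbrFun_Y, (bar_ptB (a := a)).2.1, funABD_ptB] at this
        linarith)
    (by have := funABD_unitY_inv_sub (a := a) (b := b) (ptD b)
        have hb' : (b : ℝ) + 1 ≠ 0 := by positivity
        have hd : barD' a b (ptD b) = 1 := by
          simp [barD', barC', ptD]
          field_simp
          ring
        rw [← hY, funBCD_ptD, hd] at this
        linarith)
  rcases h with h | h | h <;> rw [h]
  · rw [edge_AD_eq]
    exact isStd_of_mem (by simp [stdFaces])
  · exact r.isStd_ABD
  · exact r.isStd_nbr _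

lemma isStd_of_BD {l : Space →ₗ[ℝ] ℝ} (hl : ∀ v ∈ r.hull, 1 ≤ l v) (h1 : l ptB = 1)
    (h2 : l (ptD b) = 1) : IsStd a b {v ∈ r.hull | l v = 1} := by
  have ha : (0 : ℝ) ≤ a := a.cast_nonneg
  have hb : (0 : ℝ) ≤ b := b.cast_nonneg
  have e := fun v => funBCD_sub_funABD (a := a) (b := b) v
  have hc : 0 < ((a : ℝ) + 1) * (a + 2) - 1 := by nlinarith
  have h := face_of_edge (K := r.hull) (l := l) (l₁ := funABD a b) (l₂ := nbrFun a b 0)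
    (P := ptB) (Q := ptD b) (R := ptA a) (R' := ptC a b)
    (fun v => ⟨_, _, _, (eq_barycentric_ABD (a := a) (b := b) v).trans (by
      rw [add_assoc, add_comm])⟩)
    hl (fun v => r.one_le_funABD')
    (fun v hv => r.one_le_nbrFun hv _) h1 h2 funABD_ptB funABD_ptD funABD_ptA
    (by rw [nbrFun_zero, funBCD_ptB])
    (by rw [nbrFun_zero, funBCD_ptD])
    (by rw [nbrFun_zero, funBCD_ptC])
    r.ptA_mem r.ptC_mem
    (by have := e (ptA a)
        rw [← nbrFun_zero, (bar_ptA (a := a)).1, funABD_ptA] at this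
        have : 0 < (((a : ℝ) + 1) * (a + 2) - 1) / (a + 2) := by positivity
        linarith)
    (by have := funABD_sub_funBCD (a := a) (b := b) (ptC a b)
        have hd : barC' a b (ptC a b) = 1 := by
          have ha' : (a : ℝ) + 2 ≠ 0 := by positivity
          simp [barC', ptC]
          field_simp
          ring
        rw [funBCD_ptC, hd] at this
        linarith)
  rcases h with h | h | h <;> rw [h]
  · rw [edge_BD_eq]
    exact isStd_of_mem (by simp [stdFaces])
  · exact r.isStd_ABD
  · exact r.isStd_nbr _

/-- A functional that attains its minimum at a point of a triangle which is not a vertex attains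
it on an edge, up to the action of the units. -/
lemma isStd_of_tri {l : Space →ₗ[ℝ] ℝ} (hl : ∀ v ∈ r.hull, 1 ≤ l v) {x : Space} (hx : l x = 1)
    {s : Bool} (hs : x ∈ tri a b s) (hv : ∀ κ, x ≠ vert a b κ) :
    IsStd a b {v ∈ r.hull | l v = 1} := by
  -- A convex combination of numbers at least 1 equals 1 only if every number with nonzero weight is
  -- 1. As x is not a vertex, at least two corners have nonzero weight, so l is 1 at both ends of an
  -- edge.
  have two : ∀ {p q s x y z : ℝ}, 0 ≤ p → 0 ≤ q → 0 ≤ s → p + q + s = 1 → 1 ≤ x → 1 ≤ y →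
      1 ≤ z → p * x + q * y + s * z = 1 → (p = 0 ∨ x = 1) ∧ (q = 0 ∨ y = 1) ∧ (s = 0 ∨ z = 1) := by
    intro p q s x y z hp hq hs h hx hy hz e
    have h1 := mul_nonneg hp (sub_nonneg.2 hx)
    have h2 := mul_nonneg hq (sub_nonneg.2 hy)
    have h3 := mul_nonneg hs (sub_nonneg.2 hz)
    have k1 : p * (x - 1) = 0 := by linarith
    have k2 : q * (y - 1) = 0 := by linarith
    have k3 : s * (z - 1) = 0 := by linarith
    simpa only [mul_eq_zero, sub_eq_zero] using And.intro k1 (And.intro k2 k3)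
  have hA := hl _ r.ptA_mem
  have hB := hl _ r.ptB_mem_hull
  have hC := hl _ r.ptC_mem
  have hD := hl _ r.ptD_mem
  have nA : x ≠ ptA a := by rw [ptA_eq (b := b)]; exact hv _
  have nB : x ≠ ptB := by rw [← vert_zero (a := a) (b := b)]; exact hv _
  have nC : x ≠ ptC a b := by rw [ptC_eq]; exact hv _
  have nD : x ≠ ptD b := by rw [ptD_eq (a := a)]; exact hv _
  have transport : ∀ κ : ℤ × ℤ, toOperator (unit a b κ) '' {v ∈ r.hull | l v = 1} =
      {v ∈ r.hull | (l ∘ₗ toOperator (unit a b (-κ))) v = 1} := by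
    intro κ
    ext v
    constructor
    · rintro ⟨w, ⟨hw, h⟩, rfl⟩
      exact ⟨r.unit_mem_hull _ hw, by rwa [LinearMap.comp_apply, toOperator_unit_neg_cancel]⟩
    · rintro ⟨hv, h⟩
      exact ⟨_, ⟨r.unit_mem_hull (-κ) hv, h⟩, toOperator_unit_cancel_neg _ _⟩
  -- The edges BC and CD are Y(AD) and X(AB), so they reduce to edges already treated.
  have BC : l ptB = 1 → l (ptC a b) = 1 → IsStd a b {v ∈ r.hull | l v = 1} := by
    intro h1 h2
    apply isStd_of_image (0, 1)
    rw [transport]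
    have hY : unit a b (-(0, 1)) = unitY a b := by simp [unit]
    refine r.isStd_of_AD (fun v hv => hl _ (r.unit_mem_hull _ hv)) ?_ ?_
    · rw [LinearMap.comp_apply, hY, unitY_ptA, h1]
    · rw [LinearMap.comp_apply, hY, unitY_ptD, h2]
  have CD : l (ptC a b) = 1 → l (ptD b) = 1 → IsStd a b {v ∈ r.hull | l v = 1} := by
    intro h1 h2
    apply isStd_of_image (-1, 0)
    rw [transport]
    have hX : unit a b (-(-1, 0)) = unitX a b := by simp [unit]
    refine r.isStd_of_AB (fun v hv => hl _ (r.unit_mem_hull _ hv)) ?_ ?_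
    · rw [LinearMap.comp_apply, hX, unitX_ptA, h2]
    · rw [LinearMap.comp_apply, hX, unitX_ptB, h1]
  cases s
  · obtain ⟨p, q, s, hp, hq, hs', h, rfl⟩ := mem_convexHull_triple.1 hs
    simp only [map_add, map_smul, smul_eq_mul] at hx
    obtain ⟨h1 | h1, h2 | h2, h3 | h3⟩ := two hp hq hs' h hB hC hD hx
    · linarith
    · subst h1 h2
      obtain rfl : s = 1 := by linarith
      simp at nD
    · subst h1 h3
      obtain rfl : q = 1 := by linarith
      simp at nC
    · exact CD h2 h3
    · subst h2 h3
      obtain rfl : p = 1 := by linarith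
      simp at nB
    · exact r.isStd_of_BD hl h1 h3
    · exact BC h1 h2
    · exact BC h1 h2
  · obtain ⟨p, q, s, hp, hq, hs', h, rfl⟩ := mem_convexHull_triple.1 hs
    simp only [map_add, map_smul, smul_eq_mul] at hx
    obtain ⟨h1 | h1, h2 | h2, h3 | h3⟩ := two hp hq hs' h hA hB hD hx
    · linarith
    · subst h1 h2
      obtain rfl : s = 1 := by linarith
      simp at nD
    · subst h1 h3
      obtain rfl : q = 1 := by linarith
      simp at nB
    · exact r.isStd_of_BD hl h2 h3
    · subst h2 h3
      obtain rfl : p = 1 := by linarith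
      simp at nA
    · exact r.isStd_of_AD hl h1 h3
    · exact r.isStd_of_AB hl h1 h2
    · exact r.isStd_of_AB hl h1 h2

/-- Every face is a translate of one of the six standard faces. -/
lemma isStd_of_isContact {F : Set Space} (hF : IsContact r.hull F) : IsStd a b F := by
  by_cases hvert : ∀ x ∈ F, ∃ κ, x = vert a b κ
  -- The midpoint of two points of the convex set F would again be a vertex, hence extreme, so the
  -- two points coincide.
  · have hsub : F.Subsingleton := by
      intro x hx y hy
      have hconv : Convex ℝ F := (r.exposed_of_isContact hF).2.convex r.convex_hull
      have hmid : (1 / 2 : ℝ) • x + (1 / 2 : ℝ) • y ∈ F :=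
        hconv hx hy (by norm_num) (by norm_num) (by norm_num)
      obtain ⟨κ, hκ⟩ := hvert _ hmid
      have hsub := (r.exposed_of_isContact hF).2.subset
      have := (mem_extremePoints.1 (r.vert_extreme κ)).2 x (hsub hx) y (hsub hy)
        ⟨1 / 2, 1 / 2, by norm_num, by norm_num, by norm_num, hκ⟩
      rw [this.1, this.2]
    obtain ⟨x, hx⟩ := hF.1
    obtain ⟨κ, rfl⟩ := hvert x hx
    rw [hsub.eq_singleton_of_mem hx]
    refine ⟨-κ, ?_⟩
    rw [Set.image_singleton, unit_vert, neg_add_cancel, vert_zero]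
    simp [stdFaces]
  · push Not at hvert
    obtain ⟨x, hx, hne⟩ := hvert
    obtain ⟨κ, s, hκ⟩ := r.exists_mem_tri (r.contact_subset_sail hF hx)
    apply isStd_of_image κ
    obtain ⟨-, l, hl, h⟩ := r.isContact_image hF κ
    have hxF : toOperator (unit a b κ) x ∈ {v ∈ r.hull | l v = 1} := h ▸ ⟨x, hx, rfl⟩
    rw [h]
    refine r.isStd_of_tri hl hxF.2 hκ fun μ hμ => hne (-κ + μ) ?_
    rw [← unit_vert, ← hμ, toOperator_unit_neg_cancel]

lemma isContact_of_mem {F : Set Space} (hF : F ∈ stdFaces a b) : IsContact r.hull F := by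
  rcases hF with rfl | rfl | rfl | rfl | rfl | rfl
  exacts [r.isContact_B, r.isContact_AB, r.isContact_AD, r.isContact_BD, r.isContact_tri true,
    r.isContact_tri false]

/-! ### The period group -/

lemma vert_mem_sail (κ : ℤ × ℤ) : vert a b κ ∈ sail r.orth :=
  r.contact_subset_sail (r.isContact_vert κ) rfl

/-- M has distinct eigenvalues, so its commutant is diagonal in the eigenbasis. The eigenvalues of g
are the coordinates of gB because those of B are 1. -/
lemma coord_comm {g : SL(3, ℤ)} (hg : g * frob a b = frob a b * g) (i : Fin 3) (v : Space) :
    r.coord i (toOperator g v) = r.coord i (toOperator g ptB) * r.coord i v := by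
  have hdual : ∀ j ≠ i, r.coord i (toOperator g (r.dual j)) = 0 := by
    intro j hj
    have h1 : toOperator (frob a b) (r.dual j) = (r.t j)⁻¹ • r.dual j := by
      apply r.coord_ext
      intro k
      rw [coord_frob, map_smul, smul_eq_mul]
      rcases eq_or_ne k j with rfl | hk
      · rfl
      · simp [r.coord_dual_ne hk]
    have h2 := r.coord_frob i (toOperator g (r.dual j))
    rw [← toOperator_mul, ← hg, toOperator_mul, h1, map_smul, map_smul, smul_eq_mul] at h2
    have hne : (r.t j)⁻¹ - (r.t i)⁻¹ ≠ 0 :=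
      sub_ne_zero.2 fun h => hj (r.injective (inv_injective h))
    apply mul_left_cancel₀ hne
    linear_combination h2
  have key : ∀ v, r.coord i (toOperator g v) =
      r.coord i v * r.coord i (toOperator g (r.dual i)) := by
    intro v
    rw [← LinearMap.comp_apply, r.map_eq_sum, Finset.sum_eq_single i]
    · rfl
    · intro j _ hj
      rw [LinearMap.comp_apply, hdual j hj, mul_zero]
    · simp
  rw [key ptB, coord_ptB, one_mul, key v, mul_comm]

/-- After a unit the point lies in one of the two triangles; being extreme in the polyhedron, it is
extreme there, hence a corner. -/
lemma mem_vert_of_extreme {x : Space} (hx : x ∈ r.hull.extremePoints ℝ) (hs : x ∈ sail r.orth) :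
    ∃ κ, x = vert a b κ := by
  obtain ⟨κ, s, hκ⟩ := r.exists_mem_tri hs
  have hext : toOperator (unit a b κ) x ∈ r.hull.extremePoints ℝ := by
    refine mem_extremePoints_iff_left.2 ⟨r.unit_mem_hull κ hx.1, ?_⟩
    rintro y hy z hz ⟨c, d, hc, hd, hcd, h⟩
    have := (mem_extremePoints.1 hx).2 _ (r.unit_mem_hull (-κ) hy) _ (r.unit_mem_hull (-κ) hz)
      ⟨c, d, hc, hd, hcd, by
        rw [← map_smul, ← map_smul, ← map_add, h, toOperator_unit_neg_cancel]⟩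
    rw [← this.1, toOperator_unit_cancel_neg]
  have hext' := inter_extremePoints_subset_extremePoints_of_subset (r.tri_subset_hull s)
    ⟨hκ, hext⟩
  have hfin : ∀ y, (y = ptA a ∨ y = ptB ∨ y = ptC a b ∨ y = ptD b) → ∃ μ, y = vert a b μ := by
    rintro y (rfl | rfl | rfl | rfl)
    exacts [⟨_, ptA_eq⟩, ⟨_, vert_zero.symm⟩, ⟨_, ptC_eq⟩, ⟨_, ptD_eq⟩]
  have : ∃ μ, toOperator (unit a b κ) x = vert a b μ := by
    apply hfin
    cases s
    · have := extremePoints_convexHull_subset hext'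
      simp only [Set.mem_insert_iff, Set.mem_singleton_iff] at this
      tauto
    · have := extremePoints_convexHull_subset hext'
      simp only [Set.mem_insert_iff, Set.mem_singleton_iff] at this
      tauto
  obtain ⟨μ, hμ⟩ := this
  exact ⟨-κ + μ, by rw [← unit_vert, ← hμ, toOperator_unit_neg_cancel]⟩

/-- As gB lies on the sail, the diagonal entries of g are positive, so g preserves the orthant, its
integer points and their hull. Then gB is an extreme point on the sail, that is, a vertex. The
quotient of g by the corresponding unit fixes B and commutes with M, so it is the identity. -/
lemma mem_periodGroup_iff {g : SL(3, ℤ)} :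
    g ∈ periodGroup (frob a b) r.orth ↔ ∃ κ, g = unit a b κ := by
  constructor
  · rintro ⟨hg, hs⟩
    have hB : toOperator g ptB ∈ sail r.orth := by
      rw [← hs]
      exact ⟨_, vert_zero (a := a) (b := b) ▸ r.vert_mem_sail 0, rfl⟩
    have hpos := (r.sail_subset_hull hB).1
    have himg : ∀ x, x ∈ {x | x ∈ r.orth ∧ IsIntegerPoint x} ↔
        toOperator g x ∈ {x | x ∈ r.orth ∧ IsIntegerPoint x} := by
      intro x
      have horth : x ∈ r.orth ↔ toOperator g x ∈ r.orth := by
        refine forall_congr' fun i => ?_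
        rw [r.coord_comm hg i x]
        exact (mul_pos_iff_of_pos_left (hpos i)).symm
      have hint : IsIntegerPoint x ↔ IsIntegerPoint (toOperator g x) :=
        ⟨fun h => h.map g, fun h => toOperator_inv_cancel g x ▸ h.map g⁻¹⟩
      exact and_congr horth hint
    have hset : toOperator g '' {x | x ∈ r.orth ∧ IsIntegerPoint x} =
        {x | x ∈ r.orth ∧ IsIntegerPoint x} := by
      ext x
      constructor
      · rintro ⟨y, hy, rfl⟩
        exact (himg y).1 hy
      · intro hx
        rw [← toOperator_cancel_inv g x] at hx ⊢
        exact ⟨_, (himg _).2 hx, rfl⟩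
    have hhull : toOperator g '' r.hull = r.hull := by
      rw [← integerHull_eq, integerHull, integer_set_eq, LinearMap.image_convexHull, hset]
    have hext : toOperator g ptB ∈ r.hull.extremePoints ℝ := by
      have hBe := r.vert_extreme 0
      rw [vert_zero] at hBe
      refine mem_extremePoints_iff_left.2 ⟨hhull ▸ ⟨_, r.ptB_mem_hull, rfl⟩, ?_⟩
      intro y hy z hz h
      rw [← hhull] at hy hz
      obtain ⟨y, hy, rfl⟩ := hy
      obtain ⟨z, hz, rfl⟩ := hz
      obtain ⟨c, d, hc, hd, hcd, h⟩ := h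
      have := (mem_extremePoints.1 hBe).2 _ hy _ hz ⟨c, d, hc, hd, hcd, by
        rw [← toOperator_inv_cancel g ptB, ← h, map_add, map_smul, map_smul,
          toOperator_inv_cancel, toOperator_inv_cancel]⟩
      rw [this.1]
    obtain ⟨κ, hκ⟩ := r.mem_vert_of_extreme hext hB
    refine ⟨κ, ?_⟩
    have h1 : unit a b (-κ) * g = 1 := by
      refine eq_one_of_comm ?_ ?_ (a := a) (b := b)
      · exact (show Commute (unit a b (-κ)) (frob a b) from unit_comm _).mul_left hg
      · rw [toOperator_mul, hκ, unit_vert, neg_add_cancel, vert_zero]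
    rw [unit_neg] at h1
    exact (inv_mul_eq_one.1 h1).symm
  · rintro ⟨κ, rfl⟩
    refine ⟨unit_comm κ, ?_⟩
    apply Set.Subset.antisymm
    · rintro _ ⟨v, hv, rfl⟩
      exact r.unit_mem_sail κ hv
    · intro v hv
      exact ⟨_, r.unit_mem_sail (-κ) hv, toOperator_unit_cancel_neg κ v⟩

end Roots

/-! ### The parametrization of the fundamental region by the unit square -/

/-- The unit square. -/
def sq : Set (ℝ × ℝ) := Set.Icc 0 1 ×ˢ Set.Icc 0 1

/-- The piecewise linear parametrization of the fundamental region by the unit square. -/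
def param (a b : ℕ) (z : ℝ × ℝ) : Space :=
  (1 - max z.1 z.2) • ptB + (max z.1 z.2 - z.2) • ptC a b + min z.1 z.2 • ptD b +
    (max z.1 z.2 - z.1) • ptA a

lemma continuous_param : Continuous (param a b) := by
  unfold param
  fun_prop

lemma param_of_le {z : ℝ × ℝ} (h : z.1 ≤ z.2) :
    param a b z = (z.2 - z.1) • ptA a + (1 - z.2) • ptB + z.1 • ptD b := by
  rw [param, max_eq_right h, min_eq_left h]
  module

lemma param_of_ge {z : ℝ × ℝ} (h : z.2 ≤ z.1) :
    param a b z = (1 - z.1) • ptB + (z.1 - z.2) • ptC a b + z.2 • ptD b := by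
  rw [param, max_eq_left h, min_eq_right h]
  module

lemma param_mem_tri {z : ℝ × ℝ} (hz : z ∈ sq) : ∃ s, param a b z ∈ tri a b s := by
  obtain ⟨⟨h1, h2⟩, h3, h4⟩ := hz
  rcases le_total z.1 z.2 with h | h
  · exact ⟨true, mem_convexHull_triple.2 ⟨_, _, _, by linarith, by linarith, h1, by ring,
      param_of_le h⟩⟩
  · exact ⟨false, mem_convexHull_triple.2 ⟨_, _, _, by linarith, by linarith, h3, by ring,
      param_of_ge h⟩⟩

lemma image_param_true : param a b '' convexHull ℝ {(0, 1), (0, 0), (1, 1)} = tri a b true := by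
  ext v
  constructor
  · rintro ⟨z, hz, rfl⟩
    obtain ⟨p, q, s, hp, hq, hs, h, rfl⟩ := mem_convexHull_triple.1 hz
    refine mem_convexHull_triple.2 ⟨p, q, s, hp, hq, hs, h, ?_⟩
    rw [param_of_le (by simpa using hp)]
    simp
    rw [← h]
    module
  · intro hv
    obtain ⟨p, q, s, hp, hq, hs, h, rfl⟩ := mem_convexHull_triple.1 hv
    refine ⟨p • (0, 1) + q • (0, 0) + s • (1, 1),
      mem_convexHull_triple.2 ⟨p, q, s, hp, hq, hs, h, rfl⟩, ?_⟩
    rw [param_of_le (by simpa using hp)]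
    simp
    rw [← h]
    module

lemma image_param_false : param a b '' convexHull ℝ {(0, 0), (1, 0), (1, 1)} = tri a b false := by
  ext v
  constructor
  · rintro ⟨z, hz, rfl⟩
    obtain ⟨p, q, s, hp, hq, hs, h, rfl⟩ := mem_convexHull_triple.1 hz
    refine mem_convexHull_triple.2 ⟨p, q, s, hp, hq, hs, h, ?_⟩
    rw [param_of_ge (by simpa using hq)]
    simp
    rw [← h]
    module
  · intro hv
    obtain ⟨p, q, s, hp, hq, hs, h, rfl⟩ := mem_convexHull_triple.1 hv
    refine ⟨p • (0, 0) + q • (1, 0) + s • (1, 1),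
      mem_convexHull_triple.2 ⟨p, q, s, hp, hq, hs, h, rfl⟩, ?_⟩
    rw [param_of_ge (by simpa using hq)]
    simp
    rw [← h]
    module

lemma image_param_zero : param a b '' {(0, 0)} = {ptB} := by
  simp [param]

lemma image_param_BC : param a b '' segment ℝ (0, 0) (1, 0) = segment ℝ ptB (ptC a b) := by
  ext v
  constructor
  · rintro ⟨_, ⟨p, q, hp, hq, h, rfl⟩, rfl⟩
    refine ⟨p, q, hp, hq, h, ?_⟩
    rw [param_of_ge (by simpa using hq)]
    simp
    rw [← h]
    module
  · rintro ⟨p, q, hp, hq, h, rfl⟩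
    refine ⟨_, ⟨p, q, hp, hq, h, rfl⟩, ?_⟩
    rw [param_of_ge (by simpa using hq)]
    simp
    rw [← h]
    module

lemma image_param_BA : param a b '' segment ℝ (0, 0) (0, 1) = segment ℝ (ptA a) ptB := by
  ext v
  constructor
  · rintro ⟨_, ⟨p, q, hp, hq, h, rfl⟩, rfl⟩
    refine ⟨q, p, hq, hp, by linarith, ?_⟩
    rw [param_of_le (by simpa using hq)]
    simp
    rw [← h]
    module
  · rintro ⟨p, q, hp, hq, h, rfl⟩
    refine ⟨_, ⟨q, p, hq, hp, by linarith, rfl⟩, ?_⟩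
    rw [param_of_le (by simpa using hp)]
    simp
    rw [← h]
    module

lemma image_param_BD : param a b '' segment ℝ (0, 0) (1, 1) = segment ℝ ptB (ptD b) := by
  ext v
  constructor
  · rintro ⟨_, ⟨p, q, hp, hq, h, rfl⟩, rfl⟩
    refine ⟨p, q, hp, hq, h, ?_⟩
    rw [param_of_le (by simp)]
    simp
    rw [← h]
    module
  · rintro ⟨p, q, hp, hq, h, rfl⟩
    refine ⟨_, ⟨p, q, hp, hq, h, rfl⟩, ?_⟩
    rw [param_of_le (by simp)]
    simp
    rw [← h]
    module

lemma convex_sq : Convex ℝ sq := (convex_Icc 0 1).prod (convex_Icc 0 1)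

lemma tri_true_subset_sq : convexHull ℝ {((0 : ℝ), (1 : ℝ)), (0, 0), (1, 1)} ⊆ sq :=
  convexHull_min (by rintro _ (rfl | rfl | rfl) <;> simp [sq]) convex_sq

lemma tri_false_subset_sq : convexHull ℝ {((0 : ℝ), (0 : ℝ)), (1, 0), (1, 1)} ⊆ sq :=
  convexHull_min (by rintro _ (rfl | rfl | rfl) <;> simp [sq]) convex_sq

/-! #### The gluing of the sides -/

/-- The sides BA and CD of the square are glued by X, which sends B to C and A to D. The next lemma
glues BC to AD by Y⁻¹. -/
lemma param_one (q : ℝ) (hq : q ∈ Set.Icc (0 : ℝ) 1) :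
    param a b (1, q) = toOperator (unit a b (1, 0)) (param a b (0, q)) := by
  rw [param_of_ge (by simpa using hq.2), param_of_le (by simpa using hq.1), unit_one_zero]
  simp only [map_add, map_smul, unitX_ptA, unitX_ptB]
  module

lemma param_snd_one (p : ℝ) (hp : p ∈ Set.Icc (0 : ℝ) 1) :
    param a b (p, 1) = toOperator (unit a b (0, 1)) (param a b (p, 0)) := by
  rw [param_of_le (by simpa using hp.2), param_of_ge (by simpa using hp.1), unit_zero_one]
  have h1 : toOperator (unitY a b)⁻¹ (ptC a b) = ptD b := toOperator_inv_eq unitY_ptD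
  have h2 : toOperator (unitY a b)⁻¹ ptB = ptA a := toOperator_inv_eq unitY_ptA
  simp only [map_add, map_smul, h1, h2]
  module

lemma int_diff {p p' : ℝ} (hp : p ∈ Set.Icc (0 : ℝ) 1) (hp' : p' ∈ Set.Icc (0 : ℝ) 1) {k : ℤ}
    (h : p = k + p') : (k = 0 ∧ p = p') ∨ (k = 1 ∧ p = 1 ∧ p' = 0) ∨
      (k = -1 ∧ p = 0 ∧ p' = 1) := by
  have h1 : (k : ℝ) ≤ 1 := by linarith [hp.2, hp'.1]
  have h2 : (-1 : ℝ) ≤ k := by linarith [hp.1, hp'.2]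
  have h1' : k ≤ 1 := by exact_mod_cast h1
  have h2' : -1 ≤ k := by exact_mod_cast h2
  obtain rfl | rfl | rfl : k = -1 ∨ k = 0 ∨ k = 1 := by omega
  · right; right
    norm_num at h
    exact ⟨rfl, by linarith [hp.1, hp'.2], by linarith [hp.1, hp'.2]⟩
  · left
    exact ⟨rfl, by simpa using h⟩
  · right; left
    norm_num at h
    exact ⟨rfl, by linarith [hp.2, hp'.1], by linarith [hp.2, hp'.1]⟩

/-- Two numbers of [0, 1] differing by an integer are equal or are the two endpoints. The first
coordinates are matched by X, then the second by Y⁻¹, through the intermediate point (p, q'). -/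
lemma param_add {z z' : ℝ × ℝ} (hz : z ∈ sq) (hz' : z' ∈ sq) {κ : ℤ × ℤ}
    (h1 : z.1 = κ.1 + z'.1) (h2 : z.2 = κ.2 + z'.2) :
    param a b z = toOperator (unit a b κ) (param a b z') := by
  obtain ⟨p, q⟩ := z
  obtain ⟨p', q'⟩ := z'
  obtain ⟨k, l⟩ := κ
  have e1 : param a b (p, q') = toOperator (unit a b (k, 0)) (param a b (p', q')) := by
    rcases int_diff hz.1 hz'.1 h1 with ⟨rfl, h⟩ | ⟨rfl, h, h'⟩ | ⟨rfl, h, h'⟩ <;> dsimp only at h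
    · rw [h, show ((0, 0) : ℤ × ℤ) = 0 from rfl, unit_zero, toOperator_one]
    · dsimp only at h'
      rw [h, h']
      exact param_one q' hz'.2
    · dsimp only at h'
      rw [h, h', param_one q' hz'.2, show ((-1, 0) : ℤ × ℤ) = -(1, 0) from rfl,
        toOperator_unit_neg_cancel]
  have e2 : param a b (p, q) = toOperator (unit a b (0, l)) (param a b (p, q')) := by
    rcases int_diff hz.2 hz'.2 h2 with ⟨rfl, h⟩ | ⟨rfl, h, h'⟩ | ⟨rfl, h, h'⟩ <;> dsimp only at h
    · rw [h, show ((0, 0) : ℤ × ℤ) = 0 from rfl, unit_zero, toOperator_one]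
    · dsimp only at h'
      rw [h, h']
      exact param_snd_one p hz.1
    · dsimp only at h'
      rw [h, h', param_snd_one p hz.1, show ((0, -1) : ℤ × ℤ) = -(0, 1) from rfl,
        toOperator_unit_neg_cancel]
  rw [e2, e1, ← toOperator_unit_add]
  simp

/-! #### Position functionals -/

/-- The affine inverse of the parametrization on the plane of a triangle. -/
def posFun (a b : ℕ) : Bool → Space →ₗ[ℝ] ℝ × ℝ
  | true =>
    { toFun v := (barD b v, barA b v + barD b v)
      map_add' v w := by ext <;> simp [barA, barD] <;> ring
      map_smul' c v := by ext <;> simp [barA, barD] <;> ring }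
  | false =>
    { toFun v := (barC' a b v + barD' a b v, barD' a b v)
      map_add' v w := by ext <;> simp [barC', barD'] <;> ring
      map_smul' c v := by ext <;> simp [barC', barD'] <;> ring }

lemma bar_combo' (p q s : ℝ) : barC' a b (p • ptB + q • ptC a b + s • ptD b) = q ∧
    barD' a b (p • ptB + q • ptC a b + s • ptD b) = s ∧
    barB' a b (p • ptB + q • ptC a b + s • ptD b) = p := by
  have : (b : ℝ) + 1 ≠ 0 := by positivity
  have : (a : ℝ) + 2 ≠ 0 := by positivity
  refine ⟨?_, ?_, ?_⟩ <;> simp [barC', barB', barD', ptC, ptB, ptD] <;> field_simp <;> ring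

lemma posFun_true (p q s : ℝ) :
    posFun a b true (p • ptA a + q • ptB + s • ptD b) = (s, p + s) := by
  obtain ⟨h1, -, h3⟩ := Roots.bar_combo (a := a) (b := b) p q s
  change (barD b _, barA b _ + barD b _) = _
  rw [h1, h3]

lemma posFun_false (p q s : ℝ) :
    posFun a b false (p • ptB + q • ptC a b + s • ptD b) = (q + s, s) := by
  obtain ⟨h1, h3, -⟩ := bar_combo' (a := a) (b := b) p q s
  change (barC' a b _ + barD' a b _, barD' a b _) = _
  rw [h1, h3]

namespace Roots

variable (r : Roots a b)

/-- A vertex of the sail lying in a triangle is extreme there, so it is a corner, and at the corners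
the position is the exponent of the unit. -/
lemma posFun_vert (r : Roots a b) {κ : ℤ × ℤ} {s : Bool} (h : vert a b κ ∈ tri a b s) :
    posFun a b s (vert a b κ) = ((κ.1 : ℝ), (κ.2 : ℝ)) := by
  have hext := inter_extremePoints_subset_extremePoints_of_subset (r.tri_subset_hull s)
    ⟨h, r.vert_extreme κ⟩
  have hinj := r.vert_injective
  have hA : ptA a = vert a b (0, 1) := ptA_eq
  have hB : ptB = vert a b (0, 0) := vert_zero.symm
  have hC : ptC a b = vert a b (1, 0) := ptC_eq
  have hD : ptD b = vert a b (1, 1) := ptD_eq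
  cases s
  · have hm := extremePoints_convexHull_subset hext
    simp only [Set.mem_insert_iff, Set.mem_singleton_iff] at hm
    rcases hm with h | h | h <;> rw [h]
    · rw [hB] at h
      rw [hinj h]
      simpa using posFun_false (a := a) (b := b) 1 0 0
    · rw [hC] at h
      rw [hinj h]
      simpa using posFun_false (a := a) (b := b) 0 1 0
    · rw [hD] at h
      rw [hinj h]
      simpa using posFun_false (a := a) (b := b) 0 0 1
  · have hm := extremePoints_convexHull_subset hext
    simp only [Set.mem_insert_iff, Set.mem_singleton_iff] at hm
    rcases hm with h | h | h <;> rw [h]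
    · rw [hA] at h
      rw [hinj h]
      simpa using posFun_true (a := a) (b := b) 1 0 0
    · rw [hB] at h
      rw [hinj h]
      simpa using posFun_true (a := a) (b := b) 0 1 0
    · rw [hD] at h
      rw [hinj h]
      simpa using posFun_true (a := a) (b := b) 0 0 1

/-- The extension of the parametrization to the plane is injective. -/
lemma param_injective (r : Roots a b) {z z' : ℝ × ℝ} (hz : z ∈ sq) (hz' : z' ∈ sq) {κ : ℤ × ℤ}
    (h : param a b z = toOperator (unit a b κ) (param a b z')) :
    z.1 = κ.1 + z'.1 ∧ z.2 = κ.2 + z'.2 := by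
  obtain ⟨s, hs, hpos⟩ : ∃ s, param a b z ∈ tri a b s ∧ posFun a b s (param a b z) = z := by
    obtain ⟨⟨h1, h2⟩, h3, h4⟩ := hz
    rcases le_total z.1 z.2 with h | h
    · refine ⟨true, mem_convexHull_triple.2 ⟨_, _, _, by linarith, by linarith, h1, by ring,
        param_of_le h⟩, ?_⟩
      rw [param_of_le h, posFun_true, sub_add_cancel]
    · refine ⟨false, mem_convexHull_triple.2 ⟨_, _, _, by linarith, by linarith, h3, by ring,
        param_of_ge h⟩, ?_⟩
      rw [param_of_ge h, posFun_false, sub_add_cancel]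
  -- The translated point is a convex combination of the four vertices with exponents κ + corner,
  -- with the weights of z'.
  have hexp : toOperator (unit a b κ) (param a b z') =
      (1 - max z'.1 z'.2) • vert a b κ + (max z'.1 z'.2 - z'.2) • vert a b (κ + (1, 0)) +
      min z'.1 z'.2 • vert a b (κ + (1, 1)) + (max z'.1 z'.2 - z'.1) • vert a b (κ + (0, 1)) := by
    have hB : toOperator (unit a b κ) ptB = vert a b κ := rfl
    rw [param]
    simp only [map_add, map_smul, ptC_eq, ptA_eq (a := a) (b := b), ptD_eq (a := a) (b := b),
      ← toOperator_unit_add]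
    rfl
  have hl := triFun_of_mem hs
  rw [h, hexp] at hl
  rw [h, hexp] at hpos
  simp only [map_add, map_smul, smul_eq_mul] at hl
  simp only [map_add, map_smul] at hpos
  have hge : ∀ μ, 1 ≤ triFun a b s (vert a b μ) := fun μ => by
    simpa [toOperator_one] using (r.vert_mem_hull μ).2 0 s
  obtain ⟨⟨k1, k2⟩, k3, k4⟩ := hz'
  have w0 : 0 ≤ 1 - max z'.1 z'.2 := sub_nonneg.2 (max_le k2 k4)
  have w1 : 0 ≤ max z'.1 z'.2 - z'.2 := sub_nonneg.2 (le_max_right _ _)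
  have w2 : 0 ≤ min z'.1 z'.2 := le_min k1 k3
  have w3 : 0 ≤ max z'.1 z'.2 - z'.1 := sub_nonneg.2 (le_max_left _ _)
  have hmm := max_add_min z'.1 z'.2
  have m0 := mul_nonneg w0 (sub_nonneg.2 (hge κ))
  have m1 := mul_nonneg w1 (sub_nonneg.2 (hge (κ + (1, 0))))
  have m2 := mul_nonneg w2 (sub_nonneg.2 (hge (κ + (1, 1))))
  have m3 := mul_nonneg w3 (sub_nonneg.2 (hge (κ + (0, 1))))
  -- The form of the triangle containing the point is 1 there and at least 1 at all vertices. So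
  -- each vertex with nonzero weight lies in that triangle, where the position reads its exponent;
  -- averaging the exponents gives z = κ + z'.
  have key : ∀ (w : ℝ) (μ : ℤ × ℤ), w * (triFun a b s (vert a b μ) - 1) = 0 →
      w • posFun a b s (vert a b μ) = w • ((μ.1 : ℝ), (μ.2 : ℝ)) := by
    intro w μ h0
    rcases mul_eq_zero.1 h0 with h0 | h0
    · rw [h0, zero_smul, zero_smul]
    · rw [r.posFun_vert]
      rw [r.tri_eq]
      exact ⟨r.vert_mem_hull μ, by linarith⟩
  rw [key _ κ (by linarith), key _ (κ + (1, 0)) (by linarith), key _ (κ + (1, 1)) (by linarith),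
    key _ (κ + (0, 1)) (by linarith)] at hpos
  have p1 := congrArg Prod.fst hpos
  have p2 := congrArg Prod.snd hpos
  simp at p1 p2
  constructor
  · rw [← p1]
    linear_combination (1 + (κ.1 : ℝ)) * hmm
  · rw [← p2]
    linear_combination (1 + (κ.2 : ℝ)) * hmm

end Roots

/-! ### The factor of the sail is a torus -/

/-- Continuous surjections of a compact space onto Hausdorff spaces with the same fibres have
homeomorphic targets. -/
lemma exists_homeomorph_of_fibres {X Y Z : Type*} [TopologicalSpace X] [TopologicalSpace Y]
    [TopologicalSpace Z] [CompactSpace X] [T2Space Y] [T2Space Z] {f : X → Y} {g : X → Z}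
    (hf : Continuous f) (hg : Continuous g) (sf : f.Surjective) (sg : g.Surjective)
    (h : ∀ x y, f x = f y ↔ g x = g y) : ∃ φ : Y ≃ₜ Z, ∀ x, φ (f x) = g x := by
  have e1 : ∀ x, g (Function.surjInv sf (f x)) = g x := fun x =>
    (h _ _).1 (Function.surjInv_eq sf _)
  have e2 : ∀ x, f (Function.surjInv sg (g x)) = f x := fun x =>
    (h _ _).2 (Function.surjInv_eq sg _)
  -- A continuous map from a compact space to a Hausdorff space is closed, so both surjections are
  -- quotient maps.
  have qf := hf.isClosedMap.isQuotientMap hf sf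
  have qg := hg.isClosedMap.isQuotientMap hg sg
  refine ⟨⟨⟨fun y => g (Function.surjInv sf y), fun z => f (Function.surjInv sg z),
    fun y => ?_, fun z => ?_⟩, ?_, ?_⟩, e1⟩
  · obtain ⟨x, rfl⟩ := sf y
    exact (congrArg _ (congrArg _ (e1 x))).trans (e2 x)
  · obtain ⟨x, rfl⟩ := sg z
    exact (congrArg _ (congrArg _ (e2 x))).trans (e1 x)
  · exact qf.continuous_iff.2 (hg.congr fun x => (e1 x).symm)
  · exact qg.continuous_iff.2 (hf.congr fun x => (e2 x).symm)

lemma addCircle_coe_eq_iff {x y : ℝ} : (x : UnitAddCircle) = y ↔ ∃ k : ℤ, x = k + y := by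
  rw [← sub_eq_zero, ← AddCircle.coe_sub, AddCircle.coe_eq_zero_iff]
  refine exists_congr fun k => ?_
  rw [zsmul_one, eq_comm, sub_eq_iff_eq_add]

lemma toTorus_eq_iff {z w : ℝ × ℝ} : toTorus z = toTorus w ↔
    ∃ κ : ℤ × ℤ, z.1 = κ.1 + w.1 ∧ z.2 = κ.2 + w.2 := by
  rw [toTorus, toTorus, Prod.mk.injEq, addCircle_coe_eq_iff, addCircle_coe_eq_iff]
  exact ⟨fun ⟨⟨k, hk⟩, l, hl⟩ => ⟨(k, l), hk, hl⟩, fun ⟨κ, h1, h2⟩ => ⟨⟨_, h1⟩, _, h2⟩⟩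

lemma continuous_toTorus : Continuous toTorus := by
  unfold toTorus
  exact (AddCircle.continuous_mk' 1).comp continuous_fst |>.prodMk
    ((AddCircle.continuous_mk' 1).comp continuous_snd)

lemma exists_sq_toTorus (p : UnitAddCircle × UnitAddCircle) : ∃ z ∈ sq, toTorus z = p := by
  obtain ⟨x, y⟩ := p
  induction x using QuotientAddGroup.induction_on with | _ x =>
  induction y using QuotientAddGroup.induction_on with | _ y =>
  refine ⟨(Int.fract x, Int.fract y), ⟨⟨Int.fract_nonneg _, (Int.fract_lt_one _).le⟩,
    Int.fract_nonneg _, (Int.fract_lt_one _).le⟩, ?_⟩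
  refine (toTorus_eq_iff (w := (x, y))).2 ⟨(-⌊x⌋, -⌊y⌋), ?_, ?_⟩
  · push_cast
    linarith [Int.self_sub_floor x]
  · push_cast
    linarith [Int.self_sub_floor y]

/-! ### Logarithmic coordinates, the Hausdorff property and the homeomorphism with the torus. -/

namespace Roots

variable (r : Roots a b)

/-- The logarithm of a coordinate, made homogeneous of degree zero. -/
def logCoord (i : Fin 3) (v : Space) : ℝ :=
  Real.log (r.coord i v) - (∑ j, Real.log (r.coord j v)) / 3

lemma sum_log_sq : ∑ i, Real.log (r.t i ^ 2) = 0 := by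
  rw [← Real.log_prod fun i _ => (pow_two_pos_of_ne_zero (r.t_ne_zero i)).ne', Fin.prod_univ_three,
    ← mul_pow, ← mul_pow, r.prod_t]
  simp

lemma sum_log_add : ∑ i, Real.log (r.t i + (a + 2)) = 0 := by
  rw [← Real.log_prod fun i _ => (r.add_pos i).ne', Fin.prod_univ_three, r.prod_add, Real.log_one]

lemma logCoord_unit (i : Fin 3) (κ : ℤ × ℤ) {v : Space} (hv : v ∈ r.orth) :
    r.logCoord i (toOperator (unit a b κ) v) =
      κ.1 * Real.log (r.t i ^ 2) + κ.2 * Real.log (r.t i + (a + 2)) + r.logCoord i v := by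
  have e : ∀ j, Real.log (r.coord j (toOperator (unit a b κ) v)) =
      κ.1 * Real.log (r.t j ^ 2) + κ.2 * Real.log (r.t j + (a + 2)) + Real.log (r.coord j v) :=
    fun j => by rw [coord_unit, Real.log_mul (r.eps_pos j κ).ne' (hv j).ne', log_eps]
  simp only [logCoord, e, Finset.sum_add_distrib, ← Finset.mul_sum, sum_log_sq, sum_log_add]
  ring

lemma continuousOn_logCoord (i : Fin 3) : ContinuousOn (r.logCoord i) r.orth := by
  have e : ∀ j, ContinuousOn (fun v => Real.log (r.coord j v)) r.orth := fun j =>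
    ContinuousOn.log (r.continuous_coord j).continuousOn fun v hv => (hv j).ne'
  exact (e i).sub ((continuousOn_finsetSum _ fun j _ => e j).div_const 3)

/-- The logarithmic coordinates in the basis of the lattice of the units. -/
def logMap (v : Space) : ℝ × ℝ :=
  ((Real.log (r.t 1 + (a + 2)) * r.logCoord 0 v - Real.log (r.t 0 + (a + 2)) * r.logCoord 1 v) /
      (Real.log (r.t 0 ^ 2) * Real.log (r.t 1 + (a + 2)) -
        Real.log (r.t 1 ^ 2) * Real.log (r.t 0 + (a + 2))),
    (Real.log (r.t 0 ^ 2) * r.logCoord 1 v - Real.log (r.t 1 ^ 2) * r.logCoord 0 v) /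
      (Real.log (r.t 0 ^ 2) * Real.log (r.t 1 + (a + 2)) -
        Real.log (r.t 1 ^ 2) * Real.log (r.t 0 + (a + 2))))

lemma continuousOn_logMap : ContinuousOn r.logMap r.orth := by
  have h0 := r.continuousOn_logCoord 0
  have h1 := r.continuousOn_logCoord 1
  unfold logMap
  fun_prop

/-- Units of norm 1 have logarithms of sum 0, so they shift the homogeneous logarithms by a lattice
vector. `logMap` is Cramer's rule for that lattice; two of the three coordinates suffice. -/
lemma logMap_unit (κ : ℤ × ℤ) {v : Space} (hv : v ∈ r.orth) :
    (r.logMap (toOperator (unit a b κ) v)).1 = κ.1 + (r.logMap v).1 ∧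
      (r.logMap (toOperator (unit a b κ) v)).2 = κ.2 + (r.logMap v).2 := by
  have hr := r.regulator_pos.ne'
  simp only [logMap, r.logCoord_unit _ κ hv]
  constructor
  · rw [div_eq_iff hr, add_mul, div_mul_cancel₀ _ hr]
    ring
  · rw [div_eq_iff hr, add_mul, div_mul_cancel₀ _ hr]
    ring

lemma sum_logCoord (v : Space) : ∑ i, r.logCoord i v = 0 := by
  simp only [logCoord, Fin.sum_univ_three]
  ring

/-- Equal homogeneous logarithms mean that the logarithms of all the coordinates differ by one
common constant. -/
lemma exists_smul_of_logMap {v w : Space} (hv : v ∈ r.orth) (hw : w ∈ r.orth)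
    (h : r.logMap v = r.logMap w) : ∃ c : ℝ, 0 < c ∧ v = c • w := by
  have hr := r.regulator_pos.ne'
  obtain ⟨h1, h2⟩ := Prod.mk.inj h
  rw [div_left_inj' hr] at h1 h2
  have k0 : r.logCoord 0 v = r.logCoord 0 w := by
    apply mul_left_cancel₀ hr
    linear_combination Real.log (r.t 0 ^ 2) * h1 + Real.log (r.t 0 + (a + 2)) * h2
  have k1 : r.logCoord 1 v = r.logCoord 1 w := by
    apply mul_left_cancel₀ hr
    linear_combination Real.log (r.t 1 ^ 2) * h1 + Real.log (r.t 1 + (a + 2)) * h2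
  have k2 : r.logCoord 2 v = r.logCoord 2 w := by
    have e1 := r.sum_logCoord v
    have e2 := r.sum_logCoord w
    rw [Fin.sum_univ_three] at e1 e2
    linarith
  refine ⟨Real.exp ((∑ j, Real.log (r.coord j v)) / 3 - (∑ j, Real.log (r.coord j w)) / 3),
    Real.exp_pos _, r.coord_ext fun i => ?_⟩
  have k : r.logCoord i v = r.logCoord i w := by
    match i with
    | 0 => exact k0
    | 1 => exact k1
    | 2 => exact k2
  rw [map_smul, smul_eq_mul]
  nth_rw 1 [← Real.exp_log (hv i)]
  conv_rhs => rw [← Real.exp_log (hw i)]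
  rw [← Real.exp_add, Real.exp_eq_exp]
  unfold logCoord at k
  linarith

/-- Each ray meets the sail at most once: a form equal to 1 at one of the points is at least 1 at
the other, and this holds in both directions. -/
lemma eq_of_smul_mem_sail {v w : Space} (hv : v ∈ sail r.orth) (hw : w ∈ sail r.orth) {c : ℝ}
    (h : v = c • w) : v = w := by
  rw [sail_eq] at hv hw
  obtain ⟨hv, κ, s, h1⟩ := hv
  obtain ⟨hw, μ, s', h2⟩ := hw
  have h3 := hv.2 μ s'
  have h4 := hw.2 κ s
  rw [h, map_smul, map_smul, smul_eq_mul] at h1 h3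
  rw [h2, mul_one] at h3
  have : c = 1 := by nlinarith
  rw [h, this, one_smul]

lemma sail_subset_orth : sail r.orth ⊆ r.orth := fun _ hv => (r.sail_subset_hull hv).1

/-- The period quotient of the sail injects continuously into the torus. -/
def factorMap : SailFactor (frob a b) r.orth → UnitAddCircle × UnitAddCircle :=
  Quotient.lift (fun v => toTorus (r.logMap v)) (by
    rintro v w ⟨g, hg, h⟩
    obtain ⟨κ, rfl⟩ := r.mem_periodGroup_iff.1 hg
    refine (toTorus_eq_iff.2 ⟨κ, ?_⟩).symm
    rw [← h]
    exact r.logMap_unit κ (r.sail_subset_orth v.2))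

lemma continuous_factorMap : Continuous r.factorMap :=
  Continuous.quotient_lift (continuous_toTorus.comp
    (r.continuousOn_logMap.comp_continuous continuous_subtype_val
      fun v => r.sail_subset_orth v.2)) _

lemma mk_eq_iff {v w : sail r.orth} :
    (Quotient.mk (periodSetoid (frob a b) r.orth) v = Quotient.mk _ w) ↔
      ∃ κ, toOperator (unit a b κ) v = (w : Space) := by
  rw [Quotient.eq]
  constructor
  · rintro ⟨g, hg, h⟩
    obtain ⟨κ, rfl⟩ := r.mem_periodGroup_iff.1 hg
    exact ⟨κ, h⟩
  · rintro ⟨κ, h⟩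
    exact ⟨_, r.mem_periodGroup_iff.2 ⟨κ, rfl⟩, h⟩

lemma injective_factorMap : Function.Injective r.factorMap := by
  intro x y
  induction x using Quotient.inductionOn with | _ v =>
  induction y using Quotient.inductionOn with | _ w =>
  intro h
  obtain ⟨κ, h1, h2⟩ := toTorus_eq_iff.1 (show toTorus (r.logMap v) = toTorus (r.logMap w) from h)
  obtain ⟨h3, h4⟩ := r.logMap_unit κ (r.sail_subset_orth w.2)
  obtain ⟨c, -, hc⟩ := r.exists_smul_of_logMap (r.sail_subset_orth v.2)
    (r.sail_subset_orth (r.unit_mem_sail κ w.2)) (Prod.ext (h1.trans h3.symm) (h2.trans h4.symm))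
  exact (r.mk_eq_iff.2 ⟨κ, (r.eq_of_smul_mem_sail v.2 (r.unit_mem_sail κ w.2) hc).symm⟩).symm

/-- This is all that the logarithmic map is used for. The homeomorphism itself comes from the
piecewise linear parametrization, which respects the cells. -/
instance : T2Space (SailFactor (frob a b) r.orth) :=
  T2Space.of_injective_continuous r.injective_factorMap r.continuous_factorMap

lemma param_mem_sail {z : ℝ × ℝ} (hz : z ∈ sq) : param a b z ∈ sail r.orth := by
  obtain ⟨s, hs⟩ := param_mem_tri (a := a) (b := b) hz
  exact r.tri_subset_sail s hs

lemma exists_param {v : Space} (hv : v ∈ sail r.orth) :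
    ∃ κ, ∃ z ∈ sq, toOperator (unit a b κ) v = param a b z := by
  obtain ⟨κ, s, h⟩ := r.exists_mem_tri hv
  cases s
  · rw [← image_param_false] at h
    obtain ⟨z, hz, e⟩ := h
    exact ⟨κ, z, tri_false_subset_sq hz, e.symm⟩
  · rw [← image_param_true] at h
    obtain ⟨z, hz, e⟩ := h
    exact ⟨κ, z, tri_true_subset_sq hz, e.symm⟩

/-- The class of a point of the parametrized fundamental region. -/
def squareMap (z : sq) : SailFactor (frob a b) r.orth :=
  Quotient.mk _ ⟨param a b z, r.param_mem_sail z.2⟩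

lemma exists_homeomorph : ∃ φ : SailFactor (frob a b) r.orth ≃ₜ UnitAddCircle × UnitAddCircle,
    ∀ z : sq, φ (r.squareMap z) = toTorus z := by
  have : CompactSpace sq := isCompact_iff_compactSpace.1 (isCompact_Icc.prod isCompact_Icc)
  refine exists_homeomorph_of_fibres (f := r.squareMap) (g := fun z : sq => toTorus z)
    ?_ (continuous_toTorus.comp continuous_subtype_val) ?_ ?_ ?_
  · exact continuous_quotient_mk'.comp
      ((continuous_param.comp continuous_subtype_val).subtype_mk _)
  · intro x
    induction x using Quotient.inductionOn with | _ v =>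
    obtain ⟨κ, z, hz, h⟩ := r.exists_param v.2
    exact ⟨⟨z, hz⟩, (r.mk_eq_iff.2 ⟨κ, h⟩).symm⟩
  · intro p
    obtain ⟨z, hz, h⟩ := exists_sq_toTorus p
    exact ⟨⟨z, hz⟩, h⟩
  · intro z w
    rw [toTorus_eq_iff, squareMap, squareMap, eq_comm, r.mk_eq_iff]
    refine exists_congr fun κ => ⟨fun h => ?_, fun ⟨h1, h2⟩ => ?_⟩
    · exact r.param_injective z.2 w.2 h.symm
    · exact (param_add z.2 w.2 h1 h2).symm

/-! ### The cells of the torus triangulation -/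

/-- The image of a face in the factor. -/
def cell (F : Set Space) : Set (SailFactor (frob a b) r.orth) :=
  Quotient.mk _ '' (Subtype.val ⁻¹' F)

lemma cell_image {F : Set Space} (hF : F ⊆ sail r.orth) (κ : ℤ × ℤ) :
    r.cell (toOperator (unit a b κ) '' F) = r.cell F := by
  ext x
  constructor
  · rintro ⟨v, ⟨w, hw, h⟩, rfl⟩
    exact ⟨⟨w, hF hw⟩, hw, r.mk_eq_iff.2 ⟨κ, h⟩⟩
  · rintro ⟨v, hv, rfl⟩
    exact ⟨⟨_, r.unit_mem_sail κ v.2⟩, ⟨v, hv, rfl⟩, (r.mk_eq_iff.2 ⟨κ, rfl⟩).symm⟩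

lemma image_cell {φ : SailFactor (frob a b) r.orth ≃ₜ UnitAddCircle × UnitAddCircle}
    (hφ : ∀ z : sq, φ (r.squareMap z) = toTorus z) {t : Set (ℝ × ℝ)} (ht : t ⊆ sq) :
    φ '' r.cell (param a b '' t) = toTorus '' t := by
  ext x
  constructor
  · rintro ⟨_, ⟨v, ⟨z, hz, h⟩, rfl⟩, rfl⟩
    refine ⟨z, hz, ?_⟩
    rw [← hφ ⟨z, ht hz⟩]
    refine congrArg φ ?_
    rw [squareMap]
    exact congrArg _ (Subtype.ext h)
  · rintro ⟨z, hz, rfl⟩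
    exact ⟨_, ⟨⟨param a b z, r.param_mem_sail (ht hz)⟩, ⟨z, hz, rfl⟩, rfl⟩, hφ ⟨z, ht hz⟩⟩

lemma finrank_image_le (F : Set Space) (f : Space →ₗ[ℝ] Space) :
    Module.finrank ℝ (vectorSpan ℝ (f '' F)) ≤ Module.finrank ℝ (vectorSpan ℝ F) := by
  have := f.toAffineMap.map_vectorSpan (s := F)
  rw [LinearMap.toAffineMap_linear, LinearMap.coe_toAffineMap] at this
  rw [← this]
  exact Submodule.finrank_map_le _ _

lemma unit_image_neg (κ : ℤ × ℤ) (F : Set Space) :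
    toOperator (unit a b (-κ)) '' (toOperator (unit a b κ) '' F) = F := by
  rw [Set.image_image]
  simp [toOperator_unit_neg_cancel]

lemma finrank_unit_image (F : Set Space) (κ : ℤ × ℤ) :
    Module.finrank ℝ (vectorSpan ℝ (toOperator (unit a b κ) '' F)) =
      Module.finrank ℝ (vectorSpan ℝ F) := by
  refine (finrank_image_le F _).antisymm ?_
  conv_lhs => rw [← unit_image_neg (a := a) (b := b) κ F]
  exact finrank_image_le _ _

/-- The faces of the sail are the translates of the six standard faces. -/
lemma exists_std_of_isFace {F : Set Space} {k : ℕ} (h : IsFace r.orth k F) :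
    ∃ κ, toOperator (unit a b κ) '' F ∈ stdFaces a b ∧
      Module.finrank ℝ (vectorSpan ℝ (toOperator (unit a b κ) '' F)) = k := by
  obtain ⟨h1, h2⟩ := r.isFace_iff.1 h
  obtain ⟨κ, hκ⟩ := r.isStd_of_isContact h1
  exact ⟨κ, hκ, (finrank_unit_image F κ).trans h2⟩

/-- Translating a face by a unit changes neither its image in the factor nor its dimension, so the
six standard faces give all the cells. -/
lemma torusTriangulation_eq (k : ℕ) : torusTriangulation (frob a b) r.orth k =
    r.cell '' {F ∈ stdFaces a b | Module.finrank ℝ (vectorSpan ℝ F) = k} := by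
  ext c
  constructor
  · rintro ⟨F, hF, rfl⟩
    obtain ⟨κ, h1, h2⟩ := r.exists_std_of_isFace hF
    exact ⟨_, ⟨h1, h2⟩, r.cell_image (r.contact_subset_sail (r.isFace_iff.1 hF).1) κ⟩
  · rintro ⟨F, ⟨h1, h2⟩, rfl⟩
    exact ⟨F, r.isFace_iff.2 ⟨r.isContact_of_mem h1, h2⟩, rfl⟩

lemma finrank_B : Module.finrank ℝ (vectorSpan ℝ {ptB}) = 0 := by simp

lemma finrank_AB (a : ℕ) : Module.finrank ℝ (vectorSpan ℝ (segment ℝ (ptA a) ptB)) = 1 :=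
  finrank_vectorSpan_segment fun h => by simpa [ptA, ptB] using congrArg (fun v : Space => v 0) h

lemma finrank_AD (a b : ℕ) :
    Module.finrank ℝ (vectorSpan ℝ (segment ℝ (ptA a) (ptD b))) = 1 :=
  finrank_vectorSpan_segment fun h => by
    have := congrArg (fun v : Space => v 1) h
    simp [ptA, ptD] at this
    linarith [(Nat.cast_nonneg b : (0 : ℝ) ≤ b)]

lemma finrank_BD (b : ℕ) : Module.finrank ℝ (vectorSpan ℝ (segment ℝ ptB (ptD b))) = 1 :=
  finrank_vectorSpan_segment fun h => by
    have := congrArg (fun v : Space => v 1) h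
    simp [ptB, ptD] at this
    linarith [(Nat.cast_nonneg b : (0 : ℝ) ≤ b)]

lemma finrank_ABD (a b : ℕ) :
    Module.finrank ℝ (vectorSpan ℝ (convexHull ℝ {ptA a, ptB, ptD b})) = 2 :=
  finrank_vectorSpan_triple fun _ _ _ => linearIndep_ABD

lemma finrank_BCD (a b : ℕ) :
    Module.finrank ℝ (vectorSpan ℝ (convexHull ℝ {ptB, ptC a b, ptD b})) = 2 :=
  finrank_vectorSpan_triple fun _ _ _ => linearIndep_BCD

lemma stdFaces_finrank (k : ℕ) : {F ∈ stdFaces a b | Module.finrank ℝ (vectorSpan ℝ F) = k} =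
    match k with
    | 0 => {{ptB}}
    | 1 => {segment ℝ (ptA a) ptB, segment ℝ (ptA a) (ptD b), segment ℝ ptB (ptD b)}
    | 2 => {convexHull ℝ {ptA a, ptB, ptD b}, convexHull ℝ {ptB, ptC a b, ptD b}}
    | _ => ∅ := by
  ext F
  constructor
  · rintro ⟨h, rfl⟩
    rcases h with rfl | rfl | rfl | rfl | rfl | rfl
    · rw [finrank_B]; simp
    · rw [finrank_AB]; simp
    · rw [finrank_AD]; simp
    · rw [finrank_BD]; simp
    · rw [finrank_ABD]; simp
    · rw [finrank_BCD]; simp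
  · match k with
    | 0 =>
      rintro rfl
      exact ⟨by simp [stdFaces], finrank_B⟩
    | 1 =>
      rintro (rfl | rfl | rfl)
      exacts [⟨by simp [stdFaces], finrank_AB a⟩, ⟨by simp [stdFaces], finrank_AD a b⟩,
        ⟨by simp [stdFaces], finrank_BD b⟩]
    | 2 =>
      rintro (rfl | rfl)
      exacts [⟨by simp [stdFaces], finrank_ABD a b⟩, ⟨by simp [stdFaces], finrank_BCD a b⟩]
    | _ + 3 => exact fun h => absurd h (Set.notMem_empty F)

lemma unitY_image_AD : toOperator (unit a b (0, -1)) '' segment ℝ (ptA a) (ptD b) =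
    segment ℝ ptB (ptC a b) := by
  have h : unit a b (0, -1) = unitY a b := by simp [unit]
  have := image_segment ℝ (toOperator (unitY a b)).toAffineMap (ptA a) (ptD b)
  rw [LinearMap.coe_toAffineMap, unitY_ptA, unitY_ptD] at this
  rw [h, this]

/-- The model lists the side BC of the square, the family of faces lists AD; they are identified by
Y. -/
lemma cell_AD : r.cell (segment ℝ (ptA a) (ptD b)) = r.cell (segment ℝ ptB (ptC a b)) := by
  rw [← unitY_image_AD, r.cell_image (r.contact_subset_sail r.isContact_AD)]

/-- The torus triangulation is the square cut by a diagonal with the opposite sides glued. -/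
theorem homeomorphicDecompositions :
    HomeomorphicDecompositions (torusTriangulation (frob a b) r.orth) squareTriangulation := by
  obtain ⟨φ, hφ⟩ := r.exists_homeomorph
  have hsq : ∀ p ∈ ({0, 1} : Set ℝ), ∀ q ∈ ({0, 1} : Set ℝ), (p, q) ∈ sq := by
    rintro _ (rfl | rfl) _ (rfl | rfl) <;> norm_num [sq]
  have hseg : ∀ p ∈ ({0, 1} : Set ℝ), ∀ q ∈ ({0, 1} : Set ℝ), segment ℝ (0, 0) (p, q) ⊆ sq :=
    fun p hp q hq => convex_sq.segment_subset (hsq 0 (by simp) 0 (by simp)) (hsq p hp q hq)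
  have key : ∀ {t : Set (ℝ × ℝ)} {F : Set Space}, param a b '' t = F → t ⊆ sq →
      φ '' r.cell F = toTorus '' t := by
    rintro t _ rfl ht
    exact r.image_cell hφ ht
  have hB := key image_param_zero (Set.singleton_subset_iff.2 (hsq 0 (by simp) 0 (by simp)))
  have hBC := key image_param_BC (hseg 1 (by simp) 0 (by simp))
  have hBA := key image_param_BA (hseg 0 (by simp) 1 (by simp))
  have hBD := key image_param_BD (hseg 1 (by simp) 1 (by simp))
  have hABD := key image_param_true tri_true_subset_sq
  have hBCD := key image_param_false tri_false_subset_sq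
  refine ⟨φ, fun k => ?_⟩
  rw [r.torusTriangulation_eq, stdFaces_finrank, ← Set.image_comp]
  match k with
  | 0 => simp only [Set.image_singleton, Function.comp_apply, hB, squareTriangulation]
  | 1 =>
    simp only [Set.image_insert_eq, Set.image_singleton, Function.comp_apply, cell_AD, hBC, hBA,
      hBD, squareTriangulation]
    rw [Set.insert_comm]
  | 2 =>
    have e1 : tri a b true = convexHull ℝ {ptA a, ptB, ptD b} := rfl
    have e2 : tri a b false = convexHull ℝ {ptB, ptC a b, ptD b} := rfl
    simp only [Set.image_insert_eq, Set.image_singleton, Function.comp_apply, ← e1, ← e2, hABD,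
      hBCD, squareTriangulation]
  | _ + 3 => simp [squareTriangulation]

end Roots

/-! ### The standard faces represent the classes of faces -/

/-- The indices of the vertices of the standard faces. -/
def stdIdx : Fin 6 → Finset (ℤ × ℤ) :=
  ![{(0, 0)}, {(0, 1), (0, 0)}, {(0, 1), (1, 1)}, {(0, 0), (1, 1)}, {(0, 1), (0, 0), (1, 1)},
    {(0, 0), (1, 0), (1, 1)}]

/-- The number of indices, and their sum modulo that number, are invariant under translation; they
separate the six sets. -/
lemma eq_of_stdIdx_translate {i j : Fin 6} {κ : ℤ × ℤ}
    (h : stdIdx j = (stdIdx i).map (addLeftEmbedding κ)) : i = j := by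
  have hc : (stdIdx j).card = (stdIdx i).card := by rw [h, Finset.card_map]
  have hs : ∑ μ ∈ stdIdx j, μ = (stdIdx i).card • κ + ∑ μ ∈ stdIdx i, μ := by
    rw [h, Finset.sum_map]
    exact Finset.sum_add_distrib.trans (by rw [Finset.sum_const])
  have ec : ∀ i, (stdIdx i).card = ![1, 2, 2, 2, 3, 3] i := by decide
  have es : ∀ i, ∑ μ ∈ stdIdx i, μ =
    ![((0 : ℤ), (0 : ℤ)), (0, 1), (1, 2), (1, 1), (1, 2), (2, 1)] i := by decide
  rw [es, es, ec, Prod.ext_iff] at hs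
  rw [ec, ec] at hc
  obtain ⟨k, l⟩ := κ
  fin_cases i <;> fin_cases j <;> simp at hc hs ⊢ <;> omega

lemma image_stdIdx_eq (F : Set Space) : F ∈ stdFaces a b ↔
    ∃ i, F = convexHull ℝ (vert a b '' stdIdx i) := by
  have hA : vert a b (0, 1) = ptA a := Roots.ptA_eq.symm
  have hB : vert a b (0, 0) = ptB := vert_zero
  have hC : vert a b (1, 0) = ptC a b := Roots.ptC_eq.symm
  have hD : vert a b (1, 1) = ptD b := Roots.ptD_eq.symm
  simp [Fin.exists_fin_succ, stdIdx, stdFaces, Set.image_insert_eq, hA, hB, hC, hD,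
    convexHull_pair]

namespace Roots

variable (r : Roots a b)

/-- All vertices are extreme in the polyhedron, so a hull of vertices determines its index set.
Comparison of faces becomes comparison of finite sets of exponents. -/
lemma vert_mem_convexHull_iff (r : Roots a b) (s : Finset (ℤ × ℤ)) (μ : ℤ × ℤ) :
    vert a b μ ∈ convexHull ℝ (vert a b '' s) ↔ μ ∈ s := by
  constructor
  · intro h
    have hsub : convexHull ℝ (vert a b '' s) ⊆ r.hull := by
      refine convexHull_min ?_ r.convex_hull
      rintro _ ⟨ν, -, rfl⟩
      exact r.vert_mem_hull ν
    obtain ⟨ν, hν, e⟩ := extremePoints_convexHull_subset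
      (inter_extremePoints_subset_extremePoints_of_subset hsub ⟨h, r.vert_extreme μ⟩)
    rwa [← r.vert_injective e]
  · exact fun h => subset_convexHull ℝ _ ⟨μ, h, rfl⟩

lemma unit_image_convexHull (κ : ℤ × ℤ) (s : Finset (ℤ × ℤ)) :
    toOperator (unit a b κ) '' convexHull ℝ (vert a b '' s) =
      convexHull ℝ (vert a b '' (s.map (addLeftEmbedding κ))) := by
  rw [LinearMap.image_convexHull, Finset.coe_map, Set.image_image, Set.image_image]
  congr 2
  ext μ
  rw [unit_vert]
  rfl

lemma eq_of_unit_image (r : Roots a b) {F F' : Set Space} (hF : F ∈ stdFaces a b) (hF' : F' ∈ stdFaces a b)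
    {κ : ℤ × ℤ} (h : toOperator (unit a b κ) '' F = F') : F = F' := by
  obtain ⟨i, rfl⟩ := (image_stdIdx_eq F).1 hF
  obtain ⟨j, rfl⟩ := (image_stdIdx_eq F').1 hF'
  rw [unit_image_convexHull] at h
  have : stdIdx j = (stdIdx i).map (addLeftEmbedding κ) := by
    ext μ
    rw [← r.vert_mem_convexHull_iff, ← h, r.vert_mem_convexHull_iff]
  rw [eq_of_stdIdx_translate this]

theorem isFundamentalFamily : IsFundamentalFamily (frob a b) r.orth (stdFaces a b) := by
  refine ⟨fun F hF => ⟨_, r.isFace_iff.2 ⟨r.isContact_of_mem hF, rfl⟩⟩, fun k F hF => ?_⟩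
  obtain ⟨κ, hκ, -⟩ := r.exists_std_of_isFace hF
  refine ⟨_, ⟨hκ, _, r.mem_periodGroup_iff.2 ⟨κ, rfl⟩, rfl⟩, ?_⟩
  rintro F' ⟨hF', g, hg, e⟩
  obtain ⟨μ, rfl⟩ := r.mem_periodGroup_iff.1 hg
  refine (r.eq_of_unit_image (κ := μ - κ) hκ hF' ?_).symm
  rw [← e, Set.image_image]
  refine Set.image_congr fun v _ => ?_
  rw [← toOperator_unit_add, sub_add_cancel]

lemma isFace_vert (κ : ℤ × ℤ) : IsFace r.orth 0 {vert a b κ} :=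
  r.isFace_iff.2 ⟨r.isContact_vert κ, by simp⟩

end Roots

/-! ### The closure of the fundamental region -/

/-- The affine plane cut out by a linear equation. -/
def levelPlane (l : Space →ₗ[ℝ] ℝ) (c : ℝ) : AffineSubspace ℝ Space where
  carrier := {v | l v = c}
  smul_vsub_vadd_mem' t p q s hp hq hs := by
    simp only [Set.mem_ofPred] at hp hq hs ⊢
    simp [hp, hq, hs]

lemma mem_levelPlane {l : Space →ₗ[ℝ] ℝ} {c : ℝ} {v : Space} : v ∈ levelPlane l c ↔ l v = c :=
  Iff.rfl

lemma mem_affineSpan_triple {P Q R : Space} {p q s : ℝ} (h : p + q + s = 1) :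
    p • P + q • Q + s • R ∈ affineSpan ℝ {P, Q, R} := by
  have hP : P ∈ affineSpan ℝ {P, Q, R} := subset_affineSpan ℝ _ (by simp)
  have hQ : Q ∈ affineSpan ℝ {P, Q, R} := subset_affineSpan ℝ _ (by simp)
  have hR : R ∈ affineSpan ℝ {P, Q, R} := subset_affineSpan ℝ _ (by simp)
  have := AffineSubspace.smul_vsub_vadd_mem _ p hP hQ
    (AffineSubspace.smul_vsub_vadd_mem _ s hR hQ hQ)
  convert this using 1
  rw [eq_sub_of_add_eq (show q + (p + s) = 1 by linarith)]
  simp only [vsub_eq_sub, vadd_eq_add]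
  module

lemma affineSpan_ABD (a b : ℕ) :
    affineSpan ℝ {ptA a, ptB, ptD b} = levelPlane (funABD a b) 1 := by
  apply le_antisymm
  · rw [affineSpan_le]
    rintro v (rfl | rfl | rfl)
    exacts [funABD_ptA, funABD_ptB, funABD_ptD]
  · intro v hv
    rw [eq_barycentric_ABD (a := a) (b := b) v]
    exact mem_affineSpan_triple (by rw [← funABD_eq_sum]; exact hv)

lemma affineSpan_BCD (a b : ℕ) :
    affineSpan ℝ {ptB, ptC a b, ptD b} = levelPlane (funBCD a b) 1 := by
  apply le_antisymm
  · rw [affineSpan_le]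
    rintro v (rfl | rfl | rfl)
    exacts [funBCD_ptB, funBCD_ptC, funBCD_ptD]
  · intro v hv
    rw [eq_barycentric_BCD (a := a) (b := b) v]
    exact mem_affineSpan_triple (by rw [← funBCD_eq_sum]; exact hv)

/-- A convex set is in the closure of its relative interior, if it meets an open convex set in
whose trace on the affine span it contains. -/
lemma subset_closure_intrinsicInterior {K U : Set Space} (hK : Convex ℝ K) (hU : IsOpen U)
    (hKU : U ∩ affineSpan ℝ K ⊆ K) {c : Space} (hc : c ∈ K)
    (hseg : ∀ y ∈ K, openSegment ℝ c y ⊆ U) : K ⊆ closure (intrinsicInterior ℝ K) := by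
  intro y hy
  refine closure_mono ?_ (segment_subset_closure_openSegment (right_mem_segment ℝ c y))
  intro x hx
  have hxK := hK.openSegment_subset hc hy hx
  refine mem_intrinsicInterior.2 ⟨⟨x, subset_affineSpan ℝ K hxK⟩, ?_, rfl⟩
  refine mem_interior.2 ⟨Subtype.val ⁻¹' U, fun z hz => hKU ⟨hz, z.2⟩,
    hU.preimage continuous_subtype_val, hseg y hy hx⟩

/-- A nondegenerate triangle is the closure of its relative interior. -/
lemma triple_subset_closure {P Q R : Space} {f g h : Space → ℝ} (hf : Continuous f)
    (hg : Continuous g) (hh : Continuous h)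
    (hc : ∀ p q s : ℝ, f (p • P + q • Q + s • R) = p ∧ g (p • P + q • Q + s • R) = q ∧
      h (p • P + q • Q + s • R) = s)
    (he : ∀ v ∈ affineSpan ℝ {P, Q, R}, v = f v • P + g v • Q + h v • R ∧ f v + g v + h v = 1) :
    convexHull ℝ {P, Q, R} ⊆ closure (intrinsicInterior ℝ (convexHull ℝ {P, Q, R})) := by
  refine subset_closure_intrinsicInterior (U := {v | 0 < f v ∧ 0 < g v ∧ 0 < h v})
    (c := (1 / 3 : ℝ) • P + (1 / 3 : ℝ) • Q + (1 / 3 : ℝ) • R) (convex_convexHull ℝ _)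
    ?_ ?_ ?_ ?_
  · exact (isOpen_lt continuous_const hf).inter
      ((isOpen_lt continuous_const hg).inter (isOpen_lt continuous_const hh))
  · rintro v ⟨⟨h1, h2, h3⟩, hv⟩
    rw [affineSpan_convexHull] at hv
    exact mem_convexHull_triple.2 ⟨_, _, _, h1.le, h2.le, h3.le, (he v hv).2, (he v hv).1⟩
  · exact mem_convexHull_triple.2 ⟨_, _, _, by norm_num, by norm_num, by norm_num, by norm_num, rfl⟩
  · rintro y hy x ⟨u, w, hu, hw, -, rfl⟩
    obtain ⟨p, q, s, hp, hq, hs, -, rfl⟩ := mem_convexHull_triple.1 hy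
    have e : u • ((1 / 3 : ℝ) • P + (1 / 3 : ℝ) • Q + (1 / 3 : ℝ) • R) +
        w • (p • P + q • Q + s • R) =
        (u * (1 / 3) + w * p) • P + (u * (1 / 3) + w * q) • Q + (u * (1 / 3) + w * s) • R := by
      module
    obtain ⟨h1, h2, h3⟩ := hc (u * (1 / 3) + w * p) (u * (1 / 3) + w * q) (u * (1 / 3) + w * s)
    rw [e]
    refine ⟨?_, ?_, ?_⟩
    · rw [h1]; positivity
    · rw [h2]; positivity
    · rw [h3]; positivity

lemma tri_true_subset_closure (a b : ℕ) : convexHull ℝ {ptA a, ptB, ptD b} ⊆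
    closure (intrinsicInterior ℝ (convexHull ℝ {ptA a, ptB, ptD b})) := by
  refine triple_subset_closure (f := barA b) (g := barB a b) (h := barD b) ?_ ?_ ?_
    Roots.bar_combo fun v hv => ⟨eq_barycentric_ABD v, ?_⟩
  · unfold barA; fun_prop
  · unfold barB barA barD; fun_prop
  · unfold barD; fun_prop
  · rw [affineSpan_ABD a b] at hv
    rw [← funABD_eq_sum]
    exact hv

lemma tri_false_subset_closure (a b : ℕ) : convexHull ℝ {ptB, ptC a b, ptD b} ⊆
    closure (intrinsicInterior ℝ (convexHull ℝ {ptB, ptC a b, ptD b})) := by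
  refine triple_subset_closure (f := barB' a b) (g := barC' a b) (h := barD' a b) ?_ ?_ ?_
    (fun p q s => ?_) fun v hv => ⟨eq_barycentric_BCD v, ?_⟩
  · unfold barB' barD' barC'; fun_prop
  · unfold barC'; fun_prop
  · unfold barD' barC'; fun_prop
  · obtain ⟨h1, h2, h3⟩ := bar_combo' (a := a) (b := b) p q s
    exact ⟨h3, h1, h2⟩
  · rw [affineSpan_BCD a b] at hv
    rw [← funBCD_eq_sum]
    exact hv

theorem closure_openFaceUnion (a b : ℕ) : closure (openFaceUnion (stdFaces a b)) =
    convexHull ℝ {ptA a, ptB, ptD b} ∪ convexHull ℝ {ptB, ptC a b, ptD b} := by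
  have hclosed : ∀ P Q R : Space, IsClosed (convexHull ℝ {P, Q, R}) := fun P Q R =>
    (Set.toFinite {P, Q, R}).isClosed_convexHull ℝ
  apply Set.Subset.antisymm
  · refine closure_minimal (Set.iUnion₂_subset fun F hF => intrinsicInterior_subset.trans ?_)
      ((hclosed _ _ _).union (hclosed _ _ _))
    have hsub : ∀ P Q, P ∈ ({ptA a, ptB, ptD b} : Set Space) → Q ∈ ({ptA a, ptB, ptD b} : Set Space) →
        segment ℝ P Q ⊆ convexHull ℝ {ptA a, ptB, ptD b} := fun P Q hP hQ =>
      (convex_convexHull ℝ _).segment_subset (subset_convexHull ℝ _ hP) (subset_convexHull ℝ _ hQ)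
    rcases hF with rfl | rfl | rfl | rfl | rfl | rfl
    · exact Set.subset_union_of_subset_left
        (Set.singleton_subset_iff.2 (subset_convexHull ℝ _ (by simp))) _
    · exact Set.subset_union_of_subset_left (hsub _ _ (by simp) (by simp)) _
    · exact Set.subset_union_of_subset_left (hsub _ _ (by simp) (by simp)) _
    · exact Set.subset_union_of_subset_left (hsub _ _ (by simp) (by simp)) _
    · exact Set.subset_union_left
    · exact Set.subset_union_right
  · refine Set.union_subset ((tri_true_subset_closure a b).trans (closure_mono ?_))
      ((tri_false_subset_closure a b).trans (closure_mono ?_))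
    · exact Set.subset_biUnion_of_mem (u := fun F => intrinsicInterior ℝ F) (by simp [stdFaces])
    · exact Set.subset_biUnion_of_mem (u := fun F => intrinsicInterior ℝ F) (by simp [stdFaces])

/-! ### Eigenvectors and orthants -/

namespace Roots

variable (r : Roots a b)

lemma dual_ne_zero (i : Fin 3) : r.dual i ≠ 0 := fun h => by
  have := r.coord_dual_self i
  rw [h, map_zero] at this
  exact zero_ne_one this

lemma hasEigenvector_dual (i : Fin 3) :
    Module.End.HasEigenvector (toOperator (frob a b)) (r.t i)⁻¹ (r.dual i) := by
  refine ⟨Module.End.mem_eigenspace_iff.2 (r.coord_ext fun j => ?_), r.dual_ne_zero i⟩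
  rw [r.coord_frob, map_smul, smul_eq_mul]
  rcases eq_or_ne j i with rfl | h
  · rfl
  · rw [r.coord_dual_ne h, mul_zero, mul_zero]

lemma exists_eigenvalues (r : Roots a b) : ∃ s : Fin 3 → ℝ, Function.Injective s ∧
    ∀ i, Module.End.HasEigenvalue (toOperator (frob a b)) (s i) :=
  ⟨fun i => (r.t i)⁻¹, inv_injective.comp r.injective,
    fun i => Module.End.hasEigenvalue_of_hasEigenvector (r.hasEigenvector_dual i)⟩

lemma exists_coord_of_eigenvector {u : Space} (hu : IsEigenvector (frob a b) u) :
    ∃ i, ∀ j ≠ i, r.coord j u = 0 := by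
  obtain ⟨μ, hu⟩ := hu
  have key : ∀ j, r.coord j u ≠ 0 → (r.t j)⁻¹ = μ := fun j hj => by
    have := congrArg (r.coord j) hu.apply_eq_smul
    rw [r.coord_frob, map_smul, smul_eq_mul] at this
    exact mul_right_cancel₀ hj this
  by_cases h : ∃ i, r.coord i u ≠ 0
  · obtain ⟨i, hi⟩ := h
    refine ⟨i, fun j hj => by_contra fun hj' => hj ?_⟩
    exact r.injective (inv_injective ((key j hj').trans (key i hi).symm))
  · push Not at h
    exact ⟨0, fun j _ => h j⟩

lemma linearIndependent_dual {i j : Fin 3} (hij : i ≠ j) :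
    LinearIndependent ℝ ![r.dual i, r.dual j] := by
  refine LinearIndependent.pair_iff.2 fun s t h => ?_
  have h1 := congrArg (r.coord i) h
  have h2 := congrArg (r.coord j) h
  simpa [r.coord_dual_self, r.coord_dual_ne hij, r.coord_dual_ne hij.symm] using And.intro h1 h2

/-- An eigenvector has at most one nonzero eigencoordinate, so a plane through two of them lies in a
coordinate plane. Conversely, every coordinate plane is spanned by two dual eigenvectors. -/
lemma planesComplement_eq : planesComplement (frob a b) = {v | ∀ i, r.coord i v ≠ 0} := by
  ext v
  constructor
  · intro hv i hi
    obtain ⟨j, k, hij, hjk, hik, hs⟩ : ∃ j k : Fin 3, j ≠ i ∧ j ≠ k ∧ k ≠ i ∧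
        (Finset.univ : Finset (Fin 3)) = {i, j, k} := by
      clear hi; revert i; decide
    refine hv _ ⟨r.dual j, r.dual k, ⟨_, r.hasEigenvector_dual j⟩, ⟨_, r.hasEigenvector_dual k⟩,
      r.linearIndependent_dual hjk, rfl⟩ ?_
    refine Submodule.mem_span_pair.2 ⟨r.coord j v, r.coord k v, ?_⟩
    have e := r.sum_dual v
    rw [hs, Finset.sum_insert (by simp [hij.symm, hik.symm]), Finset.sum_pair hjk, hi, zero_smul,
      zero_add] at e
    exact e.symm
  · rintro hv _ ⟨u, w, hu, hw, -, rfl⟩ h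
    obtain ⟨i, hi⟩ := r.exists_coord_of_eigenvector hu
    obtain ⟨j, hj⟩ := r.exists_coord_of_eigenvector hw
    obtain ⟨k, hki, hkj⟩ : ∃ k : Fin 3, k ≠ i ∧ k ≠ j := by
      clear hi hj; revert i j; decide
    obtain ⟨p, q, rfl⟩ := Submodule.mem_span_pair.1 h
    exact hv k (by simp [hi k hki, hj k hkj])

/-- No coordinate vanishes on a component, so by the intermediate value theorem none changes sign.
-/
lemma coord_mul_pos {x y : Space}
    (hy : y ∈ connectedComponentIn (planesComplement (frob a b)) x)
    (i : Fin 3) : 0 < r.coord i x * r.coord i y := by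
  have hx := mem_connectedComponentIn (connectedComponentIn_nonempty_iff.1 ⟨y, hy⟩)
  have hne : ∀ z ∈ connectedComponentIn (planesComplement (frob a b)) x, r.coord i z ≠ 0 :=
    fun z hz => by
      have := connectedComponentIn_subset _ _ hz
      rw [r.planesComplement_eq] at this
      exact this i
  by_contra hneg
  have hc : ContinuousOn (r.coord i) (connectedComponentIn (planesComplement (frob a b)) x) :=
    (r.continuous_coord i).continuousOn
  have key : (0 : ℝ) ∈ r.coord i '' connectedComponentIn (planesComplement (frob a b)) x := by
    rcases mul_nonpos_iff.1 (not_lt.1 hneg) with ⟨h1, h2⟩ | ⟨h1, h2⟩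
    · exact isPreconnected_connectedComponentIn.intermediate_value hy hx hc ⟨h2, h1⟩
    · exact isPreconnected_connectedComponentIn.intermediate_value hx hy hc ⟨h1, h2⟩
  obtain ⟨z, hz, h0⟩ := key
  exact hne z hz h0

lemma orth_subset : r.orth ⊆ planesComplement (frob a b) := by
  rw [r.planesComplement_eq]
  exact fun v hv i => (hv i).ne'

lemma connectedComponentIn_eq_orth {x : Space} (hx : x ∈ r.orth) :
    connectedComponentIn (planesComplement (frob a b)) x = r.orth := by
  apply Set.Subset.antisymm
  · exact fun y hy i => pos_of_mul_pos_right (r.coord_mul_pos hy i) (hx i).le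
  · exact r.convex_orth.isPreconnected.subset_connectedComponentIn hx r.orth_subset

lemma isOrthant_orth : IsOrthant (frob a b) r.orth :=
  ⟨ptB, r.orth_subset r.ptB_mem_orth, (r.connectedComponentIn_eq_orth r.ptB_mem_orth).symm⟩

/-- The closed half-spaces given by the signs at a point x of O contain the closure of O, hence its
hull and B. All coordinates of B are 1, so all those signs are positive. -/
lemma eq_orth {O : Set Space} (hO : IsOrthant (frob a b) O) (hB : ptB ∈ integerHull O) :
    O = r.orth := by
  obtain ⟨x, hx, rfl⟩ := hO
  refine r.connectedComponentIn_eq_orth fun i => ?_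
  have hclosed : IsClosed {v | 0 ≤ r.coord i x * r.coord i v} :=
    isClosed_le continuous_const (continuous_const.mul (r.continuous_coord i))
  have hconv : Convex ℝ {v | 0 ≤ r.coord i x * r.coord i v} :=
    convex_halfSpace_ge (r.coord i x • r.coord i).isLinear 0
  have h : 0 ≤ r.coord i x * r.coord i ptB := convexHull_min (fun v hv => closure_minimal
    (fun y hy => (r.coord_mul_pos hy i).le) hclosed hv.1) hconv hB
  rw [r.coord_ptB, mul_one] at h
  rw [r.planesComplement_eq] at hx
  exact h.lt_of_ne' (hx i)

/-! ### The period group -/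

theorem periodGroup_eq :
    periodGroup (frob a b) r.orth = Subgroup.closure {unitX a b, unitY a b} := by
  ext g
  rw [r.mem_periodGroup_iff, mem_closure_iff]

lemma eq_zero_of_zpow (r : Roots a b) {i j : ℤ} (h : unitX a b ^ i * unitY a b ^ j = 1) :
    i = 0 ∧ j = 0 := by
  have := r.eq_zero_of_unit (κ := (i, -j)) (by rw [unit, neg_neg, h, toOperator_one])
  simpa using this

end Roots

/-! ### Integer volumes of simplices -/

lemma affineIndependent_iff_sub {V : Type*} [AddCommGroup V] [Module ℝ V] {k : ℕ}
    (w : Fin (k + 1) → V) :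
    AffineIndependent ℝ w ↔ LinearIndependent ℝ fun i : Fin k => w i.succ - w 0 := by
  rw [affineIndependent_iff_linearIndependent_vsub ℝ w 0,
    ← linearIndependent_equiv (finSuccAboveEquiv 0)]
  rfl

/-- The linear combinations of given vectors, as a map of the coordinate space. -/
def comb {k : ℕ} (d : Fin k → Space) : EuclideanSpace ℝ (Fin k) →ₗ[ℝ] Space :=
  Fintype.linearCombination ℝ d ∘ₗ (WithLp.linearEquiv 2 ℝ (Fin k → ℝ)).toLinearMap

lemma comb_apply {k : ℕ} (d : Fin k → Space) (x : EuclideanSpace ℝ (Fin k)) :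
    comb d x = ∑ i, x i • d i := rfl

lemma comb_injective_iff {k : ℕ} {d : Fin k → Space} :
    Function.Injective (comb d) ↔ LinearIndependent ℝ d := by
  rw [linearIndependent_iff_injective_fintypeLinearCombination]
  exact (WithLp.equiv 2 (Fin k → ℝ)).injective_comp (Fintype.linearCombination ℝ d)

lemma normDet_comb_pos {k : ℕ} {d : Fin k → Space} (h : LinearIndependent ℝ d) :
    0 < (comb d).normDet := by
  refine (LinearMap.normDet_nonneg _).lt_of_ne' fun h0 => ?_
  exact LinearMap.normDet_eq_zero_iff_ker_ne_bot.1 h0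
    (LinearMap.ker_eq_bot.2 (comb_injective_iff.2 h))

lemma linearIndependent_of_normDet {k : ℕ} {d : Fin k → Space} (h : (comb d).normDet ≠ 0) :
    LinearIndependent ℝ d := by
  rw [← comb_injective_iff, ← LinearMap.ker_eq_bot]
  by_contra h0
  exact h (LinearMap.normDet_eq_zero_iff_ker_ne_bot.2 h0)

/-- The vertices of the standard simplex. -/
def stdVertex (k : ℕ) : Fin (k + 1) → EuclideanSpace ℝ (Fin k) :=
  Fin.cons 0 fun i => EuclideanSpace.single i 1

/-- The volume of the standard simplex. -/
def stdVolume (k : ℕ) : ℝ := (volume (convexHull ℝ (Set.range (stdVertex k)))).toReal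

lemma stdVolume_pos (k : ℕ) : 0 < stdVolume k := by
  refine ENNReal.toReal_pos ?_ ?_
  · have h : AffineIndependent ℝ (stdVertex k) := by
      rw [affineIndependent_iff_sub]
      have e : (fun i : Fin k => stdVertex k i.succ - stdVertex k 0) =
          (EuclideanSpace.basisFun (Fin k) ℝ).toBasis := by
        ext i
        simp [stdVertex]
      rw [e]
      exact (EuclideanSpace.basisFun (Fin k) ℝ).toBasis.linearIndependent
    refine (Measure.measure_pos_of_nonempty_interior _ ?_).ne'
    rw [interior_convexHull_nonempty_iff_affineSpan_eq_top,
      h.affineSpan_eq_top_iff_card_eq_finrank_add_one]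
    simp
  · exact ((Set.finite_range _).isCompact_convexHull ℝ).measure_lt_top.ne

/-- The Euclidean volume of a simplex. -/
lemma euclideanVolume_simplex {k : ℕ} (w : Fin (k + 1) → Space) :
    euclideanVolume k (convexHull ℝ (Set.range w)) =
      (comb fun i : Fin k => w i.succ - w 0).normDet * stdVolume k := by
  have e : convexHull ℝ (Set.range w) = (fun v => w 0 + v) ''
      (comb (fun i : Fin k => w i.succ - w 0) '' convexHull ℝ (Set.range (stdVertex k))) := by
    rw [LinearMap.image_convexHull, ← Set.range_comp,
      show (fun v => w 0 + v) = (AffineEquiv.constVAdd ℝ Space (w 0)).toAffineMap from rfl,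
      AffineMap.image_convexHull, ← Set.range_comp]
    congr 2
    ext1 i
    refine Fin.cases ?_ (fun i => ?_) i
    · simp [stdVertex]
    · simp [stdVertex, comb_apply]
  have hiso : Isometry fun v => w 0 + v := isometry_add_left _
  have := LinearMap.euclideanHausdorffMeasure_image_eq_normDet_mul_volume
    (comb fun i : Fin k => w i.succ - w 0) (convexHull ℝ (Set.range (stdVertex k)))
  rw [finrank_euclideanSpace_fin] at this
  rw [euclideanVolume, e, hiso.euclideanHausdorffMeasure_image, this, ENNReal.toReal_mul,
    ENNReal.toReal_ofReal (LinearMap.normDet_nonneg _), stdVolume]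

/-- The change of the volume factor under an integer substitution. -/
lemma normDet_comb_matrix {k : ℕ} (d : Fin k → Space) (A : Matrix (Fin k) (Fin k) ℤ) :
    (comb fun i => ∑ j, (A i j : ℝ) • d j).normDet = (comb d).normDet * |(A.det : ℝ)| := by
  have e : (comb fun i => ∑ j, (A i j : ℝ) • d j) =
      comb d ∘ₗ Matrix.toEuclideanLin (A.map (Int.cast : ℤ → ℝ)).transpose := by
    ext1 x
    simp only [LinearMap.comp_apply, comb_apply, Matrix.toLpLin_apply, Matrix.mulVec, dotProduct,
      Matrix.transpose_apply, Matrix.map_apply, Finset.smul_sum, Finset.sum_smul]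
    rw [Finset.sum_comm]
    simp only [smul_smul, mul_comm]
  rw [e, LinearMap.normDet_comp_of_finrank_eq _ _ rfl, LinearMap.normDet_eq_abs_det,
    Matrix.toEuclideanLin_eq_toLin_orthonormal, LinearMap.det_toLin, Matrix.det_transpose]
  congr 2
  exact (Int.cast_det A).symm

/-- The integer volume of a simplex is the index of its edges in the lattice of its plane. -/
theorem integerVolume_simplex {k : ℕ} {w : Fin (k + 1) → Space} {d : Fin k → Space}
    (c : Fin k → Space →ₗ[ℝ] ℝ) (A : Matrix (Fin k) (Fin k) ℤ) (hA : A.det ≠ 0)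
    (hw : IsIntegerPoint (w 0)) (hd : ∀ i, IsIntegerPoint (d i))
    (hc : ∀ i v, IsIntegerPoint v → ∃ z : ℤ, c i v = z)
    (hcd : ∀ i j, c i (d j) = if i = j then 1 else 0)
    (hwd : ∀ i : Fin k, w i.succ - w 0 = ∑ j, (A i j : ℝ) • d j) :
    integerVolume k (convexHull ℝ (Set.range w)) = |(A.det : ℝ)| := by
  have hsum : ∀ (x : Fin k → ℝ) i, c i (∑ j, x j • d j) = x i := fun x i => by
    simp [hcd]
  have hlin : LinearIndependent ℝ d := Fintype.linearIndependent_iff.2 fun x hx i => by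
    rw [← hsum x i, hx, map_zero]
  have hdet : (1 : ℝ) ≤ |(A.det : ℝ)| := by exact_mod_cast Int.one_le_abs hA
  have hpos := mul_pos (normDet_comb_pos hlin) (stdVolume_pos k)
  have hindep : LinearIndependent ℝ fun i : Fin k => w i.succ - w 0 := by
    apply linearIndependent_of_normDet
    rw [show (fun i : Fin k => w i.succ - w 0) = fun i => ∑ j, (A i j : ℝ) • d j from funext hwd,
      normDet_comb_matrix]
    exact (mul_pos (normDet_comb_pos hlin) (by linarith)).ne'
  have hspan : vectorSpan ℝ (Set.range w) = Submodule.span ℝ (Set.range d) := by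
    refine Submodule.eq_of_le_of_finrank_eq ?_ ?_
    · rw [vectorSpan_range_eq_span_range_vsub_right ℝ w 0, Submodule.span_le]
      rintro _ ⟨i, rfl⟩
      refine Fin.cases (by simp) (fun i => ?_) i
      simp only [vsub_eq_sub, hwd]
      exact Submodule.sum_mem _ fun j _ =>
        Submodule.smul_mem _ _ (Submodule.subset_span ⟨j, rfl⟩)
    · rw [((affineIndependent_iff_sub w).2 hindep).finrank_vectorSpan (n := k) (by simp),
        finrank_span_eq_card hlin, Fintype.card_fin]
  have hw0 : w 0 ∈ affineSpan ℝ (convexHull ℝ (Set.range w)) := by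
    rw [affineSpan_convexHull]
    exact mem_affineSpan ℝ ⟨0, rfl⟩
  have hdir : (affineSpan ℝ (convexHull ℝ (Set.range w))).direction =
      Submodule.span ℝ (Set.range d) := by
    rw [affineSpan_convexHull, direction_affineSpan, hspan]
  -- The forms c are dual to d and integral on integer points, so the edges of any integer simplex
  -- in this plane are integer combinations of d. Its volume is the volume on d times a nonzero
  -- integer.
  have hset : {V | ∃ u : Fin (k + 1) → Space, AffineIndependent ℝ u ∧
      (∀ i, IsIntegerPoint (u i) ∧ u i ∈ affineSpan ℝ (convexHull ℝ (Set.range w))) ∧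
      V = euclideanVolume k (convexHull ℝ (Set.range u))} ⊆
        Set.Ici ((comb d).normDet * stdVolume k) := by
    rintro _ ⟨u, hu, hi, rfl⟩
    have hex : ∀ i : Fin k, ∃ z : Fin k → ℤ, u i.succ - u 0 = ∑ j, (z j : ℝ) • d j := by
      intro i
      have hmem : u i.succ - u 0 ∈ Submodule.span ℝ (Set.range d) := by
        rw [← hdir]
        exact AffineSubspace.vsub_mem_direction (hi _).2 (hi _).2
      obtain ⟨x, hx⟩ := (Submodule.mem_span_range_iff_exists_fun ℝ).1 hmem
      have hint : IsIntegerPoint (u i.succ - u 0) := fun l => by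
        obtain ⟨p, hp⟩ := (hi i.succ).1 l
        obtain ⟨q, hq⟩ := (hi 0).1 l
        exact ⟨p - q, by rw [PiLp.sub_apply, hp, hq]; push_cast; rfl⟩
      choose z hz using fun j => hc j _ hint
      refine ⟨z, ?_⟩
      simp only [← hz, ← hx, hsum]
    choose Z hZ using hex
    have hZdet : (Matrix.det Z : ℤ) ≠ 0 := by
      intro h0
      have := normDet_comb_pos ((affineIndependent_iff_sub u).1 hu)
      rw [show (fun i : Fin k => u i.succ - u 0) = fun i => ∑ j, (Z i j : ℝ) • d j from funext hZ,
        normDet_comb_matrix d Z, h0] at this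
      simp at this
    have h1 : (1 : ℝ) ≤ |((Matrix.det Z : ℤ) : ℝ)| := by exact_mod_cast Int.one_le_abs hZdet
    rw [Set.mem_Ici, euclideanVolume_simplex,
      show (fun i : Fin k => u i.succ - u 0) = fun i => ∑ j, (Z i j : ℝ) • d j from funext hZ,
      normDet_comb_matrix d Z]
    nlinarith
  have hmin : sInf {V | ∃ u : Fin (k + 1) → Space, AffineIndependent ℝ u ∧
      (∀ i, IsIntegerPoint (u i) ∧ u i ∈ affineSpan ℝ (convexHull ℝ (Set.range w))) ∧
      V = euclideanVolume k (convexHull ℝ (Set.range u))} = (comb d).normDet * stdVolume k := by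
    -- The minimum is attained by the simplex on w 0 with edges d.
    refine IsLeast.csInf_eq ⟨⟨Fin.cons (w 0) fun i => d i + w 0, ?_, ?_, ?_⟩, hset⟩
    · rw [affineIndependent_iff_sub]
      simpa using hlin
    · refine Fin.cases ⟨hw, hw0⟩ fun i => ⟨fun l => ?_, ?_⟩
      · obtain ⟨p, hp⟩ := hd i l
        obtain ⟨q, hq⟩ := hw l
        exact ⟨p + q, by simp [hp, hq]⟩
      · refine AffineSubspace.vadd_mem_of_mem_direction (v := d i) ?_ hw0
        rw [hdir]
        exact Submodule.subset_span ⟨i, rfl⟩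
    · rw [euclideanVolume_simplex]
      simp
  rw [integerVolume, hmin, euclideanVolume_simplex,
    show (fun i : Fin k => w i.succ - w 0) = fun i => ∑ j, (A i j : ℝ) • d j from funext hwd,
    normDet_comb_matrix, mul_right_comm, mul_div_cancel_left₀ _ hpos.ne']

/-! ### Integer lengths and areas of the faces -/

/-- The point with given integer coordinates. -/
def intPoint (x y z : ℤ) : Space := !₂[(x : ℝ), (y : ℝ), (z : ℝ)]

lemma isIntegerPoint_intPoint (x y z : ℤ) : IsIntegerPoint (intPoint x y z) := fun i => by
  fin_cases i
  exacts [⟨x, rfl⟩, ⟨y, rfl⟩, ⟨z, rfl⟩]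

/-- The linear form with given integer coefficients. -/
def intForm (x y z : ℤ) : Space →ₗ[ℝ] ℝ where
  toFun v := x * v 0 + y * v 1 + z * v 2
  map_add' v w := by simp; ring
  map_smul' c v := by simp; ring

lemma intForm_apply (x y z : ℤ) (v : Space) : intForm x y z v = x * v 0 + y * v 1 + z * v 2 := rfl

lemma exists_intForm_eq (x y z : ℤ) {v : Space} (hv : IsIntegerPoint v) :
    ∃ k : ℤ, intForm x y z v = k := by
  obtain ⟨p, hp⟩ := hv 0
  obtain ⟨q, hq⟩ := hv 1
  obtain ⟨s, hs⟩ := hv 2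
  exact ⟨x * p + y * q + z * s, by rw [intForm_apply, hp, hq, hs]; push_cast; ring⟩

lemma isIntegerPoint_ptA (a : ℕ) : IsIntegerPoint (ptA a) := by
  convert isIntegerPoint_intPoint 1 0 (a + 2) using 1
  simp [ptA, intPoint]

lemma isIntegerPoint_ptC (a b : ℕ) : IsIntegerPoint (ptC a b) := by
  convert isIntegerPoint_intPoint (b - a - 1) 1 0 using 1
  simp [ptC, intPoint]

lemma isIntegerPoint_ptD (b : ℕ) : IsIntegerPoint (ptD b) := by
  convert isIntegerPoint_intPoint ((b + 1) ^ 2) (b + 1) 1 using 1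
  simp [ptD, intPoint]

/-- An integer form with value 1 at d certifies that d is primitive, so the length is the multiple
n. -/
lemma integerLength_eq {P Q d : Space} (x y z : ℤ) {n : ℤ} (hn : n ≠ 0) (hP : IsIntegerPoint P)
    (hd : IsIntegerPoint d) (h : intForm x y z d = 1) (hQ : Q - P = (n : ℝ) • d) :
    integerLength P Q = |(n : ℝ)| := by
  have := integerVolume_simplex (k := 1) (w := ![P, Q]) (d := fun _ => d)
    (fun _ => intForm x y z) !![n] (by simpa using hn) hP (fun _ => hd)
    (fun _ v hv => exists_intForm_eq x y z hv) (fun i j => by rw [h, if_pos (Subsingleton.elim _ _)])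
    (fun i => by fin_cases i; simpa using hQ)
  rw [Matrix.range_cons, Matrix.range_cons, Matrix.range_empty, Set.union_empty,
    Set.singleton_union, convexHull_pair] at this
  rw [integerLength, this, Matrix.det_fin_one_of]

/-- Two integer forms dual to d and e certify that these are a basis of the lattice of the plane;
the area is then a 2 × 2 determinant. -/
lemma integerArea_eq {P Q R d e : Space} (x y z x' y' z' : ℤ) {n p q s : ℤ}
    (hn : n * s - p * q ≠ 0) (hP : IsIntegerPoint P) (hd : IsIntegerPoint d)
    (he : IsIntegerPoint e) (h : intForm x y z d = 1) (h0 : intForm x y z e = 0)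
    (h0' : intForm x' y' z' d = 0) (h' : intForm x' y' z' e = 1)
    (hQ : Q - P = (n : ℝ) • d + (p : ℝ) • e) (hR : R - P = (q : ℝ) • d + (s : ℝ) • e) :
    integerArea P Q R = |(n : ℝ) * s - p * q| := by
  have := integerVolume_simplex (k := 2) (w := ![P, Q, R]) (d := ![d, e])
    ![intForm x y z, intForm x' y' z'] !![n, p; q, s] (by rwa [Matrix.det_fin_two_of]) hP
    (by simp [Fin.forall_fin_two, hd, he])
    (fun i v hv => by
      fin_cases i
      exacts [exists_intForm_eq x y z hv, exists_intForm_eq x' y' z' hv])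
    (by simp [Fin.forall_fin_two, h, h', h0, h0'])
    (by simp [Fin.forall_fin_two, hQ, hR])
  rw [Matrix.range_cons, Matrix.range_cons, Matrix.range_cons, Matrix.range_empty, Set.union_empty,
    Set.singleton_union, Set.singleton_union, Matrix.det_fin_two_of] at this
  rw [integerArea, this]
  push_cast
  rfl

lemma integerLength_AB (a : ℕ) : integerLength (ptA a) ptB = 1 := by
  have := integerLength_eq (Q := ptB) (d := intPoint (-1) 0 (-(a + 1))) (-1) 0 0 one_ne_zero
    (isIntegerPoint_ptA a) (isIntegerPoint_intPoint _ _ _) (by simp [intForm_apply, intPoint])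
    (by ext i; fin_cases i <;> simp [ptA, ptB, intPoint]; ring)
  simpa using this

lemma integerLength_BC (a b : ℕ) : integerLength ptB (ptC a b) = 1 := by
  have := integerLength_eq (Q := ptC a b) (d := intPoint (b - a - 1) 1 (-1)) 0 1 0 one_ne_zero
    isIntegerPoint_ptB (isIntegerPoint_intPoint _ _ _) (by simp [intForm_apply, intPoint])
    (by ext i; fin_cases i <;> simp [ptC, ptB, intPoint])
  simpa using this

lemma integerLength_CD (a b : ℕ) : integerLength (ptC a b) (ptD b) = 1 := by
  have := integerLength_eq (Q := ptD b) (d := intPoint ((b + 1) ^ 2 - (b - a - 1)) b 1) 0 0 1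
    one_ne_zero (isIntegerPoint_ptC a b) (isIntegerPoint_intPoint _ _ _)
    (by simp [intForm_apply, intPoint])
    (by ext i; fin_cases i <;> simp [ptC, ptD, intPoint])
  simpa using this

lemma integerLength_DA (a b : ℕ) : integerLength (ptD b) (ptA a) = 1 := by
  -- The form cancels the terms in b of the edge vector and leaves (a + 2) - (a + 1) = 1.
  have := integerLength_eq (Q := ptA a) (d := intPoint (1 - (b + 1) ^ 2) (-(b + 1)) (a + 1))
    (a + 2) (-(a + 2) * (b + 1)) (-1) one_ne_zero (isIntegerPoint_ptD b)
    (isIntegerPoint_intPoint _ _ _) (by simp [intForm_apply, intPoint]; ring)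
    (by ext i; fin_cases i <;> simp [ptA, ptD, intPoint]; ring)
  simpa using this

lemma integerLength_BD (b : ℕ) : integerLength ptB (ptD b) = b + 1 := by
  have := integerLength_eq (Q := ptD b) (d := intPoint (b + 1) 1 0) 0 1 0 (n := b + 1)
    (by positivity) isIntegerPoint_ptB (isIntegerPoint_intPoint _ _ _)
    (by simp [intForm_apply, intPoint])
    (by ext i; fin_cases i <;> simp [ptB, ptD, intPoint]; ring)
  rw [this]
  push_cast
  exact abs_of_pos (by positivity)

lemma integerArea_ABD (a b : ℕ) : integerArea (ptA a) ptB (ptD b) = b + 1 := by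
  have := integerArea_eq (P := ptA a) (Q := ptB) (R := ptD b) (d := intPoint 1 0 (a + 1))
    (e := intPoint (b + 1) 1 0) 1 (-(b + 1)) 0 0 1 0 (n := -1) (p := 0) (q := -1) (s := b + 1)
    (by push_cast; linarith) (isIntegerPoint_ptA a)
    (isIntegerPoint_intPoint _ _ _) (isIntegerPoint_intPoint _ _ _)
    (by simp [intForm_apply, intPoint]) (by simp [intForm_apply, intPoint])
    (by simp [intForm_apply, intPoint]) (by simp [intForm_apply, intPoint])
    (by ext i; fin_cases i <;> simp [ptA, ptB, intPoint]; ring)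
    (by ext i; fin_cases i <;> simp [ptA, ptD, intPoint] <;> ring)
  rw [this]
  push_cast
  rw [abs_of_neg (by linarith [(Nat.cast_nonneg b : (0 : ℝ) ≤ b)])]
  ring

lemma integerArea_BCD (a b : ℕ) : integerArea ptB (ptC a b) (ptD b) = b + 1 := by
  have := integerArea_eq (P := ptB) (Q := ptC a b) (R := ptD b) (d := intPoint (b - a - 1) 1 (-1))
    (e := intPoint (b + 1) 1 0) 0 0 (-1) 0 1 1 (n := 1) (p := 0) (q := 0) (s := b + 1)
    (by push_cast; linarith) isIntegerPoint_ptB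
    (isIntegerPoint_intPoint _ _ _) (isIntegerPoint_intPoint _ _ _)
    (by simp [intForm_apply, intPoint]) (by simp [intForm_apply, intPoint])
    (by simp [intForm_apply, intPoint]) (by simp [intForm_apply, intPoint])
    (by ext i; fin_cases i <;> simp [ptC, ptB, intPoint])
    (by ext i; fin_cases i <;> simp [ptB, ptD, intPoint]; ring)
  rw [this]
  push_cast
  rw [abs_of_pos (by linarith [(Nat.cast_nonneg b : (0 : ℝ) ≤ b)])]
  ring

/-! ### Integer distances -/

lemma intForm_eq_inner (x y z : ℤ) (v : Space) : intForm x y z v = inner ℝ (intPoint x y z) v := by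
  simp [intForm_apply, intPoint, PiLp.inner_apply, Fin.sum_univ_three]
  ring

/-- The orthogonal projection attains the distance; Cauchy–Schwarz is the lower bound. -/
lemma infDist_levelPlane {x y z : ℤ} (h : intPoint x y z ≠ 0) (c : ℝ) (q : Space) :
    Metric.infDist q (levelPlane (intForm x y z) c : Set Space) =
      |intForm x y z q - c| / ‖intPoint x y z‖ := by
  have hn : 0 < ‖intPoint x y z‖ := norm_pos_iff.2 h
  set t := (intForm x y z q - c) / ‖intPoint x y z‖ ^ 2 with ht
  have hmem : q - t • intPoint x y z ∈ (levelPlane (intForm x y z) c : Set Space) := by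
    rw [SetLike.mem_coe, mem_levelPlane, map_sub, map_smul, smul_eq_mul,
      intForm_eq_inner x y z (intPoint x y z), real_inner_self_eq_norm_sq, ht,
      div_mul_cancel₀ _ (pow_pos hn 2).ne', sub_sub_cancel]
  apply le_antisymm
  · refine (Metric.infDist_le_dist_of_mem hmem).trans_eq ?_
    rw [dist_eq_norm, sub_sub_cancel, norm_smul, ht, norm_div, Real.norm_eq_abs, norm_pow,
      norm_norm]
    field_simp
  · refine (Metric.le_infDist ⟨_, hmem⟩).2 fun p hp => ?_
    rw [SetLike.mem_coe, mem_levelPlane] at hp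
    rw [div_le_iff₀' hn, dist_eq_norm, ← hp, ← map_sub, intForm_eq_inner]
    exact abs_real_inner_le_norm _ _

/-- The point v makes the form primitive, so integer points outside the plane come as near as one
step of the form, for instance (c + 1) v. The origin is |c| steps away. -/
lemma integerDistance_levelPlane {x y z : ℤ} {v : Space} (hv : IsIntegerPoint v)
    (h : intForm x y z v = 1) (c : ℤ) :
    integerDistance (levelPlane (intForm x y z) c) 0 = |(c : ℝ)| := by
  have h0 : intPoint x y z ≠ 0 := fun h0 => by
    rw [intForm_eq_inner, h0, inner_zero_left] at h
    exact zero_ne_one h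
  have hn : 0 < ‖intPoint x y z‖ := norm_pos_iff.2 h0
  have hmin : sInf {d | ∃ q, IsIntegerPoint q ∧ q ∉ levelPlane (intForm x y z) c ∧
      d = Metric.infDist q (levelPlane (intForm x y z) c : Set Space)} = 1 / ‖intPoint x y z‖ := by
    refine IsLeast.csInf_eq ⟨⟨((c + 1 : ℤ) : ℝ) • v, fun i => ?_, ?_, ?_⟩, ?_⟩
    · obtain ⟨k, hk⟩ := hv i
      exact ⟨(c + 1) * k, by rw [PiLp.smul_apply, hk]; push_cast; rfl⟩
    · rw [mem_levelPlane, map_smul, h]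
      push_cast
      simp
    · rw [infDist_levelPlane h0, map_smul, h]
      push_cast
      simp
    · rintro _ ⟨q, hq, hq', rfl⟩
      obtain ⟨k, hk⟩ := exists_intForm_eq x y z hq
      rw [infDist_levelPlane h0]
      rw [mem_levelPlane, hk] at hq'
      rw [hk]
      gcongr
      have : k - c ≠ 0 := fun h => hq' (by rw [sub_eq_zero.1 h])
      exact_mod_cast Int.one_le_abs this
  rw [integerDistance, hmin, infDist_levelPlane h0, map_zero, zero_sub, abs_neg]
  field_simp

lemma integerDistance_ABD (a b : ℕ) :
    integerDistance (affineSpan ℝ {ptA a, ptB, ptD b}) 0 = 1 := by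
  have e : affineSpan ℝ {ptA a, ptB, ptD b} =
      levelPlane (intForm (-(a + 1)) ((a + 1) * (b + 1)) 1) (1 : ℤ) := by
    rw [affineSpan_ABD a b]
    ext v
    simp [mem_levelPlane, funABD_apply, intForm_apply]
  rw [e, integerDistance_levelPlane isIntegerPoint_ptB (by simp [intForm_apply, ptB])]
  simp

lemma integerDistance_BCD (a b : ℕ) :
    integerDistance (affineSpan ℝ {ptB, ptC a b, ptD b}) 0 = a + 2 := by
  have e : affineSpan ℝ {ptB, ptC a b, ptD b} =
      levelPlane (intForm (-1) (b + 1) (a + 2)) ((a + 2 : ℤ) : ℝ) := by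
    rw [affineSpan_BCD a b]
    ext v
    have : (a : ℝ) + 2 ≠ 0 := by positivity
    rw [mem_levelPlane, mem_levelPlane, funBCD_apply, intForm_apply]
    push_cast
    rw [div_eq_one_iff_eq this]
    constructor <;> intro h <;> linarith
  -- The form is primitive because its first coefficient is -1.
  rw [e, integerDistance_levelPlane (isIntegerPoint_intPoint (-1) 0 0)
    (by simp [intForm_apply, intPoint])]
  push_cast
  exact abs_of_pos (by positivity)

/-! ### Integer points of the edge `BD` -/

lemma integerPoints_BD (b : ℕ) : {x | x ∈ openSegment ℝ ptB (ptD b) ∧ IsIntegerPoint x} =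
    {x | ∃ i : ℕ, 1 ≤ i ∧ i ≤ b ∧ x = !₂[((b : ℝ) + 1) * i, (i : ℝ), 1]} := by
  have hb : (0 : ℝ) < b + 1 := by positivity
  ext x
  constructor
  · rintro ⟨⟨p, q, hp, hq, hpq, rfl⟩, hx⟩
    obtain ⟨k, hk⟩ := hx 1
    simp [ptB, ptD] at hk
    have h0 : (0 : ℝ) < k := hk ▸ mul_pos hq hb
    have h1 : (k : ℝ) < b + 1 := by rw [← hk]; nlinarith
    lift k to ℕ using by exact_mod_cast h0.le
    refine ⟨k, by exact_mod_cast h0, ?_, ?_⟩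
    · have : k < b + 1 := by exact_mod_cast h1
      omega
    · push_cast at hk
      ext i
      fin_cases i <;> simp [ptB, ptD, ← hk, hpq]
      ring
  · rintro ⟨i, h1, h2, rfl⟩
    have hi : (0 : ℝ) < i := by exact_mod_cast h1
    have hi' : (i : ℝ) < b + 1 := by exact_mod_cast Nat.lt_succ_of_le h2
    refine ⟨⟨1 - i / (b + 1), i / (b + 1), ?_, by positivity, by ring, ?_⟩, ?_⟩
    · rw [sub_pos, div_lt_one hb]
      exact hi'
    · ext j
      fin_cases j <;> simp [ptB, ptD] <;> field_simp
    · intro j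
      fin_cases j
      exacts [⟨(b + 1) * i, by simp⟩, ⟨i, by simp⟩, ⟨1, by simp⟩]

end KleinPolyhedron

end

theorem proposition3p1 (a b : ℕ) (m n : ℤ) (hm : m = b - a - 1) (hn : n = (a + 2) * (b + 1))
    (M : SL(3, ℤ)) (hM : M = frobeniusOperator m n)
    (A B C D : Space) (hA : A = !₂[1, 0, (a : ℝ) + 2]) (hB : B = !₂[0, 0, 1])
    (hC : C = !₂[(b : ℝ) - a - 1, 1, 0]) (hD : D = !₂[((b : ℝ) + 1) ^ 2, (b : ℝ) + 1, 1])
    (𝓕 : Set (Set Space))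
    (h𝓕 : 𝓕 = {{B}, segment ℝ A B, segment ℝ A D, segment ℝ B D,
      convexHull ℝ {A, B, D}, convexHull ℝ {B, C, D}}) :
    -- the operator defines a continued fraction of a cubic irrationality
    (Irreducible ((M : Matrix (Fin 3) (Fin 3) ℤ).map (Int.cast : ℤ → ℚ)).charpoly ∧
      ∃ r : Fin 3 → ℝ, Function.Injective r ∧
        ∀ i, Module.End.HasEigenvalue (toOperator M) (r i)) ∧
    -- the sail in question, that of the only orthant whose hull contains `(0, 0, 1)`
    ∃ O : Set Space, (IsOrthant M O ∧ B ∈ integerHull O) ∧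
      (∀ O' : Set Space, IsOrthant M O' → B ∈ integerHull O' → O' = O) ∧
      -- the homeomorphic type of the torus triangulation
      HomeomorphicDecompositions (torusTriangulation M O) squareTriangulation ∧
      -- the period group is free abelian with the generators `X` and `Y`
      (∃ X Y : SL(3, ℤ), X = M⁻¹ ^ 2 ∧
        (Y : Matrix (Fin 3) (Fin 3) ℤ) =
          (M⁻¹ : SL(3, ℤ)) *
            (((M⁻¹ : SL(3, ℤ)) : Matrix (Fin 3) (Fin 3) ℤ) - ((b : ℤ) + 1) • 1) ∧
        X * Y = Y * X ∧
        periodGroup M O = Subgroup.closure {X, Y} ∧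
        (∀ i j : ℤ, X ^ i * Y ^ j = 1 → i = 0 ∧ j = 0) ∧
        toOperator X A = D ∧ toOperator X B = C ∧
        toOperator Y A = B ∧ toOperator Y D = C) ∧
      -- the points `A`, `B`, `C`, `D` are vertices of the sail
      (IsFace O 0 {A} ∧ IsFace O 0 {B} ∧ IsFace O 0 {C} ∧ IsFace O 0 {D}) ∧
      -- a fundamental region and its closure
      (IsFundamentalFamily M O 𝓕 ∧ IsFundamentalRegion M O (openFaceUnion 𝓕) ∧
        closure (openFaceUnion 𝓕) = convexHull ℝ {A, B, D} ∪ convexHull ℝ {B, C, D}) ∧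
      -- the integer points inside the segment `BD`
      {x | x ∈ openSegment ℝ B D ∧ IsIntegerPoint x} =
        {x | ∃ i : ℕ, 1 ≤ i ∧ i ≤ b ∧ x = !₂[((b : ℝ) + 1) * i, (i : ℝ), 1]} ∧
      -- integer lengths, areas and distances
      (integerLength A B = 1 ∧ integerLength B C = 1 ∧ integerLength C D = 1 ∧
        integerLength D A = 1 ∧ integerLength B D = b + 1) ∧
      (integerArea A B D = b + 1 ∧ integerArea B C D = b + 1) ∧
      (integerDistance (affineSpan ℝ {A, B, D}) 0 = 1 ∧
        integerDistance (affineSpan ℝ {B, C, D}) 0 = a + 2) := by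
  obtain ⟨r⟩ := Roots.exists a b
  have hM' : M = frob a b := by rw [hM, hm, hn, frob]
  change A = ptA a at hA
  change B = ptB at hB
  change C = ptC a b at hC
  change D = ptD b at hD
  subst hM' hA hB hC hD
  change 𝓕 = stdFaces a b at h𝓕
  subst h𝓕
  have hA := r.isFace_vert (0, 1)
  have hB := r.isFace_vert (0, 0)
  have hC := r.isFace_vert (1, 0)
  have hD := r.isFace_vert (1, 1)
  rw [vert, ← Roots.ptA_eq] at hA
  rw [← Prod.zero_eq_mk, vert_zero] at hB
  rw [vert, ← Roots.ptC_eq] at hC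
  rw [vert, ← Roots.ptD_eq] at hD
  refine ⟨⟨charpoly_frob ▸ irreducible_frob, r.exists_eigenvalues⟩, r.orth,
    ⟨r.isOrthant_orth, r.integerHull_eq ▸ r.ptB_mem_hull⟩, fun O' => r.eq_orth,
    r.homeomorphicDecompositions,
    ⟨unitX a b, unitY a b, unitX_eq, unitY_eq, unitX_unitY_comm, r.periodGroup_eq,
      fun i j => r.eq_zero_of_zpow, unitX_ptA, unitX_ptB, unitY_ptA, unitY_ptD⟩,
    ⟨hA, hB, hC, hD⟩,
    ⟨r.isFundamentalFamily, ⟨_, r.isFundamentalFamily, rfl⟩, closure_openFaceUnion a b⟩,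
    integerPoints_BD b,
    ⟨integerLength_AB a, integerLength_BC a b, integerLength_CD a b, integerLength_DA a b,
      integerLength_BD b⟩, ⟨integerArea_ABD a b, integerArea_BCD a b⟩,
    integerDistance_ABD a b, integerDistance_BCD a b⟩
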